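/- Let $\mu>-\tfrac12$, $c_\mu=2^{\mu}\Gamma(\mu+1)$, $r(x)=x^{-\mu-1/2}$ and $s(x)=x^{2\mu+1}/c_\mu$ for $x>0$. For $1\le p<\infty$ let $L^p(sr^p)$ be the space of (classes of) measurable $f:(0,\infty)\to\mathbb C$ with norm $\|f\|=\bigl(\int_0^\infty |f|^p\,s\,r^p\,dx\bigr)^{1/p}<\infty$, and let $L^\infty(r)$ be the space of measurable $f$ with norm $\|f\|=\operatorname{ess\,sup}_{x>0}|r(x)f(x)|<\infty$. Let $\mathcal H_\mu$ be the space of all $\varphi\in C^\infty(0,\infty)$ with $\gamma_{m,k}(\varphi)=\sup_{x>0}\bigl|x^m(x^{-1}D)^k\bigl(x^{-\mu-1/2}\varphi(x)\bigr)\bigr|<\infty$ for all $m,k\ge 0$, with the topology of the seminorms $\gamma_{m,k}$, and let $\mathcal H_\mu'$ be its dual. The Bessel operator $S_\mu=\frac{d^2}{dx^2}-\frac{4\mu^2-1}{4x^2}$ maps $\mathcal H_\mu$ continuously into itself and acts on $\mathcal H_\mu'$ by $(S_\mu u,\varphi)=(u,S_\mu\varphi)$. A function $f$ in $L^p(sr^p)$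 or $L^\infty(r)$ is identified with the functional $\varphi\mapsto\int_0^\infty f\varphi\,dx$ in $\mathcal H_\mu'$. Let $S_{\mu,p}$ be the part of $S_\mu$ in $L^p(sr^p)$, i.e. $D(S_{\mu,p})=\{f\in L^p(sr^p): S_\mu f\in L^p(sr^p)\}$, $S_{\mu,p}f=S_\mu f$, and let $S_{\mu,\infty}$ be, likewise, the part of $S_\mu$ in $L^\infty(r)$. For $\lambda>0$ let $N_\lambda(x)=\lambda^{\mu/2}x^{1/2}\mathcal K_\mu(\sqrt\lambda\,x)$, where $\mathcal K_\mu(x)=\frac12\bigl(\frac x2\bigr)^{\mu}\int_0^\infty e^{-t-x^2/(4t)}\,t^{-\mu-1}\,dt$, and let $$(f\,\sharp\,g)(x)=\int_0^\infty\!\!\int_0^\infty D_\mu(x,y,z)f(y)g(z)\,dy\,dz$$ be the Hankel convolution, where $D_\mu(x,y,z)=\frac{2^{\mu-1}(xyz)^{-\mu+1/2}}{\Gamma(\mu+\frac12)\sqrt\pi}\,A(x,y,z)^{2\mu-1}$ with $A(x,y,z)=\frac14\sqrt{[(x+y)^2-z^2][z^2-(x-y)^2]}$ if $|x-y|<z<x+y$,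 and $D_\mu(x,y,z)=0$ otherwise. Then, for every $1\le p<\infty$: 1. The operators $S_{\mu,p}$ and $S_{\mu,\infty}$ are closed. 2. The operators $A=-S_{\mu,p}$ and $A=-S_{\mu,\infty}$ are non-negative, i.e. for every $\lambda>0$ the operator $\lambda+A$ is a bijection of $D(A)$ onto the whole space with bounded inverse, and $\sup_{\lambda>0}\|\lambda(\lambda+A)^{-1}\|<\infty$. More precisely, for every $\lambda>0$ and every $f$ in $L^p(sr^p)$ (respectively $L^\infty(r)$), the double integral defining $(N_\lambda\,\sharp\,f)(x)$ converges absolutely for almost every (respectively every) $x>0$, $(\lambda+A)^{-1}f=N_\lambda\,\sharp\,f$ almost everywhere, and $\|(\lambda+A)^{-1}\|\le 1/\lambda$. -/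

import Mathlib

open MeasureTheory Set Filter
open scoped ENNReal NNReal ContDiff

noncomputable section

namespace Bessel

/-- The weight `r(x) = x^{-μ-1/2}`. -/
def r (μ x : ℝ) : ℝ := x ^ (-μ - 1 / 2)

/-- The constant `c_μ = 2^μ Γ(μ+1)`. -/
def c (μ : ℝ) : ℝ := 2 ^ μ * Real.Gamma (μ + 1)

/-- The weight `s(x) = x^{2μ+1} / c_μ`. -/
def s (μ x : ℝ) : ℝ := x ^ (2 * μ + 1) / c μ

/-! ### The test space `H_μ` -/

/-- The operator `x⁻¹ D`. -/
def xinvD (ψ : ℝ → ℂ) (x : ℝ) : ℂ := (x : ℂ)⁻¹ * deriv ψ x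

/-- The function `(x⁻¹ D)^k (x^{-μ-1/2} φ)`. -/
def weightedDeriv (μ : ℝ) (k : ℕ) (φ : ℝ → ℂ) : ℝ → ℂ :=
  xinvD^[k] (fun x => (r μ x : ℂ) * φ x)

theorem xinvD_congr {f g : ℝ → ℂ} (h : EqOn f g (Ioi 0)) : EqOn (xinvD f) (xinvD g) (Ioi 0) := by
  intro x hx
  have : f =ᶠ[nhds x] g := h.eventuallyEq_of_mem (isOpen_Ioi.mem_nhds hx)
  simp only [xinvD, this.deriv_eq]

theorem xinvD_iter_congr {f g : ℝ → ℂ} (h : EqOn f g (Ioi 0)) (k : ℕ) :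
    EqOn (xinvD^[k] f) (xinvD^[k] g) (Ioi 0) := by
  induction k with
  | zero => exact h
  | succ k ih => rw [Function.iterate_succ_apply', Function.iterate_succ_apply']; exact xinvD_congr ih

theorem contDiffOn_deriv {f : ℝ → ℂ} (h : ContDiffOn ℝ ∞ f (Ioi 0)) :
    ContDiffOn ℝ ∞ (deriv f) (Ioi 0) :=
  ((contDiffOn_infty_iff_deriv_of_isOpen isOpen_Ioi).1 h).2

theorem contDiffOn_ofReal_rpow (a : ℝ) :
    ContDiffOn ℝ ∞ (fun x : ℝ => ((x ^ a : ℝ) : ℂ)) (Ioi 0) :=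
  Complex.ofRealCLM.contDiff.comp_contDiffOn
    (contDiffOn_id.rpow_const_of_ne fun _ hx => ne_of_gt hx)

theorem contDiffOn_ofReal_inv : ContDiffOn ℝ ∞ (fun x : ℝ => (x : ℂ)⁻¹) (Ioi 0) :=
  Complex.ofRealCLM.contDiff.contDiffOn.inv fun _ hx => by
    simpa using (ne_of_gt hx)

theorem contDiffOn_xinvD {f : ℝ → ℂ} (h : ContDiffOn ℝ ∞ f (Ioi 0)) :
    ContDiffOn ℝ ∞ (xinvD f) (Ioi 0) :=
  contDiffOn_ofReal_inv.mul (contDiffOn_deriv h)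

theorem contDiffOn_xinvD_iter {f : ℝ → ℂ} (h : ContDiffOn ℝ ∞ f (Ioi 0)) (k : ℕ) :
    ContDiffOn ℝ ∞ (xinvD^[k] f) (Ioi 0) := by
  induction k with
  | zero => exact h
  | succ k ih => rw [Function.iterate_succ_apply']; exact contDiffOn_xinvD ih

theorem contDiffOn_r_mul (μ : ℝ) {f : ℝ → ℂ} (h : ContDiffOn ℝ ∞ f (Ioi 0)) :
    ContDiffOn ℝ ∞ (fun x => (r μ x : ℂ) * f x) (Ioi 0) :=
  (contDiffOn_ofReal_rpow _).mul h

theorem differentiableAt_of {f : ℝ → ℂ} (h : ContDiffOn ℝ ∞ f (Ioi 0)) {x : ℝ} (hx : 0 < x) :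
    DifferentiableAt ℝ f x :=
  (h.contDiffAt (isOpen_Ioi.mem_nhds hx)).differentiableAt (by simp)

theorem xinvD_iter_add {f g : ℝ → ℂ} (hf : ContDiffOn ℝ ∞ f (Ioi 0))
    (hg : ContDiffOn ℝ ∞ g (Ioi 0)) (k : ℕ) :
    EqOn (xinvD^[k] (fun x => f x + g x)) (fun x => xinvD^[k] f x + xinvD^[k] g x) (Ioi 0) := by
  induction k with
  | zero => intro x _; rfl
  | succ k ih =>
    intro x hx
    simp only [Function.iterate_succ_apply']
    rw [xinvD_congr ih hx]
    have h1 := differentiableAt_of (contDiffOn_xinvD_iter hf k) hx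
    have h2 := differentiableAt_of (contDiffOn_xinvD_iter hg k) hx
    simp only [xinvD, deriv_fun_add h1 h2]
    ring

theorem xinvD_iter_const_mul (a : ℂ) (f : ℝ → ℂ) (k : ℕ) :
    xinvD^[k] (fun x => a * f x) = fun x => a * xinvD^[k] f x := by
  induction k with
  | zero => rfl
  | succ k ih =>
    simp only [Function.iterate_succ_apply', ih]
    funext x
    simp only [xinvD, deriv_const_mul_field]
    ring

theorem weightedDeriv_add (μ : ℝ) {f g : ℝ → ℂ} (hf : ContDiffOn ℝ ∞ f (Ioi 0))
    (hg : ContDiffOn ℝ ∞ g (Ioi 0)) (k : ℕ) {x : ℝ} (hx : 0 < x) :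
    weightedDeriv μ k (f + g) x = weightedDeriv μ k f x + weightedDeriv μ k g x := by
  have := xinvD_iter_add (contDiffOn_r_mul μ hf) (contDiffOn_r_mul μ hg) k hx
  simpa only [weightedDeriv, Pi.add_apply, mul_add] using this

theorem weightedDeriv_smul (μ : ℝ) (a : ℂ) (f : ℝ → ℂ) (k : ℕ) (x : ℝ) :
    weightedDeriv μ k (a • f) x = a * weightedDeriv μ k f x := by
  have := congrFun (xinvD_iter_const_mul a (fun x => (r μ x : ℂ) * f x) k) x
  simp only [weightedDeriv, Pi.smul_apply, smul_eq_mul]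
  rw [← this]
  have e : (fun x => (r μ x : ℂ) * (a * f x)) = fun x => a * ((r μ x : ℂ) * f x) := by
    funext y
    ring
  rw [e]

/-- The space `H_μ`: smooth functions `φ` on `(0,∞)` (extended by `0` to the real line) such that
`x^m (x⁻¹D)^k (x^{-μ-1/2} φ)` is bounded on `(0,∞)` for all `m`, `k`. -/
def Hmu (μ : ℝ) : Submodule ℂ (ℝ → ℂ) where
  carrier := {φ | (∀ x ≤ 0, φ x = 0) ∧ ContDiffOn ℝ ∞ φ (Ioi 0) ∧
    ∀ m k : ℕ, BddAbove (range fun x : Ioi (0 : ℝ) => ‖((x : ℝ) : ℂ) ^ m * weightedDeriv μ k φ x‖)}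
  add_mem' := by
    rintro f g ⟨hf0, hf, hfb⟩ ⟨hg0, hg, hgb⟩
    refine ⟨fun x hx => by simp [hf0 x hx, hg0 x hx], hf.add hg, fun m k => ?_⟩
    obtain ⟨A, hA⟩ := hfb m k
    obtain ⟨B, hB⟩ := hgb m k
    refine ⟨A + B, ?_⟩
    rintro _ ⟨x, rfl⟩
    simp only [weightedDeriv_add μ hf hg k x.2, mul_add]
    exact (norm_add_le _ _).trans (add_le_add (hA ⟨x, rfl⟩) (hB ⟨x, rfl⟩))
  zero_mem' := by
    refine ⟨fun _ _ => rfl, contDiffOn_const, fun m k => ⟨0, ?_⟩⟩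
    rintro _ ⟨x, rfl⟩
    have := weightedDeriv_smul μ 0 (0 : ℝ → ℂ) k x
    rw [zero_smul, zero_mul] at this
    simp [this]
  smul_mem' := by
    rintro a f ⟨hf0, hf, hfb⟩
    refine ⟨fun x hx => by simp [hf0 x hx], contDiffOn_const.smul hf, fun m k => ?_⟩
    obtain ⟨A, hA⟩ := hfb m k
    refine ⟨‖a‖ * A, ?_⟩
    rintro _ ⟨x, rfl⟩
    simp only [weightedDeriv_smul, mul_left_comm _ a, norm_mul a]
    exact mul_le_mul_of_nonneg_left (hA ⟨x, rfl⟩) (norm_nonneg _)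

/-- The seminorm `γ_{m,k}(φ) = sup_{x>0} |x^m (x⁻¹D)^k (x^{-μ-1/2} φ(x))|` on `H_μ`. -/
def gamma (μ : ℝ) (m k : ℕ) : Seminorm ℂ (Hmu μ) :=
  Seminorm.of
    (fun φ => ⨆ x : Ioi (0 : ℝ), ‖((x : ℝ) : ℂ) ^ m * weightedDeriv μ k (φ : ℝ → ℂ) x‖)
    (by
      intro f g
      have : Nonempty (Ioi (0 : ℝ)) := ⟨⟨1, mem_Ioi.2 one_pos⟩⟩
      refine ciSup_le fun x => ?_
      simp only [Submodule.coe_add, weightedDeriv_add μ f.2.2.1 g.2.2.1 k x.2, mul_add]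
      exact (norm_add_le _ _).trans
        (add_le_add (le_ciSup (f.2.2.2 m k) x) (le_ciSup (g.2.2.2 m k) x)))
    (by
      intro a f
      rw [Real.mul_iSup_of_nonneg (norm_nonneg a)]
      refine iSup_congr fun x => ?_
      simp only [Submodule.coe_smul, weightedDeriv_smul, mul_left_comm _ a, norm_mul a])

theorem le_gamma (μ : ℝ) (m k : ℕ) (φ : Hmu μ) {x : ℝ} (hx : 0 < x) :
    ‖(x : ℂ) ^ m * weightedDeriv μ k (φ : ℝ → ℂ) x‖ ≤ gamma μ m k φ :=
  le_ciSup (φ.2.2.2 m k) (⟨x, hx⟩ : Ioi (0 : ℝ))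

theorem gamma_le (μ : ℝ) (m k : ℕ) (φ : Hmu μ) {C : ℝ}
    (h : ∀ x : ℝ, 0 < x → ‖(x : ℂ) ^ m * weightedDeriv μ k (φ : ℝ → ℂ) x‖ ≤ C) :
    gamma μ m k φ ≤ C := by
  have : Nonempty (Ioi (0 : ℝ)) := ⟨⟨1, mem_Ioi.2 one_pos⟩⟩
  exact ciSup_le fun x => h x x.2

/-- The family of seminorms `γ_{m,k}`. -/
def gammaFamily (μ : ℝ) : SeminormFamily ℂ (Hmu μ) (ℕ × ℕ) := fun i => gamma μ i.1 i.2

/-- `H_μ` carries the topology given by the seminorms `γ_{m,k}`. -/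
instance instTopHmu (μ : ℝ) : TopologicalSpace (Hmu μ) := (gammaFamily μ).moduleFilterBasis.topology

theorem withSeminorms_Hmu (μ : ℝ) : WithSeminorms (gammaFamily μ) := ⟨rfl⟩

instance instTopGroupHmu (μ : ℝ) : IsTopologicalAddGroup (Hmu μ) :=
  (withSeminorms_Hmu μ).topologicalAddGroup

/-- The dual space `H'_μ`. -/
abbrev HmuDual (μ : ℝ) : Type := Hmu μ →L[ℂ] ℂ

/-! ### The Bessel operator on `H_μ` and on `H'_μ` -/

/-- `S_μ φ = φ'' - (4μ² - 1)/(4x²) φ` on `(0,∞)` (and `0` elsewhere). -/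
def besselFun (μ : ℝ) (φ : ℝ → ℂ) : ℝ → ℂ :=
  (Ioi (0 : ℝ)).indicator fun x =>
    deriv (deriv φ) x - (((4 * μ ^ 2 - 1) / (4 * x ^ 2) : ℝ) : ℂ) * φ x

theorem contDiffOn_besselFun (μ : ℝ) {φ : ℝ → ℂ} (h : ContDiffOn ℝ ∞ φ (Ioi 0)) :
    ContDiffOn ℝ ∞ (besselFun μ φ) (Ioi 0) := by
  have h1 : ContDiffOn ℝ ∞ (fun x : ℝ =>
      deriv (deriv φ) x - (((4 * μ ^ 2 - 1) / (4 * x ^ 2) : ℝ) : ℂ) * φ x) (Ioi 0) := by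
    refine (contDiffOn_deriv (contDiffOn_deriv h)).sub (ContDiffOn.mul ?_ h)
    refine Complex.ofRealCLM.contDiff.comp_contDiffOn (contDiffOn_const.div (by fun_prop) ?_)
    intro x hx
    have : (0 : ℝ) < x := hx
    positivity
  exact h1.congr fun x hx => indicator_of_mem hx _

/-- `x^{-μ-1/2} S_μ φ = x² (x⁻¹D)² ψ + (2μ+2) (x⁻¹D) ψ` with `ψ = x^{-μ-1/2} φ`. -/
theorem r_mul_besselFun (μ : ℝ) {φ : ℝ → ℂ} (h : ContDiffOn ℝ ∞ φ (Ioi 0)) :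
    EqOn (fun x => (r μ x : ℂ) * besselFun μ φ x)
      (fun x => (x : ℂ) ^ 2 * weightedDeriv μ 2 φ x + (2 * μ + 2) * weightedDeriv μ 1 φ x)
      (Ioi 0) := by
  have hr : ∀ (a x : ℝ), 0 < x →
      HasDerivAt (fun y : ℝ => ((y ^ a : ℝ) : ℂ)) ((a : ℂ) * ((x ^ (a - 1) : ℝ) : ℂ)) x := by
    intro a x hx
    have := (Real.hasDerivAt_rpow_const (p := a) (Or.inl hx.ne')).ofReal_comp
    push_cast at this ⊢
    exact this
  have hd1 : ∀ x : ℝ, 0 < x → HasDerivAt φ (deriv φ x) x :=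
    fun x hx => (differentiableAt_of h hx).hasDerivAt
  have hd2 : ∀ x : ℝ, 0 < x → HasDerivAt (deriv φ) (deriv (deriv φ) x) x :=
    fun x hx => (differentiableAt_of (contDiffOn_deriv h) hx).hasDerivAt
  have h1 : EqOn (weightedDeriv μ 1 φ)
      (fun x => ((-μ - 1 / 2 : ℝ) : ℂ) * (((x ^ (-μ - 1 / 2 - 2) : ℝ) : ℂ) * φ x)
        + ((x ^ (-μ - 1 / 2 - 1) : ℝ) : ℂ) * deriv φ x) (Ioi 0) := by
    intro x hx
    have hx0 : (0 : ℝ) < x := hx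
    have hxc : (x : ℂ) ≠ 0 := by exact_mod_cast hx0.ne'
    have e : weightedDeriv μ 1 φ x = (x : ℂ)⁻¹ * deriv (fun y => (r μ y : ℂ) * φ y) x := rfl
    rw [e]
    have := ((hr (-μ - 1 / 2) x hx).mul (hd1 x hx)).deriv
    have e2 : (fun y => (r μ y : ℂ) * φ y)
      = (fun y : ℝ => ((y ^ (-μ - 1 / 2) : ℝ) : ℂ)) * φ := rfl
    rw [e2, this]
    have q1 : x ^ (-μ - 1 / 2 - 1) = x ^ (-μ - 1 / 2) / x := by
      rw [Real.rpow_sub hx0, Real.rpow_one]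
    have q2 : x ^ (-μ - 1 / 2 - 2) = x ^ (-μ - 1 / 2) / x ^ 2 := by
      rw [Real.rpow_sub hx0, Real.rpow_two]
    simp only [q1, q2]
    generalize x ^ (-μ - 1 / 2) = X
    push_cast
    field_simp
  intro x hx
  have hx0 : (0 : ℝ) < x := hx
  have hxc : (x : ℂ) ≠ 0 := by exact_mod_cast hx0.ne'
  have e : weightedDeriv μ 2 φ x = xinvD (weightedDeriv μ 1 φ) x := rfl
  have h2 := ((((hr (-μ - 1 / 2 - 2) x hx).mul (hd1 x hx)).const_mul
    ((-μ - 1 / 2 : ℝ) : ℂ)).add ((hr (-μ - 1 / 2 - 1) x hx).mul (hd2 x hx))).deriv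
  have h3 := (e.trans (xinvD_congr h1 hx)).trans (congrArg (fun z => (x : ℂ)⁻¹ * z) h2)
  beta_reduce at h3 ⊢
  rw [h3, h1 hx, besselFun, indicator_of_mem hx, r]
  beta_reduce
  have hp : ∀ n : ℕ, x ^ (-μ - 1 / 2 - n) = x ^ (-μ - 1 / 2) / x ^ n := fun n => by
    rw [Real.rpow_sub hx0, Real.rpow_natCast]
  have q1 := hp 1
  have q2 := hp 2
  have q3 := hp 3
  rw [show -μ - 1 / 2 - 2 - 1 = -μ - 1 / 2 - ((3 : ℕ) : ℝ) by push_cast; ring,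
    show -μ - 1 / 2 - 1 - 1 = -μ - 1 / 2 - ((2 : ℕ) : ℝ) by push_cast; ring,
    show -μ - 1 / 2 - 2 = -μ - 1 / 2 - ((2 : ℕ) : ℝ) by push_cast; ring,
    show -μ - 1 / 2 - 1 = -μ - 1 / 2 - ((1 : ℕ) : ℝ) by push_cast; ring, q1, q2, q3]
  generalize x ^ (-μ - 1 / 2) = X
  push_cast
  field_simp
  ring

theorem weightedDeriv_besselFun (μ : ℝ) {φ : ℝ → ℂ} (h : ContDiffOn ℝ ∞ φ (Ioi 0)) (k : ℕ) :
    EqOn (weightedDeriv μ k (besselFun μ φ))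
      (fun x => (x : ℂ) ^ 2 * weightedDeriv μ (k + 2) φ x
        + (2 * k + 2 * μ + 2) * weightedDeriv μ (k + 1) φ x) (Ioi 0) := by
  induction k with
  | zero => simpa [weightedDeriv] using r_mul_besselFun μ h
  | succ k ih =>
    intro x hx
    have hx0 : (0 : ℝ) < x := hx
    have hxc : (x : ℂ) ≠ 0 := by exact_mod_cast hx0.ne'
    have e : ∀ (j : ℕ) (f : ℝ → ℂ), weightedDeriv μ (j + 1) f = xinvD (weightedDeriv μ j f) :=
      fun j f => Function.iterate_succ_apply' _ _ _
    have hd : ∀ j, HasDerivAt (weightedDeriv μ j φ) (x * weightedDeriv μ (j + 1) φ x) x := by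
      intro j
      have := (differentiableAt_of (contDiffOn_xinvD_iter (contDiffOn_r_mul μ h) j) hx).hasDerivAt
      rw [e, xinvD, mul_inv_cancel_left₀ hxc]
      exact this
    have h2 : HasDerivAt (fun y : ℝ => (y : ℂ) ^ 2) (2 * x) x := by
      have := (hasDerivAt_id x).ofReal_comp.fun_pow 2
      simpa using! this
    have h3 := ((h2.mul (hd (k + 2))).add ((hd (k + 1)).const_mul (2 * (k : ℂ) + 2 * μ + 2))).deriv
    rw [e k (besselFun μ φ), xinvD_congr ih hx]
    refine (congrArg (fun z => (x : ℂ)⁻¹ * z) h3).trans ?_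
    simp only [show k + 1 + 2 = k + 2 + 1 from rfl, show k + 1 + 1 = k + 2 from rfl]
    push_cast
    field_simp
    ring

theorem norm_weightedDeriv_besselFun_le (μ : ℝ) (φ : Hmu μ) (m k : ℕ) {x : ℝ} (hx : 0 < x) :
    ‖(x : ℂ) ^ m * weightedDeriv μ k (besselFun μ φ) x‖ ≤
      gamma μ (m + 2) (k + 2) φ + ‖(2 * k + 2 * μ + 2 : ℂ)‖ * gamma μ m (k + 1) φ := by
  rw [weightedDeriv_besselFun μ φ.2.2.1 k hx]
  simp only
  have : (x : ℂ) ^ m * ((x : ℂ) ^ 2 * weightedDeriv μ (k + 2) φ x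
        + (2 * k + 2 * μ + 2) * weightedDeriv μ (k + 1) φ x)
      = (x : ℂ) ^ (m + 2) * weightedDeriv μ (k + 2) φ x
        + (2 * k + 2 * μ + 2) * ((x : ℂ) ^ m * weightedDeriv μ (k + 1) φ x) := by ring
  rw [this]
  refine (norm_add_le _ _).trans (add_le_add (le_gamma μ _ _ φ hx) ?_)
  rw [norm_mul]
  exact mul_le_mul_of_nonneg_left (le_gamma μ _ _ φ hx) (norm_nonneg _)

/-- `S_μ` as a linear operator of `H_μ`. -/
def besselLin (μ : ℝ) : Hmu μ →ₗ[ℂ] Hmu μ where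
  toFun φ := ⟨besselFun μ φ, by
    refine ⟨fun x hx => indicator_of_notMem (by simpa using hx) _,
      contDiffOn_besselFun μ φ.2.2.1, fun m k =>
      ⟨gamma μ (m + 2) (k + 2) φ + ‖(2 * k + 2 * μ + 2 : ℂ)‖ * gamma μ m (k + 1) φ, ?_⟩⟩
    · rintro _ ⟨x, rfl⟩
      exact norm_weightedDeriv_besselFun_le μ φ m k x.2⟩
  map_add' f g := by
    ext x
    simp only [besselFun, Submodule.coe_add, Pi.add_apply]
    by_cases hx : x ∈ Ioi (0 : ℝ)
    · simp only [indicator_of_mem hx]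
      have h1 : EqOn (deriv ((f : ℝ → ℂ) + (g : ℝ → ℂ))) (deriv (f : ℝ → ℂ) + deriv (g : ℝ → ℂ)) (Ioi 0) :=
        fun y hy => deriv_add (differentiableAt_of f.2.2.1 hy) (differentiableAt_of g.2.2.1 hy)
      rw [(h1.eventuallyEq_of_mem (isOpen_Ioi.mem_nhds hx)).deriv_eq,
        deriv_add (differentiableAt_of (contDiffOn_deriv f.2.2.1) hx)
          (differentiableAt_of (contDiffOn_deriv g.2.2.1) hx)]
      ring
    · simp only [indicator_of_notMem hx, add_zero]
  map_smul' a f := by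
    ext x
    simp only [besselFun, Submodule.coe_smul, Pi.smul_apply, RingHom.id_apply]
    by_cases hx : x ∈ Ioi (0 : ℝ)
    · simp only [indicator_of_mem hx, smul_eq_mul]
      have h1 : deriv (a • (f : ℝ → ℂ)) = a • deriv (f : ℝ → ℂ) := by
        funext y
        exact deriv_const_mul_field a
      have h2 : deriv (a • deriv (f : ℝ → ℂ)) x = a * deriv (deriv (f : ℝ → ℂ)) x :=
        deriv_const_mul_field a
      rw [h1, h2]
      ring
    · simp only [indicator_of_notMem hx, smul_zero]

/-- `S_μ : H_μ → H_μ` as a continuous linear operator. -/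
def besselCLM (μ : ℝ) : Hmu μ →L[ℂ] Hmu μ where
  toLinearMap := besselLin μ
  cont := by
    refine WithSeminorms.continuous_of_isBounded (withSeminorms_Hmu μ) (withSeminorms_Hmu μ) _
      (Seminorm.IsBounded.of_real ?_)
    rintro ⟨m, k⟩
    refine ⟨{(m + 2, k + 2), (m, k + 1)}, 1 + ‖(2 * k + 2 * μ + 2 : ℂ)‖, fun φ => ?_⟩
    have hle : ∀ i ∈ ({(m + 2, k + 2), (m, k + 1)} : Finset (ℕ × ℕ)), gammaFamily μ i φ ≤
        (({(m + 2, k + 2), (m, k + 1)} : Finset (ℕ × ℕ)).sup (gammaFamily μ)) φ :=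
      fun i hi => (Finset.le_sup (f := gammaFamily μ) hi : _ ≤ _) φ
    have h1 := hle (m + 2, k + 2) (by simp)
    have h2 := hle (m, k + 1) (by simp)
    have h3 : gammaFamily μ (m, k) (besselLin μ φ) ≤
        gamma μ (m + 2) (k + 2) φ + ‖(2 * k + 2 * μ + 2 : ℂ)‖ * gamma μ m (k + 1) φ :=
      gamma_le μ m k _ fun x hx => norm_weightedDeriv_besselFun_le μ φ m k hx
    refine h3.trans ?_
    rw [add_mul, one_mul]
    exact add_le_add h1 (mul_le_mul_of_nonneg_left h2 (norm_nonneg _))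

/-- The distributional Bessel operator on `H'_μ`: `(S_μ u, φ) = (u, S_μ φ)`. -/
def besselDual (μ : ℝ) : HmuDual μ →ₗ[ℂ] HmuDual μ where
  toFun u := u.comp (besselCLM μ)
  map_add' _ _ := rfl
  map_smul' _ _ := rfl

/-! ### Functions as regular elements of `H'_μ` -/

/-- The exponent used to bound test functions at infinity. -/
def decayExp (μ : ℝ) : ℕ := ⌈2 * μ + 2⌉₊ + 1

/-- The weight `x^{μ+1/2} / (1 + x^m)`, which dominates every element of `H_μ`. -/
def testWeight (μ x : ℝ) : ℝ := x ^ (μ + 1 / 2) / (1 + x ^ decayExp μ)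

theorem r_pos (μ : ℝ) {x : ℝ} (hx : 0 < x) : 0 < r μ x := Real.rpow_pos_of_pos hx _

theorem c_pos {μ : ℝ} (hμ : -1 / 2 < μ) : 0 < c μ :=
  mul_pos (Real.rpow_pos_of_pos two_pos _) (Real.Gamma_pos_of_pos (by linarith))

theorem s_pos {μ : ℝ} (hμ : -1 / 2 < μ) {x : ℝ} (hx : 0 < x) : 0 < s μ x :=
  div_pos (Real.rpow_pos_of_pos hx _) (c_pos hμ)

theorem testWeight_pos (μ : ℝ) {x : ℝ} (hx : 0 < x) : 0 < testWeight μ x := by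
  have := Real.rpow_pos_of_pos hx (μ + 1 / 2)
  unfold testWeight
  positivity

theorem continuousOn_testWeight (μ : ℝ) : ContinuousOn (testWeight μ) (Ioi 0) := by
  refine ContinuousOn.div
    (continuousOn_id.rpow_const fun x hx => Or.inl (ne_of_gt hx)) (by fun_prop) ?_
  intro x hx
  have : (0 : ℝ) < x := hx
  positivity

theorem norm_test_le (μ : ℝ) (φ : Hmu μ) {x : ℝ} (hx : 0 < x) :
    ‖(φ : ℝ → ℂ) x‖ ≤ (gamma μ 0 0 φ + gamma μ (decayExp μ) 0 φ) * testWeight μ x := by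
  have h0 := le_gamma μ 0 0 φ hx
  have h1 := le_gamma μ (decayExp μ) 0 φ hx
  have e : weightedDeriv μ 0 (φ : ℝ → ℂ) x = (r μ x : ℂ) * (φ : ℝ → ℂ) x := rfl
  have hX := Real.rpow_pos_of_pos hx (μ + 1 / 2)
  have hr : r μ x = (x ^ (μ + 1 / 2))⁻¹ := by
    rw [r, ← Real.rpow_neg hx.le]
    congr 1
    ring
  rw [e, hr] at h0 h1
  simp only [norm_mul, norm_pow, Complex.norm_real, Real.norm_eq_abs, abs_of_pos hx,
    abs_of_pos (inv_pos.2 hX), pow_zero, one_mul] at h0 h1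
  rw [testWeight, mul_div_assoc', le_div_iff₀ (by positivity)]
  have h2 := mul_le_mul_of_nonneg_right (add_le_add h0 h1) hX.le
  refine le_trans (le_of_eq ?_) h2
  field_simp

theorem integrableOn_mul_test {μ : ℝ} {f : ℝ → ℂ}
    (hf : IntegrableOn (fun x => (testWeight μ x : ℂ) * f x) (Ioi 0)) (φ : Hmu μ) :
    IntegrableOn (fun x => f x * (φ : ℝ → ℂ) x) (Ioi 0) := by
  have hm : AEStronglyMeasurable (fun x => f x * (φ : ℝ → ℂ) x) (volume.restrict (Ioi 0)) := by
    have hw : ContinuousOn (fun x => (testWeight μ x : ℂ)⁻¹) (Ioi 0) :=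
      (Complex.continuous_ofReal.comp_continuousOn (continuousOn_testWeight μ)).inv₀
        fun x hx => Complex.ofReal_ne_zero.2 (testWeight_pos μ hx).ne'
    have h1 := (hw.aestronglyMeasurable measurableSet_Ioi).mul hf.aestronglyMeasurable
    have h2 := h1.mul (φ.2.2.1.continuousOn.aestronglyMeasurable measurableSet_Ioi)
    refine h2.congr ((ae_restrict_iff' measurableSet_Ioi).2 (ae_of_all _ fun x hx => ?_))
    have : (testWeight μ x : ℂ) ≠ 0 := by exact_mod_cast (testWeight_pos μ hx).ne'
    simp only [Pi.mul_apply]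
    rw [inv_mul_cancel_left₀ this]
  refine (hf.norm.const_mul (gamma μ 0 0 φ + gamma μ (decayExp μ) 0 φ)).mono' hm
    ((ae_restrict_iff' measurableSet_Ioi).2 (ae_of_all _ fun x hx => ?_))
  rw [norm_mul, norm_mul, Complex.norm_real, Real.norm_eq_abs, abs_of_pos (testWeight_pos μ hx),
    ← mul_assoc, mul_comm ‖f x‖]
  exact mul_le_mul_of_nonneg_right (norm_test_le μ φ hx) (norm_nonneg _)

/-- The linear form `φ ↦ ∫₀^∞ f φ` on `H_μ`. -/
def regularForm (μ : ℝ) (f : ℝ → ℂ)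
    (hf : IntegrableOn (fun x => (testWeight μ x : ℂ) * f x) (Ioi 0)) : Hmu μ →ₗ[ℂ] ℂ where
  toFun φ := ∫ x in Ioi 0, f x * (φ : ℝ → ℂ) x
  map_add' φ ψ := by
    rw [← integral_add (integrableOn_mul_test hf φ) (integrableOn_mul_test hf ψ)]
    simp only [Submodule.coe_add, Pi.add_apply, mul_add]
  map_smul' a φ := by
    simp only [Submodule.coe_smul, Pi.smul_apply, smul_eq_mul, RingHom.id_apply, mul_left_comm _ a]
    exact integral_const_mul a _

/-- The regular element `T_f` of `H'_μ`: `(T_f, φ) = ∫₀^∞ f φ`. -/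
def regularElement (μ : ℝ) (f : ℝ → ℂ)
    (hf : IntegrableOn (fun x => (testWeight μ x : ℂ) * f x) (Ioi 0)) : HmuDual μ where
  toLinearMap := regularForm μ f hf
  cont := by
    refine WithSeminorms.continuous_normedSpace_rng ℂ (withSeminorms_Hmu μ)
      (regularForm μ f hf) ?_
    refine ⟨{(0, 0), (decayExp μ, 0)},
      2 * (∫ x in Ioi 0, ‖(testWeight μ x : ℂ) * f x‖).toNNReal, fun φ => ?_⟩
    have hle : ∀ i ∈ ({(0, 0), (decayExp μ, 0)} : Finset (ℕ × ℕ)), gammaFamily μ i φ ≤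
        (({(0, 0), (decayExp μ, 0)} : Finset (ℕ × ℕ)).sup (gammaFamily μ)) φ :=
      fun i hi => (Finset.le_sup (f := gammaFamily μ) hi : _ ≤ _) φ
    have h1 : gamma μ 0 0 φ ≤ _ := hle (0, 0) (by simp)
    have h2 : gamma μ (decayExp μ) 0 φ ≤ _ := hle (decayExp μ, 0) (by simp)
    have hI : 0 ≤ ∫ x in Ioi 0, ‖(testWeight μ x : ℂ) * f x‖ :=
      integral_nonneg fun _ => norm_nonneg _
    have h3 : ‖∫ x in Ioi 0, f x * (φ : ℝ → ℂ) x‖ ≤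
        (gamma μ 0 0 φ + gamma μ (decayExp μ) 0 φ) *
          ∫ x in Ioi 0, ‖(testWeight μ x : ℂ) * f x‖ := by
      rw [← integral_const_mul]
      refine norm_integral_le_of_norm_le (hf.norm.const_mul _)
        ((ae_restrict_iff' measurableSet_Ioi).2 (ae_of_all _ fun x hx => ?_))
      rw [norm_mul, norm_mul, Complex.norm_real, Real.norm_eq_abs,
        abs_of_pos (testWeight_pos μ hx), ← mul_assoc, mul_comm ‖f x‖]
      exact mul_le_mul_of_nonneg_right (norm_test_le μ φ hx) (norm_nonneg _)
    refine h3.trans ((mul_le_mul_of_nonneg_right (add_le_add h1 h2) hI).trans (le_of_eq ?_))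
    simp only [smul_apply, NNReal.smul_def, NNReal.coe_mul, Real.coe_toNNReal _ hI,
      smul_eq_mul, NNReal.coe_ofNat]
    ring

/-- Smooth functions with compact support in `(0,∞)`. -/
def IsTestFun (ψ : ℝ → ℂ) : Prop :=
  ContDiff ℝ ∞ ψ ∧ HasCompactSupport ψ ∧ tsupport ψ ⊆ Ioi 0

theorem IsTestFun.mul {h ψ : ℝ → ℂ} (hh : ContDiffOn ℝ ∞ h (Ioi 0)) (hψ : IsTestFun ψ) :
    IsTestFun (fun x => h x * ψ x) := by
  have hs : tsupport (fun x => h x * ψ x) ⊆ tsupport ψ := tsupport_mul_subset_right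
  refine ⟨contDiff_iff_contDiffAt.2 fun x => ?_, hψ.2.1.mul_left, hs.trans hψ.2.2⟩
  by_cases hx : x ∈ tsupport ψ
  · exact (hh.contDiffAt (isOpen_Ioi.mem_nhds (hψ.2.2 hx))).mul hψ.1.contDiffAt
  · have h0 : (fun x => h x * ψ x) =ᶠ[nhds x] fun _ => 0 :=
      notMem_tsupport_iff_eventuallyEq.1 fun h' => hx (hs h')
    exact contDiffAt_const.congr_of_eventuallyEq h0

theorem IsTestFun.xinvD {ψ : ℝ → ℂ} (hψ : IsTestFun ψ) : IsTestFun (xinvD ψ) :=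
  IsTestFun.mul contDiffOn_ofReal_inv
    ⟨(contDiff_infty_iff_deriv.1 hψ.1).2, hψ.2.1.deriv, tsupport_deriv_subset.trans hψ.2.2⟩

/-- `D(0,∞)` is contained in `H_μ`. -/
theorem IsTestFun.mem_Hmu (μ : ℝ) {ψ : ℝ → ℂ} (hψ : IsTestFun ψ) : ψ ∈ Hmu μ := by
  refine ⟨fun x hx => ?_, hψ.1.contDiffOn, fun m k => ?_⟩
  · by_contra h
    exact absurd (hψ.2.2 (subset_tsupport _ h)) (by simpa using hx)
  · have h1 : IsTestFun (weightedDeriv μ k ψ) := by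
      induction k with
      | zero => exact IsTestFun.mul (contDiffOn_ofReal_rpow _) hψ
      | succ k ih =>
        have e : weightedDeriv μ (k + 1) ψ = Bessel.xinvD (weightedDeriv μ k ψ) :=
          Function.iterate_succ_apply' _ _ _
        rw [e]
        exact ih.xinvD
    have h2 : IsTestFun (fun x => (x : ℂ) ^ m * weightedDeriv μ k ψ x) :=
      IsTestFun.mul (Complex.ofRealCLM.contDiff.pow m).contDiffOn h1
    obtain ⟨C, hC⟩ := h2.2.1.exists_bound_of_continuous h2.1.continuous
    exact ⟨C, by rintro _ ⟨x, rfl⟩; exact hC x⟩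

/-- A regular element that vanishes is given by a function that vanishes almost everywhere. -/
theorem ae_eq_zero_of_regularElement {μ : ℝ} {f : ℝ → ℂ}
    (hf : IntegrableOn (fun x => (testWeight μ x : ℂ) * f x) (Ioi 0))
    (h : ∀ φ : Hmu μ, ∫ x in Ioi 0, f x * (φ : ℝ → ℂ) x = 0) :
    ∀ᵐ x ∂volume.restrict (Ioi 0), f x = 0 := by
  rw [ae_restrict_iff' measurableSet_Ioi]
  have hw : ContinuousOn (fun x => (testWeight μ x : ℂ)⁻¹) (Ioi 0) :=
    (Complex.continuous_ofReal.comp_continuousOn (continuousOn_testWeight μ)).inv₀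
      fun x hx => Complex.ofReal_ne_zero.2 (testWeight_pos μ hx).ne'
  have h1 := hf.locallyIntegrableOn.continuousOn_mul hw isOpen_Ioi.isLocallyClosed
  have h2 : LocallyIntegrableOn f (Ioi 0) := by
    refine h1.congr ((ae_restrict_iff' measurableSet_Ioi).2 (ae_of_all _ fun x hx => ?_))
    have : (testWeight μ x : ℂ) ≠ 0 := by exact_mod_cast (testWeight_pos μ hx).ne'
    exact inv_mul_cancel_left₀ this _
  refine isOpen_Ioi.ae_eq_zero_of_integral_contDiff_smul_eq_zero h2 fun g hg hc hs => ?_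
  have hsub : tsupport (fun x => (g x : ℂ)) ⊆ tsupport g :=
    closure_mono fun x hx => by simpa using hx
  have hT : IsTestFun (fun x => (g x : ℂ)) :=
    ⟨Complex.ofRealCLM.contDiff.comp hg, hc.comp_left Complex.ofReal_zero, hsub.trans hs⟩
  have h3 := h ⟨_, hT.mem_Hmu μ⟩
  rw [← h3]
  rw [setIntegral_eq_integral_of_forall_compl_eq_zero]
  · refine integral_congr_ae (ae_of_all _ fun x => ?_)
    simp only [Complex.real_smul]
    ring
  · intro x hx
    simp only [(hT.mem_Hmu μ).1 x (by simpa using hx), mul_zero]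

theorem testWeight_eq {μ : ℝ} (hμ : -1 / 2 < μ) {x : ℝ} (hx : 0 < x) :
    testWeight μ x = c μ * (r μ x * ((1 + x ^ decayExp μ)⁻¹ * s μ x)) := by
  have hc := (c_pos hμ).ne'
  have : x ^ (2 * μ + 1) * x ^ (-μ - 1 / 2) = x ^ (μ + 1 / 2) := by
    rw [← Real.rpow_add hx]
    congr 1
    ring
  rw [testWeight, s, r, ← this]
  have : 1 + x ^ decayExp μ ≠ 0 := by positivity
  field_simp

theorem integrableOn_decay_mul_s {μ : ℝ} (hμ : -1 / 2 < μ) :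
    IntegrableOn (fun x => (1 + x ^ decayExp μ)⁻¹ * s μ x) (Ioi 0) := by
  have hcont : ContinuousOn (fun x => (1 + x ^ decayExp μ)⁻¹ * s μ x) (Ioi 0) := by
    refine ContinuousOn.mul (ContinuousOn.inv₀ (by fun_prop) ?_) (ContinuousOn.div_const
      (continuousOn_id.rpow_const fun x hx => Or.inl (ne_of_gt hx)) _)
    intro x hx
    have : (0 : ℝ) < x := hx
    positivity
  rw [← Ioc_union_Ioi_eq_Ioi zero_le_one]
  have hc := c_pos hμ
  refine IntegrableOn.union ?_ ?_
  · refine (integrableOn_const (μ := volume) (s := Ioc (0 : ℝ) 1) (C := 1 / c μ) (by simp)).mono'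
      ((hcont.mono Ioc_subset_Ioi_self).aestronglyMeasurable measurableSet_Ioc)
      ((ae_restrict_iff' measurableSet_Ioc).2 (ae_of_all _ fun x hx => ?_))
    have hx0 : 0 < x := hx.1
    have h1 : x ^ (2 * μ + 1) ≤ 1 := Real.rpow_le_one hx0.le hx.2 (by linarith)
    have h2 := s_pos hμ hx0
    have h3 : (1 + x ^ decayExp μ)⁻¹ ≤ 1 := inv_le_one_of_one_le₀ (by
      have := pow_pos hx0 (decayExp μ); linarith)
    rw [Real.norm_of_nonneg (by positivity)]
    calc (1 + x ^ decayExp μ)⁻¹ * s μ x ≤ 1 * s μ x := mul_le_mul_of_nonneg_right h3 h2.le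
      _ ≤ 1 / c μ := by rw [one_mul, s]; exact div_le_div_of_nonneg_right h1 hc.le
  · have hexp : 2 * μ + 1 - decayExp μ < -1 := by
      have := Nat.le_ceil (2 * μ + 2)
      rw [decayExp]
      push_cast
      linarith
    refine ((integrableOn_Ioi_rpow_of_lt hexp one_pos).div_const (c μ)).mono'
      ((hcont.mono (Ioi_subset_Ioi zero_le_one)).aestronglyMeasurable measurableSet_Ioi)
      ((ae_restrict_iff' measurableSet_Ioi).2 (ae_of_all _ fun x hx => ?_))
    have hx0 : 0 < x := one_pos.trans hx
    have h2 := s_pos hμ hx0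
    have h4 := pow_pos hx0 (decayExp μ)
    rw [Real.norm_of_nonneg (by positivity), Real.rpow_sub hx0, Real.rpow_natCast, div_right_comm,
      div_eq_inv_mul _ (x ^ decayExp μ)]
    exact mul_le_mul_of_nonneg_right (inv_anti₀ h4 (by linarith)) h2.le

/-! ### The weighted Lebesgue spaces -/

/-- The measure `s r^p dx` on `(0,∞)`. -/
def weightMeasure (μ : ℝ) (p : ℝ≥0∞) : Measure ℝ :=
  (volume.restrict (Ioi 0)).withDensity fun x => ENNReal.ofReal (s μ x * r μ x ^ p.toReal)

theorem measurable_weight (μ : ℝ) (p : ℝ≥0∞) :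
    Measurable fun x => ENNReal.ofReal (s μ x * r μ x ^ p.toReal) := by
  unfold s r
  fun_prop

theorem restrict_ac_weightMeasure {μ : ℝ} (hμ : -1 / 2 < μ) (p : ℝ≥0∞) :
    volume.restrict (Ioi 0) ≪ weightMeasure μ p := by
  refine withDensity_absolutelyContinuous' (measurable_weight μ p).aemeasurable
    ((ae_restrict_iff' measurableSet_Ioi).2 (ae_of_all _ fun x hx => ?_))
  have h1 := s_pos hμ hx
  have h2 := Real.rpow_pos_of_pos (r_pos μ hx) p.toReal
  simpa using mul_pos h1 h2

theorem weightMeasure_ac_restrict (μ : ℝ) (p : ℝ≥0∞) :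
    weightMeasure μ p ≪ volume.restrict (Ioi 0) :=
  withDensity_absolutelyContinuous _ _

/-- The space `L^p(s r^p)`, `1 ≤ p < ∞`. -/
abbrev LpSR (μ : ℝ) (p : ℝ≥0∞) : Type := Lp ℂ p (weightMeasure μ p)

theorem integrableOn_testWeight_Lp {μ : ℝ} (hμ : -1 / 2 < μ) {p : ℝ≥0∞} [hp1 : Fact (1 ≤ p)]
    (hp : p ≠ ⊤) (f : LpSR μ p) :
    IntegrableOn (fun x => (testWeight μ x : ℂ) * f x) (Ioi 0) := by
  have hp0 : p ≠ 0 := (zero_lt_one.trans_le hp1.out).ne'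
  have hp1' : 1 ≤ p.toReal := by
    rw [← ENNReal.toReal_one]
    exact ENNReal.toReal_mono hp hp1.out
  have h1 := (Lp.memLp f).integrable_norm_rpow hp0 hp
  replace h1 := (integrable_withDensity_iff (measurable_weight μ p) (by simp)).1 h1
  have h2 := (((integrableOn_decay_mul_s hμ).add h1).const_mul (c μ))
  have hm : AEStronglyMeasurable (fun x => (testWeight μ x : ℂ) * f x)
      (volume.restrict (Ioi 0)) :=
    ((Complex.continuous_ofReal.comp_continuousOn
      (continuousOn_testWeight μ)).aestronglyMeasurable measurableSet_Ioi).mul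
      ((Lp.aestronglyMeasurable f).mono_ac (restrict_ac_weightMeasure hμ p))
  refine h2.mono' hm ((ae_restrict_iff' measurableSet_Ioi).2 (ae_of_all _ fun x hx => ?_))
  have hx0 : 0 < x := hx
  have hs := s_pos hμ hx0
  have hr := r_pos μ hx0
  have hc := c_pos hμ
  have h4 := pow_pos hx0 (decayExp μ)
  have hv : (1 + x ^ decayExp μ)⁻¹ ≤ 1 := inv_le_one_of_one_le₀ (by linarith)
  have hv0 : 0 < (1 + x ^ decayExp μ)⁻¹ := by positivity
  rw [norm_mul, Complex.norm_real, Real.norm_of_nonneg (testWeight_pos μ hx).le,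
    testWeight_eq hμ hx0, mul_assoc]
  refine mul_le_mul_of_nonneg_left ?_ hc.le
  simp only [Pi.add_apply]
  rw [ENNReal.toReal_ofReal (by positivity)]
  set t := r μ x * ‖f x‖ with ht
  have ht0 : 0 ≤ t := by positivity
  have key : t ≤ 1 + t ^ p.toReal := by
    rcases le_total t 1 with h | h
    · have := Real.rpow_nonneg ht0 p.toReal
      linarith
    · have := Real.rpow_le_rpow_of_exponent_le h hp1'
      rw [Real.rpow_one] at this
      linarith
  have e : ‖f x‖ ^ p.toReal * (s μ x * r μ x ^ p.toReal) = t ^ p.toReal * s μ x := by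
    rw [ht, Real.mul_rpow hr.le (norm_nonneg _)]
    ring
  rw [e]
  calc r μ x * ((1 + x ^ decayExp μ)⁻¹ * s μ x) * ‖f x‖
      = t * ((1 + x ^ decayExp μ)⁻¹ * s μ x) := by rw [ht]; ring
    _ ≤ (1 + t ^ p.toReal) * ((1 + x ^ decayExp μ)⁻¹ * s μ x) :=
        mul_le_mul_of_nonneg_right key (by positivity)
    _ = (1 + x ^ decayExp μ)⁻¹ * s μ x + t ^ p.toReal * ((1 + x ^ decayExp μ)⁻¹ * s μ x) := by
        ring
    _ ≤ _ := by
        have := mul_le_mul_of_nonneg_right hv hs.le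
        rw [one_mul] at this
        have := mul_le_mul_of_nonneg_left this (Real.rpow_nonneg ht0 p.toReal)
        linarith

/-- The embedding `f ↦ T_f` of `L^p(s r^p)` into `H'_μ`. -/
def embedLp (μ : ℝ) (hμ : -1 / 2 < μ) (p : ℝ≥0∞) [Fact (1 ≤ p)] (hp : p ≠ ⊤) :
    LpSR μ p →ₗ[ℂ] HmuDual μ where
  toFun f := regularElement μ f (integrableOn_testWeight_Lp hμ hp f)
  map_add' f g := by
    ext φ
    change ∫ x in Ioi 0, (f + g : LpSR μ p) x * (φ : ℝ → ℂ) x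
      = (∫ x in Ioi 0, f x * (φ : ℝ → ℂ) x) + ∫ x in Ioi 0, g x * (φ : ℝ → ℂ) x
    rw [← integral_add (integrableOn_mul_test (integrableOn_testWeight_Lp hμ hp f) φ)
      (integrableOn_mul_test (integrableOn_testWeight_Lp hμ hp g) φ)]
    refine integral_congr_ae ?_
    filter_upwards [(restrict_ac_weightMeasure hμ p).ae_le (Lp.coeFn_add f g)] with x hx
    rw [hx, Pi.add_apply, add_mul]
  map_smul' a f := by
    ext φ
    change ∫ x in Ioi 0, (a • f : LpSR μ p) x * (φ : ℝ → ℂ) x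
      = a * ∫ x in Ioi 0, f x * (φ : ℝ → ℂ) x
    rw [← integral_const_mul]
    refine integral_congr_ae ?_
    filter_upwards [(restrict_ac_weightMeasure hμ p).ae_le (Lp.coeFn_smul a f)] with x hx
    rw [hx, Pi.smul_apply, smul_eq_mul, mul_assoc]

theorem embedLp_injective (μ : ℝ) (hμ : -1 / 2 < μ) (p : ℝ≥0∞) [Fact (1 ≤ p)] (hp : p ≠ ⊤) :
    Function.Injective (embedLp μ hμ p hp) := by
  rw [injective_iff_map_eq_zero]
  intro f hf
  have h := ae_eq_zero_of_regularElement (integrableOn_testWeight_Lp hμ hp f)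
    fun φ => DFunLike.congr_fun hf φ
  rw [Lp.eq_zero_iff_ae_eq_zero]
  exact (weightMeasure_ac_restrict μ p).ae_le h

/-- `L^∞(r)` as a space of classes of functions on `(0,∞)` modulo equality almost everywhere. -/
def LinfSubmodule (μ : ℝ) : Submodule ℂ (ℝ →ₘ[volume.restrict (Ioi (0 : ℝ))] ℂ) where
  carrier := {f | MemLp (fun x => (r μ x : ℂ) * f x) ∞ (volume.restrict (Ioi 0))}
  add_mem' := by
    intro f g hf hg
    refine (hf.add hg).ae_eq ?_
    filter_upwards [AEEqFun.coeFn_add f g] with x hx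
    simp only [hx, Pi.add_apply, mul_add]
  zero_mem' := by
    refine MemLp.zero.ae_eq ?_
    filter_upwards [AEEqFun.coeFn_zero (α := ℝ) (β := ℂ) (μ := volume.restrict (Ioi 0))] with x hx
    simp [hx]
  smul_mem' := by
    intro a f hf
    refine (hf.const_smul a).ae_eq ?_
    filter_upwards [AEEqFun.coeFn_smul a f] with x hx
    simp only [hx, Pi.smul_apply, smul_eq_mul, mul_left_comm a]

/-- The space `L^∞(r)`. -/
def LinfR (μ : ℝ) : Type := LinfSubmodule μ

instance instAddCommGroupLinfR (μ : ℝ) : AddCommGroup (LinfR μ) :=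
  inferInstanceAs (AddCommGroup (LinfSubmodule μ))

instance instModuleLinfR (μ : ℝ) : Module ℂ (LinfR μ) :=
  inferInstanceAs (Module ℂ (LinfSubmodule μ))

/-- The class of functions underlying an element of `L^∞(r)`. -/
def LinfR.toClass {μ : ℝ} : LinfR μ →ₗ[ℂ] (ℝ →ₘ[volume.restrict (Ioi (0 : ℝ))] ℂ) :=
  (LinfSubmodule μ).subtype

/-- The function underlying an element of `L^∞(r)`. -/
instance instCoeFunLinfR (μ : ℝ) : CoeFun (LinfR μ) fun _ => ℝ → ℂ :=
  ⟨fun f => (LinfR.toClass f : ℝ → ℂ)⟩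

theorem LinfR.memLp {μ : ℝ} (f : LinfR μ) :
    MemLp (fun x => (r μ x : ℂ) * f x) ∞ (volume.restrict (Ioi 0)) := Subtype.property f

theorem LinfR.eq_zero {μ : ℝ} (f : LinfR μ)
    (h : ∀ᵐ x ∂volume.restrict (Ioi (0 : ℝ)), f x = 0) : f = 0 := by
  have h1 : LinfR.toClass f = 0 := by
    refine AEEqFun.ext ?_
    filter_upwards [h, AEEqFun.coeFn_zero (α := ℝ) (β := ℂ) (μ := volume.restrict (Ioi 0))]
      with x hx h0
    rw [hx, h0, Pi.zero_apply]
  exact Subtype.ext h1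

theorem LinfR.coe_add {μ : ℝ} (f g : LinfR μ) :
    ∀ᵐ x ∂volume.restrict (Ioi (0 : ℝ)), (f + g) x = f x + g x := by
  rw [map_add]
  exact AEEqFun.coeFn_add _ _

theorem LinfR.coe_smul {μ : ℝ} (a : ℂ) (f : LinfR μ) :
    ∀ᵐ x ∂volume.restrict (Ioi (0 : ℝ)), (a • f) x = a * f x := by
  rw [map_smul]
  exact AEEqFun.coeFn_smul _ _

/-- Multiplication by `r`, from `L^∞(r)` to `L^∞`. -/
def mulR (μ : ℝ) : LinfR μ →ₗ[ℂ] Lp ℂ ∞ (volume.restrict (Ioi (0 : ℝ))) where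
  toFun f := MemLp.toLp (fun x => (r μ x : ℂ) * f x) f.memLp
  map_add' f g := by
    rw [← MemLp.toLp_add, MemLp.toLp_eq_toLp_iff]
    filter_upwards [LinfR.coe_add f g] with x hx
    simp only [hx, Pi.add_apply, mul_add]
  map_smul' a f := by
    rw [RingHom.id_apply, ← MemLp.toLp_const_smul, MemLp.toLp_eq_toLp_iff]
    filter_upwards [LinfR.coe_smul a f] with x hx
    simp only [hx, Pi.smul_apply, smul_eq_mul, mul_left_comm a]

theorem mulR_injective (μ : ℝ) : Function.Injective (mulR μ) := by
  rw [injective_iff_map_eq_zero]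
  intro f hf
  have h1 := (MemLp.coeFn_toLp f.memLp).symm.trans ((Lp.eq_zero_iff_ae_eq_zero).1 hf)
  refine f.eq_zero ?_
  filter_upwards [h1, ae_restrict_mem measurableSet_Ioi] with x hx hxI
  have hr : (r μ x : ℂ) ≠ 0 := Complex.ofReal_ne_zero.2 (r_pos μ hxI).ne'
  exact (mul_eq_zero.1 hx).resolve_left hr

/-- The norm `‖f‖_{L^∞(r)} = ‖r f‖_∞`. -/
instance instNormedAddCommGroupLinfR (μ : ℝ) : NormedAddCommGroup (LinfR μ) :=
  NormedAddCommGroup.induced (LinfR μ) _ (mulR μ) (mulR_injective μ)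

instance instNormedSpaceLinfR (μ : ℝ) : NormedSpace ℂ (LinfR μ) :=
  NormedSpace.induced ℂ (LinfR μ) _ (mulR μ)

theorem norm_LinfR (μ : ℝ) (f : LinfR μ) :
    ‖f‖ = (eLpNorm (fun x => (r μ x : ℂ) * f x) ∞ (volume.restrict (Ioi 0))).toReal :=
  Lp.norm_toLp _ f.memLp

theorem integrableOn_testWeight_Linf {μ : ℝ} (hμ : -1 / 2 < μ) (f : LinfR μ) :
    IntegrableOn (fun x => (testWeight μ x : ℂ) * f x) (Ioi 0) := by
  have h1 : Integrable (fun x => ((c μ * ((1 + x ^ decayExp μ)⁻¹ * s μ x) : ℝ) : ℂ))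
      (volume.restrict (Ioi 0)) := ((integrableOn_decay_mul_s hμ).const_mul (c μ)).ofReal
  have h2 := f.memLp
  have h3 := h1.mul_bdd (c := (eLpNorm (fun x => (r μ x : ℂ) * f x) ∞
    (volume.restrict (Ioi 0))).toReal) h2.1
    (by
      filter_upwards [ae_le_eLpNormEssSup (f := fun x => (r μ x : ℂ) * f x)
        (μ := volume.restrict (Ioi 0))] with x hx
      rw [eLpNorm_exponent_top, ← toReal_enorm]
      exact ENNReal.toReal_mono (by simpa using h2.2.ne) hx)
  refine h3.congr ((ae_restrict_iff' measurableSet_Ioi).2 (ae_of_all _ fun x hx => ?_))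
  beta_reduce
  rw [testWeight_eq hμ hx]
  push_cast
  ring

/-- The embedding `f ↦ T_f` of `L^∞(r)` into `H'_μ`. -/
def embedLinf (μ : ℝ) (hμ : -1 / 2 < μ) : LinfR μ →ₗ[ℂ] HmuDual μ where
  toFun f := regularElement μ f (integrableOn_testWeight_Linf hμ f)
  map_add' f g := by
    ext φ
    change ∫ x in Ioi 0, (f + g : LinfR μ) x * (φ : ℝ → ℂ) x
      = (∫ x in Ioi 0, f x * (φ : ℝ → ℂ) x) + ∫ x in Ioi 0, g x * (φ : ℝ → ℂ) x
    rw [← integral_add (integrableOn_mul_test (integrableOn_testWeight_Linf hμ f) φ)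
      (integrableOn_mul_test (integrableOn_testWeight_Linf hμ g) φ)]
    refine integral_congr_ae ?_
    filter_upwards [LinfR.coe_add f g] with x hx
    rw [hx, add_mul]
  map_smul' a f := by
    ext φ
    change ∫ x in Ioi 0, (a • f : LinfR μ) x * (φ : ℝ → ℂ) x
      = a * ∫ x in Ioi 0, f x * (φ : ℝ → ℂ) x
    rw [← integral_const_mul]
    refine integral_congr_ae ?_
    filter_upwards [LinfR.coe_smul a f] with x hx
    rw [hx, mul_assoc]

theorem embedLinf_injective (μ : ℝ) (hμ : -1 / 2 < μ) :
    Function.Injective (embedLinf μ hμ) := by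
  rw [injective_iff_map_eq_zero]
  intro f hf
  have h := ae_eq_zero_of_regularElement (integrableOn_testWeight_Linf hμ f)
    fun φ => DFunLike.congr_fun hf φ
  exact f.eq_zero h

/-! ### Operators -/

/-- The part in `E` of an operator `A` of `V`, for a space `E` embedded in `V` by `T`: its domain is
`{f ∈ E | A f ∈ E}`, and it maps `f` to `A f`. -/
def part {E V : Type*} [AddCommGroup E] [Module ℂ E] [AddCommGroup V] [Module ℂ V]
    (A : V →ₗ[ℂ] V) (T : E →ₗ[ℂ] V) (hT : Function.Injective T) : E →ₗ.[ℂ] E where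
  domain := (LinearMap.range T).comap (A ∘ₗ T)
  toFun := (LinearEquiv.ofInjective T hT).symm.toLinearMap ∘ₗ
    (A ∘ₗ T).restrict (p := (LinearMap.range T).comap (A ∘ₗ T)) (q := LinearMap.range T)
      fun _ hf => hf

/-- The operator `S_{μ,p}`, the part of the distributional operator `S_μ` in `L^p(s r^p)`. -/
def besselLp (μ : ℝ) (hμ : -1 / 2 < μ) (p : ℝ≥0∞) [Fact (1 ≤ p)] (hp : p ≠ ⊤) :
    LpSR μ p →ₗ.[ℂ] LpSR μ p :=
  part (E := LpSR μ p) (V := HmuDual μ) (besselDual μ) (embedLp μ hμ p hp) (embedLp_injective μ hμ p hp)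

/-- The operator `S_{μ,∞}`, the part of the distributional operator `S_μ` in `L^∞(r)`. -/
def besselLinf (μ : ℝ) (hμ : -1 / 2 < μ) : LinfR μ →ₗ.[ℂ] LinfR μ :=
  part (E := LinfR μ) (V := HmuDual μ) (besselDual μ) (embedLinf μ hμ) (embedLinf_injective μ hμ)

/-- `R` is the bounded operator `(z + A)⁻¹`. -/
def IsResolvent {E : Type*} [NormedAddCommGroup E] [NormedSpace ℂ E]
    (A : E →ₗ.[ℂ] E) (z : ℂ) (R : E →L[ℂ] E) : Prop :=
  (∀ f : A.domain, R (z • (f : E) + A f) = f) ∧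
    ∀ g : E, ∃ h : R g ∈ A.domain, z • R g + A ⟨R g, h⟩ = g

/-- Non-negative operators: `(-∞,0)` is contained in the resolvent set of `A`, and
`λ (λ + A)⁻¹` is bounded uniformly in `λ > 0`. -/
def IsNonnegative {E : Type*} [NormedAddCommGroup E] [NormedSpace ℂ E] (A : E →ₗ.[ℂ] E) : Prop :=
  ∃ M : ℝ, ∀ l : ℝ, 0 < l → ∃ R : E →L[ℂ] E, IsResolvent A l R ∧ ‖(l : ℂ) • R‖ ≤ M

/-! ### The Hankel convolution and the kernel `N_λ` -/

/-- The area of the triangle with sides `x`, `y`, `z`. -/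
def area (x y z : ℝ) : ℝ :=
  1 / 4 * √(((x + y) ^ 2 - z ^ 2) * (z ^ 2 - (x - y) ^ 2))

/-- The kernel `D_μ(x,y,z)`. -/
def D (μ x y z : ℝ) : ℝ :=
  if |x - y| < z ∧ z < x + y then
    2 ^ (μ - 1) * (x * y * z) ^ (-μ + 1 / 2) / (Real.Gamma (μ + 1 / 2) * √Real.pi)
      * area x y z ^ (2 * μ - 1)
  else 0

/-- The Hankel convolution `(f ♯ g)(x) = ∫₀^∞ ∫₀^∞ D_μ(x,y,z) f(y) g(z) dy dz`. -/
def hankelConv (μ : ℝ) (f g : ℝ → ℂ) (x : ℝ) : ℂ :=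
  ∫ z in Ioi 0, ∫ y in Ioi 0, (D μ x y z : ℂ) * f y * g z

/-- The double integral that defines `(f ♯ g)(x)` converges absolutely. -/
def HankelConvExists (μ : ℝ) (f g : ℝ → ℂ) (x : ℝ) : Prop :=
  IntegrableOn (fun q : ℝ × ℝ => (D μ x q.1 q.2 : ℂ) * f q.1 * g q.2) (Ioi 0 ×ˢ Ioi 0)

/-- `K_ν(x) = (1/2) (x/2)^ν ∫₀^∞ e^{-t - x²/(4t)} t^{-ν-1} dt`. -/
def macdonald (ν x : ℝ) : ℝ :=
  1 / 2 * (x / 2) ^ ν * ∫ t in Ioi 0, Real.exp (-t - x ^ 2 / (4 * t)) / t ^ (ν + 1)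

/-- `N_λ(x) = λ^{μ/2} x^{1/2} K_μ(√λ x)`. -/
def N (μ l x : ℝ) : ℝ := l ^ (μ / 2) * x ^ (1 / 2 : ℝ) * macdonald μ (√l * x)

end Bessel

end

noncomputable section

namespace Bessel

open Topology

/-! ### The function `y^{-ν} K_ν(√l y)` -/

/-! Multiplication by `r` turns `S_μ` into `L u = u'' + (2μ+1)/x u'`, turns `L^p(s r^p)` into `L^p(s
dx)` and `L^∞(r)` into `L^∞`, and makes the pairing `∫ f φ dx` the symmetric pairing of `L²(s dx)`
times `c_μ`, because `c_μ s r² = 1`. In this picture the resolvent is the integral operator with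
Green's function of `l - L`, and everything rests on the properties of that kernel.

Two solutions of `L u = l u` are used: `bi`, smooth at `0` (Poisson's integral for `x^{-μ} I_μ`),
and `bk`, rapidly decreasing at `∞` (`x^{-μ} K_μ`, which is `r N_l`). Green's function is `bi (min x
z) * bk (max x z) / bi 0`; its normalisation relative to `s dx` comes from the Wronskian
(`wronskian_bk_bi`). Green's identity (`green_identity`) shows that it inverts `l - L` on functions
with mild bounds. Applied to the constant `1` it gives total mass `1/l` (`integral_green`).

The link with the Hankel convolution is the product formula (`bkTranslate_eq`): the average of `bk`
over the distances `√(x² + z² - 2xzv)` with weight `(1 - v²)^{μ-1/2}` factorises. By the law of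
cosines this average is `∫ D_μ(x,y,z) N_l(y) dy` up to explicit factors (`integral_D_mul_N`), so
that `N_l ♯ f = r⁻¹ G(r f)`, where `G` is the operator with Green's kernel (`hankelConv_N`).

The kernel is positive and symmetric and its mass is `1/l`, so Schur's test bounds `G` by `1/l` on
every `L^p(s dx)`, `1 ≤ p ≤ ∞` (`eLpNorm_greenOp_le`). Symmetry and Green's identity on `H_μ` give
the resolvent equation in `H'_μ` (`integral_mul_shiftedBessel`). Uniqueness follows because `l -
S_μ` maps `H_μ` onto a space containing `D(0,∞)` (`exists_test_eq`, by variation of parameters). A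
bounded resolvent characterises the graph as the equality set of two continuous maps, hence the
operators are closed (`isClosed_part`). -/

/-- The function `l^{ν/2} y^{-ν} K_ν(√l y)`, for `y > 0`. -/
def bk (l ν y : ℝ) : ℝ :=
  2 ^ (-ν - 1) * ∫ t in Ioi 0, Real.exp (-l * t - y ^ 2 / (4 * t)) * t ^ (-ν - 1)

/-- One term of the exponential series bounds `exp` from below. The essential zero at `t = 0` is
thus traded for an arbitrary power of `t`, at the price of `y^{-2n}`. -/
theorem exp_neg_div_le {y t : ℝ} (hy : 0 < y) (ht : 0 < t) (n : ℕ) :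
    Real.exp (-(y ^ 2 / (4 * t))) ≤ n.factorial * (4 / y ^ 2) ^ n * t ^ n := by
  have h0 : 0 < y ^ 2 / (4 * t) := by positivity
  have h := Real.pow_div_factorial_le_exp _ h0.le n
  rw [Real.exp_neg]
  have h1 : 0 < (y ^ 2 / (4 * t)) ^ n / n.factorial := by positivity
  refine (inv_anti₀ h1 h).trans (le_of_eq ?_)
  rw [inv_div, div_pow, mul_pow, div_pow]
  field_simp

/-- The free integer `n` serves twice: it makes the exponent of `t` integrable at `0`, and its
factor `y^{-2n}` is the decay of `bk` at infinity. -/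
theorem bk_integrand_le {l y t : ℝ} (hy : 0 < y) (ht : 0 < t) (a : ℝ) (n : ℕ) :
    Real.exp (-l * t - y ^ 2 / (4 * t)) * t ^ a ≤
      n.factorial * (4 / y ^ 2) ^ n * (t ^ (a + n) * Real.exp (-l * t)) := by
  have h := exp_neg_div_le hy ht n
  rw [sub_eq_add_neg, Real.exp_add, Real.rpow_add ht, Real.rpow_natCast]
  have h1 : 0 < t ^ a := Real.rpow_pos_of_pos ht a
  calc _ = Real.exp (-(y ^ 2 / (4 * t))) * (Real.exp (-l * t) * t ^ a) := by ring
    _ ≤ (n.factorial * (4 / y ^ 2) ^ n * t ^ n) * (Real.exp (-l * t) * t ^ a) :=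
      mul_le_mul_of_nonneg_right h (by positivity)
    _ = _ := by ring

theorem integrableOn_rpow_mul_exp_neg {l : ℝ} (hl : 0 < l) {a : ℝ} (ha : -1 < a) :
    IntegrableOn (fun t => t ^ a * Real.exp (-l * t)) (Ioi 0) := by
  simpa using integrableOn_rpow_mul_exp_neg_mul_rpow ha one_pos hl

theorem continuousOn_bk_integrand (l y a : ℝ) :
    ContinuousOn (fun t : ℝ => Real.exp (-l * t - y ^ 2 / (4 * t)) * t ^ a) (Ioi 0) := by
  refine ContinuousOn.mul (Real.continuous_exp.comp_continuousOn
    (ContinuousOn.sub (by fun_prop) (ContinuousOn.div (by fun_prop) (by fun_prop) ?_)))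
    (continuousOn_id.rpow_const fun x hx => Or.inl (ne_of_gt hx))
  intro t ht
  have : (0 : ℝ) < t := ht
  positivity

theorem exists_nat_gt_neg_one (a : ℝ) : ∃ n : ℕ, -1 < a + n := by
  obtain ⟨n, hn⟩ := exists_nat_gt (-1 - a)
  exact ⟨n, by linarith⟩

theorem integrableOn_bk_integrand {l y : ℝ} (hl : 0 < l) (hy : 0 < y) (a : ℝ) :
    IntegrableOn (fun t : ℝ => Real.exp (-l * t - y ^ 2 / (4 * t)) * t ^ a) (Ioi 0) := by
  obtain ⟨n, hn⟩ := exists_nat_gt_neg_one a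
  refine ((integrableOn_rpow_mul_exp_neg hl hn).const_mul
    (n.factorial * (4 / y ^ 2) ^ n)).mono'
    ((continuousOn_bk_integrand l y a).aestronglyMeasurable measurableSet_Ioi)
    ((ae_restrict_iff' measurableSet_Ioi).2 (ae_of_all _ fun t ht => ?_))
  have ht0 : (0 : ℝ) < t := ht
  rw [Real.norm_of_nonneg (by positivity)]
  exact bk_integrand_le hy ht a n

theorem bk_nonneg (l ν y : ℝ) : 0 ≤ bk l ν y :=
  mul_nonneg (by positivity) (setIntegral_nonneg measurableSet_Ioi fun t ht => by
    have : (0 : ℝ) < t := ht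
    positivity)

/-- Polynomial decay of `bk` at infinity. -/
theorem exists_pow_mul_bk_le {l : ℝ} (hl : 0 < l) (ν : ℝ) (n : ℕ) (hn : ν < n) :
    ∃ C, 0 ≤ C ∧ ∀ y, 0 < y → y ^ (2 * n) * bk l ν y ≤ C := by
  have ha : -1 < -ν - 1 + n := by linarith
  have hI := integrableOn_rpow_mul_exp_neg hl ha
  refine ⟨2 ^ (-ν - 1) * (n.factorial * 4 ^ n *
    ∫ t in Ioi 0, t ^ (-ν - 1 + n) * Real.exp (-l * t)), ?_, fun y hy => ?_⟩
  · refine mul_nonneg (by positivity) (mul_nonneg (by positivity)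
      (setIntegral_nonneg measurableSet_Ioi fun t ht => ?_))
    have : (0 : ℝ) < t := ht
    positivity
  · have h : ∫ t in Ioi 0, Real.exp (-l * t - y ^ 2 / (4 * t)) * t ^ (-ν - 1) ≤
        n.factorial * (4 / y ^ 2) ^ n * ∫ t in Ioi 0, t ^ (-ν - 1 + n) * Real.exp (-l * t) := by
      rw [← integral_const_mul]
      exact setIntegral_mono_on (integrableOn_bk_integrand hl hy _) (hI.const_mul _)
        measurableSet_Ioi fun t ht => bk_integrand_le hy ht _ n
    have h2 : (0 : ℝ) ≤ y ^ (2 * n) * 2 ^ (-ν - 1) := by positivity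
    rw [bk]
    calc y ^ (2 * n) * (2 ^ (-ν - 1) *
          ∫ t in Ioi 0, Real.exp (-l * t - y ^ 2 / (4 * t)) * t ^ (-ν - 1))
        = y ^ (2 * n) * 2 ^ (-ν - 1) *
          ∫ t in Ioi 0, Real.exp (-l * t - y ^ 2 / (4 * t)) * t ^ (-ν - 1) := by ring
      _ ≤ _ := mul_le_mul_of_nonneg_left h h2
      _ = _ := by
        rw [div_pow, pow_mul]
        field_simp

/-- Differentiation under the integral lowers the power of `t` by one, which raises the index. The
factor `2^(-ν-1)` in `bk` is what removes every constant, so that `x⁻¹D` becomes minus the index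
shift. -/
theorem hasDerivAt_bk {l : ℝ} (hl : 0 < l) (ν : ℝ) {y : ℝ} (hy : 0 < y) :
    HasDerivAt (bk l ν) (-y * bk l (ν + 1) y) y := by
  have key := hasDerivAt_integral_of_dominated_loc_of_deriv_le
    (μ := volume.restrict (Ioi 0)) (x₀ := y) (s := Ioo (y / 2) (2 * y))
    (F := fun (z t : ℝ) => Real.exp (-l * t - z ^ 2 / (4 * t)) * t ^ (-ν - 1))
    (F' := fun (z t : ℝ) => Real.exp (-l * t - z ^ 2 / (4 * t)) * t ^ (-ν - 2) * (-(z / 2)))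
    -- For `y/2 < z < 2y` the exponential is largest at `z = y/2`, and the factor `z/2` is at most
    -- `y`.
    (bound := fun t => Real.exp (-l * t - (y / 2) ^ 2 / (4 * t)) * t ^ (-ν - 2) * y)
    (Ioo_mem_nhds (by linarith) (by linarith))
    (Eventually.of_forall fun z =>
      (continuousOn_bk_integrand l z _).aestronglyMeasurable measurableSet_Ioi)
    (integrableOn_bk_integrand hl hy _)
    (((continuousOn_bk_integrand l y _).aestronglyMeasurable measurableSet_Ioi).mul_const _)
    ((ae_restrict_iff' measurableSet_Ioi).2 (ae_of_all _ fun t ht z hz => ?_))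
    ((integrableOn_bk_integrand hl (half_pos hy) _).mul_const _)
    ((ae_restrict_iff' measurableSet_Ioi).2 (ae_of_all _ fun t ht z hz => ?_))
  · have h := key.2.const_mul (2 ^ (-ν - 1))
    refine h.congr_deriv ?_
    rw [integral_mul_const, bk, show -(ν + 1) - 1 = -ν - 2 by ring,
      show (2 : ℝ) ^ (-ν - 1) = 2 ^ (-ν - 2) * 2 by
        rw [show -ν - 1 = -ν - 2 + 1 by ring, Real.rpow_add two_pos, Real.rpow_one]]
    ring
  · have ht0 : (0 : ℝ) < t := ht
    have hz0 : 0 < z := (half_pos hy).trans hz.1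
    rw [norm_mul, norm_neg, Real.norm_of_nonneg (by positivity),
      Real.norm_of_nonneg (by positivity)]
    have h1 : (y / 2) ^ 2 / (4 * t) ≤ z ^ 2 / (4 * t) := by
      have := hz.1
      gcongr
    refine mul_le_mul (mul_le_mul_of_nonneg_right (Real.exp_le_exp.2 (by linarith))
      (by positivity)) (by linarith [hz.2]) (by positivity) (by positivity)
  · have ht0 : (0 : ℝ) < t := ht
    have h1 : HasDerivAt (fun z : ℝ => -l * t - z ^ 2 / (4 * t)) (-(2 * z / (4 * t))) z := by
      have := ((hasDerivAt_pow 2 z).div_const (4 * t)).const_sub (-l * t)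
      simpa using this
    refine (h1.exp.mul_const (t ^ (-ν - 1))).congr_deriv ?_
    rw [show -ν - 1 = -ν - 2 + 1 by ring, Real.rpow_add ht0, Real.rpow_one]
    field_simp
    ring

theorem contDiffOn_bk {l : ℝ} (hl : 0 < l) (ν : ℝ) : ContDiffOn ℝ ∞ (bk l ν) (Ioi 0) := by
  rw [contDiffOn_infty]
  intro n
  induction n generalizing ν with
  | zero =>
    exact contDiffOn_zero.2 fun y hy => (hasDerivAt_bk hl ν hy).continuousAt.continuousWithinAt
  | succ n ih =>
    push_cast
    rw [contDiffOn_succ_iff_deriv_of_isOpen isOpen_Ioi]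
    refine ⟨fun y hy => (hasDerivAt_bk hl ν hy).differentiableAt.differentiableWithinAt,
      by simp, ?_⟩
    exact (contDiffOn_id.neg.mul (ih (ν + 1))).congr fun y hy => (hasDerivAt_bk hl ν hy).deriv

theorem continuousOn_bk {l : ℝ} (hl : 0 < l) (ν : ℝ) : ContinuousOn (bk l ν) (Ioi 0) :=
  (contDiffOn_bk hl ν).continuousOn

theorem measurable_bk (l ν : ℝ) : Measurable (bk l ν) := by
  have h : Measurable (fun q : ℝ × ℝ =>
      Real.exp (-l * q.2 - q.1 ^ 2 / (4 * q.2)) * q.2 ^ (-ν - 1)) := by fun_prop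
  exact (h.stronglyMeasurable.integral_prod_right'
    (ν := volume.restrict (Ioi (0 : ℝ)))).measurable.const_mul _

/-- The fundamental theorem of calculus on `(0,∞)`. -/
theorem integral_Ioi_zero_of_tendsto {E : Type*} [NormedAddCommGroup E] [NormedSpace ℝ E]
    [CompleteSpace E] {f f' : ℝ → E} {A B : E}
    (hd : ∀ t, 0 < t → HasDerivAt f (f' t) t) (hi : IntegrableOn f' (Ioi 0))
    (h0 : Tendsto f (𝓝[>] 0) (𝓝 A)) (h1 : Tendsto f atTop (𝓝 B)) :
    ∫ t in Ioi 0, f' t = B - A := by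
  -- The value of `f` at `0` is irrelevant; replacing it by the limit `A` makes `f` continuous from
  -- the right there.
  have e : ∀ t, 0 < t → Function.update f 0 A =ᶠ[𝓝 t] f := fun t ht => by
    filter_upwards [isOpen_Ioi.mem_nhds ht] with s hs
    exact Function.update_of_ne (ne_of_gt hs) _ _
  have h := integral_Ioi_of_hasDerivAt_of_tendsto (f := Function.update f 0 A) (f' := f')
    (a := 0) (m := B) ?_ (fun t ht => (hd t ht).congr_of_eventuallyEq (e t ht)) hi ?_
  · rw [h, Function.update_self]
  · rw [← continuousWithinAt_Ioi_iff_Ici, continuousWithinAt_update_same]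
    exact h0.mono_left (nhdsWithin_mono _ sdiff_subset)
  · refine h1.congr' ?_
    filter_upwards [eventually_gt_atTop 0] with t ht
    exact (Function.update_of_ne (ne_of_gt ht) _ _).symm

/-- The derivative of `exp(-lt - y²/(4t)) t^(-ν-1)` integrates to zero over `(0,∞)`, both boundary
limits being zero. Its three terms are the integrals of indices `ν`, `ν+1` and `ν+2`. -/
theorem bk_recurrence {l : ℝ} (hl : 0 < l) (ν : ℝ) {y : ℝ} (hy : 0 < y) :
    y ^ 2 * bk l (ν + 2) y = 2 * (ν + 1) * bk l (ν + 1) y + l * bk l ν y := by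
  set e : ℝ → ℝ := fun t => Real.exp (-l * t - y ^ 2 / (4 * t)) with he
  have hI : ∀ a : ℝ, Integrable (fun t => e t * t ^ a) (volume.restrict (Ioi 0)) :=
    fun a => integrableOn_bk_integrand hl hy a
  have hd : ∀ t, 0 < t → HasDerivAt (fun t => e t * t ^ (-ν - 1))
      (-l * (e t * t ^ (-ν - 1)) + (y ^ 2 / 4 * (e t * t ^ (-ν - 3))
        - (ν + 1) * (e t * t ^ (-ν - 2)))) t := by
    intro t ht
    have h1 : HasDerivAt (fun t : ℝ => -l * t - y ^ 2 / (4 * t))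
        (-l * 1 - y ^ 2 / 4 * (-(t ^ 2)⁻¹)) t := by
      refine (((hasDerivAt_id t).const_mul (-l)).fun_sub
        ((hasDerivAt_inv ht.ne').const_mul (y ^ 2 / 4))).congr_of_eventuallyEq
        (Eventually.of_forall fun z => ?_)
      simp only [id]
      rw [div_mul_eq_div_mul_one_div, one_div]
    refine (h1.exp.mul (Real.hasDerivAt_rpow_const (p := -ν - 1) (Or.inl ht.ne'))).congr_deriv ?_
    rw [show -ν - 1 - 1 = -ν - 3 + 1 by ring, show -ν - 1 = -ν - 3 + 2 by ring,
      show -ν - 2 = -ν - 3 + 1 by ring, Real.rpow_add ht, Real.rpow_add ht, Real.rpow_one,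
      Real.rpow_two]
    simp only [he]
    field_simp
    ring
  have hlim : ∀ a : ℝ, Tendsto (fun t => e t * t ^ a) (𝓝[>] 0) (𝓝 0) := by
    intro a
    obtain ⟨n, hn⟩ := exists_nat_gt (-a)
    have h1 : Tendsto (fun t : ℝ => n.factorial * (4 / y ^ 2) ^ n *
        (t ^ (a + n) * Real.exp (-l * t))) (𝓝[>] 0) (𝓝 0) := by
      have h2 : ContinuousAt (fun t : ℝ => n.factorial * (4 / y ^ 2) ^ n *
        (t ^ (a + n) * Real.exp (-l * t))) 0 := by
        refine ContinuousAt.mul continuousAt_const (ContinuousAt.mul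
          (Real.continuousAt_rpow_const _ _ (Or.inr (by linarith))) (by fun_prop))
      have h3 := h2.tendsto
      rw [Real.zero_rpow (by linarith)] at h3
      simp only [zero_mul, mul_zero] at h3
      exact h3.mono_left nhdsWithin_le_nhds
    refine squeeze_zero' ?_ ?_ h1
    · filter_upwards [self_mem_nhdsWithin] with t ht
      have : (0 : ℝ) < t := ht
      positivity
    · filter_upwards [self_mem_nhdsWithin] with t ht
      exact bk_integrand_le hy ht a n
  have hlim' : ∀ a : ℝ, Tendsto (fun t => e t * t ^ a) atTop (𝓝 0) := by
    intro a
    refine squeeze_zero' ?_ ?_ (tendsto_rpow_mul_exp_neg_mul_atTop_nhds_zero a l hl)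
    · filter_upwards [eventually_gt_atTop 0] with t ht
      positivity
    · filter_upwards [eventually_gt_atTop 0] with t ht
      have := bk_integrand_le (l := l) hy ht a 0
      simpa [he] using this
  have h := integral_Ioi_zero_of_tendsto hd ?_ (hlim _) (hlim' _)
  · rw [integral_add (f := fun t => -l * (e t * t ^ (-ν - 1))) (g := fun t =>
      y ^ 2 / 4 * (e t * t ^ (-ν - 3)) - (ν + 1) * (e t * t ^ (-ν - 2))) ((hI _).const_mul _)
      (((hI _).const_mul _).sub ((hI _).const_mul _)),
      integral_sub ((hI _).const_mul _) ((hI _).const_mul _), integral_const_mul,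
      integral_const_mul, integral_const_mul, sub_zero] at h
    have p1 : (2 : ℝ) ^ (-ν - 1) = 2 ^ (-ν - 3) * 4 := by
      rw [show -ν - 1 = -ν - 3 + 2 by ring, Real.rpow_add two_pos, Real.rpow_two]
      norm_num
    have p2 : (2 : ℝ) ^ (-ν - 2) = 2 ^ (-ν - 3) * 2 := by
      rw [show -ν - 2 = -ν - 3 + 1 by ring, Real.rpow_add two_pos, Real.rpow_one]
    simp only [bk]
    rw [show -(ν + 2) - 1 = -ν - 3 by ring, show -(ν + 1) - 1 = -ν - 2 by ring, p1, p2]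
    linear_combination (2 : ℝ) ^ (-ν - 3) * 4 * h
  · exact ((hI _).const_mul _).add (((hI _).const_mul _).sub ((hI _).const_mul _))

/-- The equation `u'' + (2μ+1)/y u' = l u` for `u = bk l μ`. -/
theorem hasDerivAt_deriv_bk {l : ℝ} (hl : 0 < l) (μ : ℝ) {y : ℝ} (hy : 0 < y) :
    HasDerivAt (fun z => -z * bk l (μ + 1) z)
      (l * bk l μ y - (2 * μ + 1) / y * (-y * bk l (μ + 1) y)) y := by
  have h := (hasDerivAt_neg y).mul (hasDerivAt_bk hl (μ + 1) hy)
  refine h.congr_deriv ?_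
  have := bk_recurrence hl μ hy
  rw [show μ + 1 + 1 = μ + 2 by ring]
  field_simp
  linear_combination this

/-- Substituting `y² t` for `t` moves `y` out of the singular term of the exponent and into the
parameter `l`. The power in front displays the singularity at `0`, and limits there become limits of
integrals at a fixed point. -/
theorem bk_eq_scaled (l ν : ℝ) {y : ℝ} (hy : 0 < y) :
    bk l ν y = y ^ (-2 * ν) * bk (l * y ^ 2) ν 1 := by
  have h := integral_comp_mul_left_Ioi
    (fun t => Real.exp (-l * t - y ^ 2 / (4 * t)) * t ^ (-ν - 1)) 0 (pow_pos hy 2)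
  rw [mul_zero, smul_eq_mul, eq_inv_mul_iff_mul_eq₀ (by positivity)] at h
  rw [bk, bk, ← h, mul_left_comm (y ^ (-2 * ν))]
  congr 1
  rw [← integral_const_mul, ← integral_const_mul]
  refine setIntegral_congr_fun measurableSet_Ioi fun t ht => ?_
  have ht0 : (0 : ℝ) < t := ht
  have e1 : y ^ 2 / (4 * (y ^ 2 * t)) = 1 ^ 2 / (4 * t) := by field_simp
  have e2 : (y ^ 2 * t) ^ (-ν - 1) = y ^ (-2 * ν) / y ^ 2 * t ^ (-ν - 1) := by
    rw [Real.mul_rpow (by positivity) ht0.le, ← Real.rpow_natCast, ← Real.rpow_mul hy.le,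
      ← Real.rpow_sub hy]
    congr 2
    push_cast
    ring
  rw [e1, e2, ← mul_assoc (-l), ← neg_mul]
  field_simp

/-- Scaling reduces both sides to the same function of `l x²`. In short, `r N_l = bk l μ`. -/
theorem N_eq {μ l x : ℝ} (hl : 0 < l) (hx : 0 < x) : N μ l x = x ^ (μ + 1 / 2) * bk l μ x := by
  have hL : 0 < √l := Real.sqrt_pos.2 hl
  have hy : 0 < √l * x := by positivity
  have h1 : macdonald μ (√l * x) = (√l * x) ^ μ * bk 1 μ (√l * x) := by
    rw [macdonald, bk, Real.div_rpow hy.le two_pos.le, ← mul_assoc]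
    have e : (2 : ℝ) ^ (-μ - 1) = 1 / 2 / 2 ^ μ := by
      rw [Real.rpow_sub two_pos, Real.rpow_neg two_pos.le, Real.rpow_one]
      field_simp
    congr 1
    · rw [e]
      ring
    · refine setIntegral_congr_fun measurableSet_Ioi fun t ht => ?_
      have ht0 : (0 : ℝ) < t := ht
      rw [show -μ - 1 = -(μ + 1) by ring, Real.rpow_neg ht0.le, div_eq_mul_inv]
      simp
  rw [N, h1, bk_eq_scaled 1 μ hy, bk_eq_scaled l μ hx, mul_pow, Real.sq_sqrt hl.le, one_mul]
  have e1 : (√l * x) ^ μ * (√l * x) ^ (-2 * μ) = (l ^ (μ / 2))⁻¹ * x ^ (-μ) := by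
    rw [← Real.rpow_add hy, Real.mul_rpow hL.le hx.le, Real.sqrt_eq_rpow, ← Real.rpow_mul hl.le,
      ← Real.rpow_neg hl.le]
    congr 2 <;> ring
  have e2 : x ^ (1 / 2 : ℝ) * x ^ (-μ) = x ^ (μ + 1 / 2) * x ^ (-2 * μ) := by
    rw [← Real.rpow_add hx, ← Real.rpow_add hx]
    congr 1
    ring
  have e3 : l ^ (μ / 2) ≠ 0 := (Real.rpow_pos_of_pos hl _).ne'
  calc _ = l ^ (μ / 2) * x ^ (1 / 2 : ℝ) * ((√l * x) ^ μ * (√l * x) ^ (-2 * μ)) *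
        bk (l * x ^ 2) μ 1 := by ring
    _ = (x ^ (1 / 2 : ℝ) * x ^ (-μ)) * bk (l * x ^ 2) μ 1 := by
        rw [e1]
        field_simp
    _ = _ := by
        rw [e2]
        ring

/-! ### Behaviour of `bk` at the origin -/

theorem integrableOn_exp_neg_inv_mul {μ : ℝ} (hμ : -1 < μ) :
    IntegrableOn (fun t : ℝ => Real.exp (-(1 / (4 * t))) * t ^ (-μ - 2)) (Ioi 0) := by
  have h := (integrableOn_Ioi_comp_rpow_iff (fun t : ℝ => t ^ μ * Real.exp (-(1 / 4) * t))
    (p := -1) (by norm_num)).2 (integrableOn_rpow_mul_exp_neg (by norm_num) hμ)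
  refine h.congr_fun (fun t ht => ?_) measurableSet_Ioi
  have ht0 : (0 : ℝ) < t := ht
  have e : t ^ (-1 - 1 : ℝ) * t ^ (-μ) = t ^ (-μ - 2) := by
    rw [← Real.rpow_add ht0]
    congr 1
    ring
  simp only [smul_eq_mul, abs_neg, abs_one, one_mul]
  rw [← Real.rpow_mul ht0.le, ← mul_assoc, neg_one_mul, e, Real.rpow_neg_one, mul_comm]
  congr 2
  field_simp

/-- Inverting `t` turns this into the Gamma integral of `t^μ e^{-t/4}`. It supplies the Gamma factor
of `c_μ`. -/
theorem integral_exp_neg_inv_mul {μ : ℝ} (hμ : -1 < μ) :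
    ∫ t in Ioi (0 : ℝ), Real.exp (-(1 / (4 * t))) * t ^ (-μ - 2) =
      4 ^ (μ + 1) * Real.Gamma (μ + 1) := by
  have h := integral_comp_rpow_Ioi (fun t : ℝ => t ^ μ * Real.exp (-(1 / 4) * t))
    (p := -1) (by norm_num)
  have h2 := Real.integral_rpow_mul_exp_neg_mul_Ioi (a := μ + 1) (r := 1 / 4) (by linarith)
    (by norm_num)
  have h3 : ∫ t in Ioi (0 : ℝ), t ^ μ * Real.exp (-(1 / 4) * t) =
      4 ^ (μ + 1) * Real.Gamma (μ + 1) := by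
    rw [one_div_one_div] at h2
    rw [← h2]
    simp only [add_sub_cancel_right, neg_mul]
  rw [← h3, ← h]
  refine setIntegral_congr_fun measurableSet_Ioi fun t ht => ?_
  have ht0 : (0 : ℝ) < t := ht
  have e : t ^ (-1 - 1 : ℝ) * t ^ (-μ) = t ^ (-μ - 2) := by
    rw [← Real.rpow_add ht0]
    congr 1
    ring
  simp only [smul_eq_mul, abs_neg, abs_one, one_mul]
  rw [← Real.rpow_mul ht0.le, ← mul_assoc, neg_one_mul, e, Real.rpow_neg_one, mul_comm]
  congr 2
  field_simp

/-- The singularity of `bk l (μ + 1)` at `0`. -/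
theorem tendsto_rpow_mul_bk_succ {μ l : ℝ} (hμ : -1 / 2 < μ) (hl : 0 < l) :
    Tendsto (fun x => x ^ (2 * μ + 2) * bk l (μ + 1) x) (𝓝[>] 0) (𝓝 (c μ)) := by
  have hμ1 : -1 < μ := by linarith
  -- After scaling, the integrand is dominated by its own limit at `x = 0`.
  have key : Tendsto (fun x : ℝ => ∫ t in Ioi (0 : ℝ),
      Real.exp (-(l * x ^ 2) * t - 1 ^ 2 / (4 * t)) * t ^ (-(μ + 1) - 1)) (𝓝[>] 0)
      (𝓝 (∫ t in Ioi (0 : ℝ), Real.exp (-(1 / (4 * t))) * t ^ (-μ - 2))) := by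
    refine tendsto_integral_filter_of_dominated_convergence _ ?_ ?_
      (integrableOn_exp_neg_inv_mul hμ1) ?_
    · exact Eventually.of_forall fun x =>
        (continuousOn_bk_integrand (l * x ^ 2) 1 _).aestronglyMeasurable measurableSet_Ioi
    · refine Eventually.of_forall fun x => (ae_restrict_iff' measurableSet_Ioi).2
        (ae_of_all _ fun t ht => ?_)
      have ht0 : (0 : ℝ) < t := ht
      rw [Real.norm_of_nonneg (by positivity), show -(μ + 1) - 1 = -μ - 2 by ring, one_pow]
      refine mul_le_mul_of_nonneg_right (Real.exp_le_exp.2 ?_) (by positivity)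
      have : 0 ≤ l * x ^ 2 * t := by positivity
      linarith
    · refine (ae_restrict_iff' measurableSet_Ioi).2 (ae_of_all _ fun t ht => ?_)
      have h1 : Continuous (fun x : ℝ => Real.exp (-(l * x ^ 2) * t - 1 ^ 2 / (4 * t)) *
        t ^ (-(μ + 1) - 1)) := by fun_prop
      have h2 := (h1.tendsto 0).mono_left (nhdsWithin_le_nhds (s := Ioi 0))
      convert h2 using 2
      rw [show -(μ + 1) - 1 = -μ - 2 by ring]
      simp
  rw [integral_exp_neg_inv_mul hμ1] at key
  have h := key.const_mul (2 ^ (-(μ + 1) - 1))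
  have e : (2 : ℝ) ^ (-(μ + 1) - 1) * (4 ^ (μ + 1) * Real.Gamma (μ + 1)) = c μ := by
    rw [c, ← mul_assoc]
    congr 1
    rw [show (4 : ℝ) = 2 ^ (2 : ℝ) by norm_num, ← Real.rpow_mul two_pos.le,
      ← Real.rpow_add two_pos]
    congr 1
    ring
  rw [e] at h
  refine h.congr' ?_
  filter_upwards [self_mem_nhdsWithin] with x hx
  have hx0 : (0 : ℝ) < x := hx
  rw [bk_eq_scaled l (μ + 1) hx0, ← mul_assoc, ← Real.rpow_add hx0,
    show 2 * μ + 2 + -2 * (μ + 1) = 0 by ring, Real.rpow_zero, one_mul, bk]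

/-- For `μ ≤ 0` the scaled integral diverges at `x = 0`, so the factor `x²` has to stay under the
integral. The bound `l x² t e^{-l x² t} ≤ 1` then gains a factor `t⁻¹`, which is enough for
dominated convergence. -/
theorem tendsto_rpow_mul_bk {μ l : ℝ} (hμ : -1 / 2 < μ) (hl : 0 < l) :
    Tendsto (fun x => x ^ (2 * μ + 2) * bk l μ x) (𝓝[>] 0) (𝓝 0) := by
  have hμ1 : -1 < μ := by linarith
  have key : Tendsto (fun x : ℝ => ∫ t in Ioi (0 : ℝ),
      x ^ 2 * (Real.exp (-(l * x ^ 2) * t - 1 ^ 2 / (4 * t)) * t ^ (-μ - 1))) (𝓝[>] 0)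
      (𝓝 (∫ t in Ioi (0 : ℝ), 0)) := by
    refine tendsto_integral_filter_of_dominated_convergence _ ?_ ?_
      ((integrableOn_exp_neg_inv_mul hμ1).const_mul l⁻¹) ?_
    · exact Eventually.of_forall fun x =>
        ((continuousOn_bk_integrand (l * x ^ 2) 1 _).aestronglyMeasurable
          measurableSet_Ioi).const_mul _
    · refine Eventually.of_forall fun x => (ae_restrict_iff' measurableSet_Ioi).2
        (ae_of_all _ fun t ht => ?_)
      have ht0 : (0 : ℝ) < t := ht
      rw [Real.norm_of_nonneg (by positivity), one_pow, sub_eq_add_neg, Real.exp_add,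
        show -μ - 1 = -μ - 2 + 1 by ring, Real.rpow_add ht0, Real.rpow_one]
      have h1 : l * x ^ 2 * t * Real.exp (-(l * x ^ 2 * t)) ≤ 1 := by
        rw [Real.exp_neg, ← div_eq_mul_inv, div_le_one (Real.exp_pos _)]
        exact (le_add_of_nonneg_right zero_le_one).trans (Real.add_one_le_exp _)
      have h2 : 0 ≤ l⁻¹ * (Real.exp (-(1 / (4 * t))) * t ^ (-μ - 2)) := by positivity
      calc _ = l * x ^ 2 * t * Real.exp (-(l * x ^ 2 * t)) *
            (l⁻¹ * (Real.exp (-(1 / (4 * t))) * t ^ (-μ - 2))) := by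
            rw [neg_mul]
            field_simp
        _ ≤ 1 * (l⁻¹ * (Real.exp (-(1 / (4 * t))) * t ^ (-μ - 2))) :=
            mul_le_mul_of_nonneg_right h1 h2
        _ = _ := one_mul _
    · refine (ae_restrict_iff' measurableSet_Ioi).2 (ae_of_all _ fun t ht => ?_)
      have h1 : Continuous (fun x : ℝ => x ^ 2 * (Real.exp (-(l * x ^ 2) * t - 1 ^ 2 / (4 * t)) *
        t ^ (-μ - 1))) := by fun_prop
      have h2 := (h1.tendsto 0).mono_left (nhdsWithin_le_nhds (s := Ioi 0))
      convert h2 using 2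
      simp
  have h := key.const_mul (2 ^ (-μ - 1))
  rw [integral_zero, mul_zero] at h
  refine h.congr' ?_
  filter_upwards [self_mem_nhdsWithin] with x hx
  have hx0 : (0 : ℝ) < x := hx
  rw [bk_eq_scaled l μ hx0, ← mul_assoc, ← Real.rpow_add hx0,
    show 2 * μ + 2 + -2 * μ = 2 by ring, Real.rpow_two, bk, integral_const_mul]
  ring

/-! ### Integrals with the weight `(1 - v²)^a` -/

theorem one_sub_sq_pos {v : ℝ} (hv : v ∈ Ioo (-1 : ℝ) 1) : 0 < 1 - v ^ 2 := by
  nlinarith [hv.1, hv.2]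

theorem continuousOn_one_sub_sq_rpow (a : ℝ) :
    ContinuousOn (fun v : ℝ => (1 - v ^ 2) ^ a) (Ioo (-1) 1) :=
  ContinuousOn.rpow_const (by fun_prop) fun _ hv => Or.inl (one_sub_sq_pos hv).ne'

/-- For `a ≥ 0` the weight is at most `1`. For `a ≤ 0`, one of the factors `1 - v`, `1 + v` is at
least `1` on each half of the interval, so the weight is bounded by the power of the other factor.
-/
theorem integrableOn_one_sub_sq_rpow {a : ℝ} (ha : -1 < a) :
    IntegrableOn (fun v : ℝ => (1 - v ^ 2) ^ a) (Ioo (-1) 1) := by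
  have h1 : IntervalIntegrable (fun v : ℝ => (1 - v) ^ a) volume (-1) 1 := by
    have := (intervalIntegral.intervalIntegrable_rpow' (a := 2) (b := 0) ha).comp_sub_left 1
    norm_num at this
    exact this
  have h2 : IntervalIntegrable (fun v : ℝ => (v + 1) ^ a) volume (-1) 1 := by
    have := (intervalIntegral.intervalIntegrable_rpow' (a := 0) (b := 2) ha).comp_add_right 1
    norm_num at this
    exact this
  have h3 := ((h1.add h2).add (intervalIntegrable_const (c := (1 : ℝ))))
  rw [intervalIntegrable_iff_integrableOn_Ioo_of_le (by norm_num)] at h3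
  refine h3.mono' ((continuousOn_one_sub_sq_rpow a).aestronglyMeasurable measurableSet_Ioo)
    ((ae_restrict_iff' measurableSet_Ioo).2 (ae_of_all _ fun v hv => ?_))
  have h0 := one_sub_sq_pos hv
  have p1 : 0 < 1 - v := by linarith [hv.2]
  have p2 : 0 < v + 1 := by linarith [hv.1]
  have q1 := Real.rpow_pos_of_pos p1 a
  have q2 := Real.rpow_pos_of_pos p2 a
  rw [Real.norm_of_nonneg (by positivity)]
  change _ ≤ (1 - v) ^ a + (v + 1) ^ a + 1
  rcases le_total 0 a with h | h
  · have := Real.rpow_le_one h0.le (by nlinarith [sq_nonneg v]) h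
    linarith
  · rcases le_total 0 v with hv0 | hv0
    · have : (1 - v ^ 2) ^ a ≤ (1 - v) ^ a :=
        Real.rpow_le_rpow_of_nonpos p1 (by nlinarith) h
      linarith
    · have : (1 - v ^ 2) ^ a ≤ (v + 1) ^ a :=
        Real.rpow_le_rpow_of_nonpos p2 (by nlinarith) h
      linarith

theorem integrableOn_one_sub_sq_rpow_mul {a : ℝ} (ha : -1 < a) {g : ℝ → ℝ}
    (hg : ContinuousOn g (Icc (-1) 1)) :
    IntegrableOn (fun v : ℝ => (1 - v ^ 2) ^ a * g v) (Ioo (-1) 1) := by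
  obtain ⟨C, hC⟩ := isCompact_Icc.exists_bound_of_continuousOn hg
  exact (integrableOn_one_sub_sq_rpow ha).mul_bdd (c := C)
    ((hg.mono Ioo_subset_Icc_self).aestronglyMeasurable measurableSet_Ioo)
    ((ae_restrict_iff' measurableSet_Ioo).2
      (ae_of_all _ fun v hv => hC v (Ioo_subset_Icc_self hv)))

/-- Differentiation under the integral sign. -/
theorem hasDerivAt_integral_one_sub_sq_rpow_mul {a : ℝ} (ha : -1 < a) {U : Set ℝ} (hU : IsOpen U)
    {g g' : ℝ → ℝ → ℝ}
    (hg : ∀ x ∈ U, ∀ v ∈ Icc (-1 : ℝ) 1, HasDerivAt (fun y => g y v) (g' x v) x)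
    (hc : ∀ x ∈ U, ContinuousOn (g x) (Icc (-1) 1))
    (hc' : ContinuousOn (fun q : ℝ × ℝ => g' q.1 q.2) (U ×ˢ Icc (-1) 1)) {x : ℝ} (hx : x ∈ U) :
    HasDerivAt (fun y => ∫ v in Ioo (-1) 1, (1 - v ^ 2) ^ a * g y v)
      (∫ v in Ioo (-1) 1, (1 - v ^ 2) ^ a * g' x v) x := by
  obtain ⟨ε, hε, hball⟩ := Metric.nhds_basis_closedBall.mem_iff.1 (hU.mem_nhds hx)
  have hK : IsCompact (Metric.closedBall x ε ×ˢ Icc (-1 : ℝ) 1) :=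
    (isCompact_closedBall x ε).prod isCompact_Icc
  obtain ⟨C, hC⟩ := hK.exists_bound_of_continuousOn (hc'.mono (prod_mono hball Subset.rfl))
  have hm : ∀ h : ℝ → ℝ, ContinuousOn h (Icc (-1) 1) → AEStronglyMeasurable
      (fun v => (1 - v ^ 2) ^ a * h v) (volume.restrict (Ioo (-1) 1)) := fun h hh =>
    (integrableOn_one_sub_sq_rpow_mul ha hh).aestronglyMeasurable
  refine (hasDerivAt_integral_of_dominated_loc_of_deriv_le
    (F := fun y v => (1 - v ^ 2) ^ a * g y v) (F' := fun y v => (1 - v ^ 2) ^ a * g' y v)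
    (bound := fun v => (1 - v ^ 2) ^ a * C) (Metric.closedBall_mem_nhds x hε)
    (by
      filter_upwards [hU.mem_nhds hx] with y hy
      exact hm _ (hc y hy))
    (integrableOn_one_sub_sq_rpow_mul ha (hc x hx))
    (hm _ (hc'.comp (f := fun v : ℝ => (x, v)) (Continuous.continuousOn (by fun_prop))
      fun v hv => ⟨hx, hv⟩))
    ((ae_restrict_iff' measurableSet_Ioo).2 (ae_of_all _ fun v hv y hy => ?_))
    ((integrableOn_one_sub_sq_rpow ha).mul_const C)
    ((ae_restrict_iff' measurableSet_Ioo).2 (ae_of_all _ fun v hv y hy => ?_))).2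
  · have h0 := one_sub_sq_pos hv
    rw [norm_mul, Real.norm_of_nonneg (by positivity)]
    exact mul_le_mul_of_nonneg_left (hC (y, v) ⟨hy, Ioo_subset_Icc_self hv⟩) (by positivity)
  · exact (hg y (hball hy) v (Ioo_subset_Icc_self hv)).const_mul _

/-- Integration by parts against `(1 - v²)^{a+1}`. -/
theorem integral_one_sub_sq_rpow_mul_deriv {a : ℝ} (ha : -1 < a) {g g' : ℝ → ℝ}
    (hg : ∀ v ∈ Icc (-1 : ℝ) 1, HasDerivAt g (g' v) v) (hg' : ContinuousOn g' (Icc (-1) 1)) :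
    ∫ v in Ioo (-1) 1, (1 - v ^ 2) ^ a * ((1 - v ^ 2) * g' v - 2 * (a + 1) * v * g v) = 0 := by
  have hc : ContinuousOn g (Icc (-1) 1) := fun v hv => (hg v hv).continuousAt.continuousWithinAt
  have hi := integrableOn_one_sub_sq_rpow_mul ha
    (g := fun v => (1 - v ^ 2) * g' v - 2 * (a + 1) * v * g v)
    (((by fun_prop : Continuous fun v : ℝ => 1 - v ^ 2).continuousOn.mul hg').sub
      ((by fun_prop : Continuous fun v : ℝ => 2 * (a + 1) * v).continuousOn.mul hc))
  rw [← intervalIntegrable_iff_integrableOn_Ioo_of_le (by norm_num)] at hi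
  rw [← integral_Ioc_eq_integral_Ioo, ← intervalIntegral.integral_of_le (by norm_num)]
  rw [intervalIntegral.integral_eq_sub_of_hasDerivAt_of_le
    (f := fun v => (1 - v ^ 2) ^ (a + 1) * g v) (by norm_num) ?_ ?_ hi]
  -- The boundary terms vanish because the exponent `a + 1` is positive.
  · norm_num [Real.zero_rpow (show a + 1 ≠ 0 by linarith)]
  · exact ContinuousOn.mul (ContinuousOn.rpow_const (by fun_prop)
      fun v _ => Or.inr (by linarith)) hc
  · intro v hv
    have h0 := one_sub_sq_pos hv
    have h1 : HasDerivAt (fun v : ℝ => 1 - v ^ 2) (-(2 * v)) v := by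
      simpa using (hasDerivAt_pow 2 v).const_sub 1
    refine ((h1.rpow_const (p := a + 1) (Or.inl h0.ne')).mul
      (hg v (Ioo_subset_Icc_self hv))).congr_deriv ?_
    rw [add_sub_cancel_right, Real.rpow_add h0, Real.rpow_one]
    ring

/-! ### The function `x^{-ν} I_ν(√l x)` -/

/-- A multiple of the function `x^{-ν} I_ν(√l x)`, by Poisson's integral. -/
def bi (l ν x : ℝ) : ℝ :=
  ∫ v in Ioo (-1) 1, (1 - v ^ 2) ^ (ν - 1 / 2) * Real.exp (√l * x * v)

theorem bi_pos (l : ℝ) {ν : ℝ} (hν : -1 / 2 < ν) (x : ℝ) : 0 < bi l ν x := by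
  have hi := integrableOn_one_sub_sq_rpow_mul (a := ν - 1 / 2) (by linarith)
    (g := fun v => Real.exp (√l * x * v)) (Continuous.continuousOn (by fun_prop))
  rw [bi, setIntegral_pos_iff_support_of_nonneg_ae
    ((ae_restrict_iff' measurableSet_Ioo).2 (ae_of_all _ fun v hv => ?_)) hi]
  · have : Function.support (fun v => (1 - v ^ 2) ^ (ν - 1 / 2) * Real.exp (√l * x * v)) ∩
        Ioo (-1) 1 = Ioo (-1) 1 := by
      refine inter_eq_right.2 fun v hv => ?_
      have := one_sub_sq_pos hv
      exact (by positivity : (0 : ℝ) < _).ne'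
    rw [this]
    norm_num
  · have := one_sub_sq_pos hv
    simp only [Pi.zero_apply]
    positivity

theorem hasDerivAt_bi_aux (l : ℝ) {ν : ℝ} (hν : -1 / 2 < ν) (k : ℕ) (x : ℝ) :
    HasDerivAt (fun x => ∫ v in Ioo (-1) 1, (1 - v ^ 2) ^ (ν - 1 / 2) *
        (v ^ k * Real.exp (√l * x * v)))
      (∫ v in Ioo (-1) 1, (1 - v ^ 2) ^ (ν - 1 / 2) *
        (√l * (v ^ (k + 1) * Real.exp (√l * x * v)))) x := by
  refine hasDerivAt_integral_one_sub_sq_rpow_mul (by linarith) isOpen_univ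
    (g := fun x v => v ^ k * Real.exp (√l * x * v))
    (g' := fun x v => √l * (v ^ (k + 1) * Real.exp (√l * x * v))) ?_ ?_ ?_ (mem_univ x)
  · intro x _ v _
    have h1 : HasDerivAt (fun x : ℝ => √l * x * v) (√l * v) x := by
      simpa using ((hasDerivAt_id x).const_mul √l).mul_const v
    refine (h1.exp.const_mul (v ^ k)).congr_deriv ?_
    ring
  · intro x _
    fun_prop
  · fun_prop

/-- Differentiation produces a factor `√l v`. Integration by parts absorbs `v` together with the
weight into `(1 - v²)^(ν+1/2)`, the weight of index `ν + 1`, with denominator `2ν + 1`. -/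
theorem hasDerivAt_bi {l : ℝ} (hl : 0 < l) {ν : ℝ} (hν : -1 / 2 < ν) (x : ℝ) :
    HasDerivAt (bi l ν) (l / (2 * ν + 1) * (x * bi l (ν + 1) x)) x := by
  have h := hasDerivAt_bi_aux l hν 0 x
  simp only [pow_zero, one_mul] at h
  refine h.congr_deriv ?_
  have h2 := integral_one_sub_sq_rpow_mul_deriv (a := ν - 1 / 2) (by linarith)
    (g := fun v => Real.exp (√l * x * v)) (g' := fun v => Real.exp (√l * x * v) * (√l * x))
    (fun v _ => ?_) (by fun_prop)
  · have e : ∀ v ∈ Ioo (-1 : ℝ) 1, (1 - v ^ 2) ^ (ν - 1 / 2) *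
        ((1 - v ^ 2) * (Real.exp (√l * x * v) * (√l * x)) -
          2 * (ν - 1 / 2 + 1) * v * Real.exp (√l * x * v)) =
        √l * x * ((1 - v ^ 2) ^ (ν + 1 - 1 / 2) * Real.exp (√l * x * v)) -
          (2 * ν + 1) * ((1 - v ^ 2) ^ (ν - 1 / 2) * (v * Real.exp (√l * x * v))) := by
      intro v hv
      rw [show ν + 1 - 1 / 2 = ν - 1 / 2 + 1 by ring, Real.rpow_add (one_sub_sq_pos hv),
        Real.rpow_one]
      ring
    rw [setIntegral_congr_fun measurableSet_Ioo e, integral_sub, integral_const_mul,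
      integral_const_mul] at h2
    · have e3 : ∀ v : ℝ, (1 - v ^ 2) ^ (ν - 1 / 2) * (√l * (v ^ (0 + 1) * Real.exp (√l * x * v))) =
        √l * ((1 - v ^ 2) ^ (ν - 1 / 2) * (v * Real.exp (√l * x * v))) := fun v => by ring
      simp only [e3]
      rw [integral_const_mul, bi]
      have hn : 2 * ν + 1 ≠ 0 := by linarith
      have hs := Real.sq_sqrt hl.le
      generalize (∫ v in Ioo (-1) 1, (1 - v ^ 2) ^ (ν + 1 - 1 / 2) * Real.exp (√l * x * v)) = X at *
      generalize (∫ v in Ioo (-1) 1, (1 - v ^ 2) ^ (ν - 1 / 2) *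
        (v * Real.exp (√l * x * v))) = Y at *
      rw [div_mul_eq_mul_div, eq_div_iff hn]
      linear_combination -√l * h2 + x * X * hs
    · exact (integrableOn_one_sub_sq_rpow_mul (by linarith) (by fun_prop)).const_mul _
    · exact (integrableOn_one_sub_sq_rpow_mul (by linarith) (by fun_prop)).const_mul _
  · have h1 : HasDerivAt (fun v : ℝ => √l * x * v) (√l * x) v := by
      simpa using (hasDerivAt_id v).const_mul (√l * x)
    exact h1.exp

theorem contDiff_bi {l : ℝ} (hl : 0 < l) {ν : ℝ} (hν : -1 / 2 < ν) : ContDiff ℝ ∞ (bi l ν) := by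
  rw [contDiff_infty]
  intro n
  induction n generalizing ν with
  | zero =>
    exact contDiff_zero.2 (continuous_iff_continuousAt.2 fun x =>
      (hasDerivAt_bi hl hν x).continuousAt)
  | succ n ih =>
    push_cast
    rw [contDiff_succ_iff_deriv]
    refine ⟨fun x => (hasDerivAt_bi hl hν x).differentiableAt, by simp, ?_⟩
    rw [funext fun x => (hasDerivAt_bi hl hν x).deriv]
    exact contDiff_const.mul (contDiff_id.mul (ih (by linarith)))

/-- The equation `u'' + (2μ+1)/x u' = l u` for `u = bi l μ`. -/
theorem hasDerivAt_deriv_bi {l : ℝ} (hl : 0 < l) {μ : ℝ} (hμ : -1 / 2 < μ) {x : ℝ} (hx : 0 < x) :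
    HasDerivAt (fun x => l / (2 * μ + 1) * (x * bi l (μ + 1) x))
      (l * bi l μ x - (2 * μ + 1) / x * (l / (2 * μ + 1) * (x * bi l (μ + 1) x))) x := by
  -- The derivative is written as a first moment again, so that the second derivative is a second
  -- moment. Splitting `v² = 1 - (1 - v²)` then gives the terms of indices `μ` and `μ + 1`.
  have h1 : (fun x => l / (2 * μ + 1) * (x * bi l (μ + 1) x)) = fun x =>
      √l * ∫ v in Ioo (-1) 1, (1 - v ^ 2) ^ (μ - 1 / 2) * (v ^ 1 * Real.exp (√l * x * v)) := by
    funext x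
    have h := hasDerivAt_bi_aux l hμ 0 x
    simp only [pow_zero, one_mul, zero_add] at h
    rw [(hasDerivAt_bi hl hμ x).unique h, ← integral_const_mul]
    congr 1
    funext v
    ring
  rw [h1]
  refine ((hasDerivAt_bi_aux l hμ 1 x).const_mul √l).congr_deriv ?_
  have hn : 2 * μ + 1 ≠ 0 := by linarith
  have e : (2 * μ + 1) / x * (l / (2 * μ + 1) * (x * bi l (μ + 1) x)) = l * bi l (μ + 1) x := by
    field_simp
  rw [e, ← mul_sub, bi, bi, ← integral_sub
    (integrableOn_one_sub_sq_rpow_mul (by linarith) (by fun_prop))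
    (integrableOn_one_sub_sq_rpow_mul (by linarith) (by fun_prop)), ← integral_const_mul,
    ← integral_const_mul]
  refine setIntegral_congr_fun measurableSet_Ioo fun v hv => ?_
  rw [show μ + 1 - 1 / 2 = μ - 1 / 2 + 1 by ring, Real.rpow_add (one_sub_sq_pos hv), Real.rpow_one]
  linear_combination (1 - v ^ 2) ^ (μ - 1 / 2) * v ^ 2 * Real.exp (√l * x * v) * Real.sq_sqrt hl.le

/-- The value at `0` is a Beta integral after `v = 2x - 1`, and Legendre's duplication formula
eliminates `Γ(2μ+1)`. This reconciles the constant in `D_μ` with `c_μ`. -/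
theorem bi_zero_eq (l : ℝ) {μ : ℝ} (hμ : -1 / 2 < μ) :
    bi l μ 0 * Real.Gamma (μ + 1) = √Real.pi * Real.Gamma (μ + 1 / 2) := by
  have hα : 0 < μ + 1 / 2 := by linarith
  have h1 : bi l μ 0 = 2 ^ (2 * μ) * ProbabilityTheory.beta (μ + 1 / 2) (μ + 1 / 2) := by
    have e0 : bi l μ 0 = ∫ v in (-1 : ℝ)..1, (1 - v ^ 2) ^ (μ - 1 / 2) := by
      rw [intervalIntegral.integral_of_le (by norm_num), integral_Ioc_eq_integral_Ioo, bi]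
      simp
    have e1 := intervalIntegral.integral_comp_mul_sub (a := 0) (b := 1) (c := 2)
      (fun v : ℝ => (1 - v ^ 2) ^ (μ - 1 / 2)) (by norm_num) 1
    norm_num at e1
    rw [ProbabilityTheory.beta_eq_betaIntegralReal _ _ hα hα, Complex.betaIntegral]
    have e2 : ∫ x in (0 : ℝ)..1, (x : ℂ) ^ (((μ + 1 / 2 : ℝ) : ℂ) - 1) *
        (1 - (x : ℂ)) ^ (((μ + 1 / 2 : ℝ) : ℂ) - 1) =
        ((∫ x in (0 : ℝ)..1, x ^ (μ - 1 / 2) * (1 - x) ^ (μ - 1 / 2) : ℝ) : ℂ) := by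
      rw [← intervalIntegral.integral_ofReal]
      refine intervalIntegral.integral_congr fun x hx => ?_
      rw [uIcc_of_le zero_le_one] at hx
      have e : (((μ + 1 / 2 : ℝ) : ℂ) - 1) = ((μ - 1 / 2 : ℝ) : ℂ) := by
        push_cast
        ring
      rw [e, ← Complex.ofReal_one, ← Complex.ofReal_sub, ← Complex.ofReal_cpow hx.1,
        ← Complex.ofReal_cpow (by linarith [hx.2]), Complex.ofReal_mul]
    rw [e2, Complex.ofReal_re, e0]
    have e3 : ∫ x in (0 : ℝ)..1, (1 - (2 * x - 1) ^ 2) ^ (μ - 1 / 2) =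
        4 ^ (μ - 1 / 2) * ∫ x in (0 : ℝ)..1, x ^ (μ - 1 / 2) * (1 - x) ^ (μ - 1 / 2) := by
      rw [← intervalIntegral.integral_const_mul]
      refine intervalIntegral.integral_congr fun x hx => ?_
      rw [uIcc_of_le zero_le_one] at hx
      have hx1 : 0 ≤ 1 - x := by linarith [hx.2]
      rw [← Real.mul_rpow hx.1 hx1, ← Real.mul_rpow (by norm_num) (mul_nonneg hx.1 hx1)]
      congr 1
      ring
    have e4 : (4 : ℝ) ^ (μ - 1 / 2) * 2 = 2 ^ (2 * μ) := by
      rw [show (4 : ℝ) = 2 ^ (2 : ℝ) by norm_num, ← Real.rpow_mul two_pos.le,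
        show 2 * μ = 2 * (μ - 1 / 2) + 1 by ring, Real.rpow_add two_pos, Real.rpow_one]
    rw [← e4]
    rw [e3] at e1
    linarith
  have h2 := Real.Gamma_mul_Gamma_add_half (μ + 1 / 2)
  rw [show μ + 1 / 2 + 1 / 2 = μ + 1 by ring, show 2 * (μ + 1 / 2) = 2 * μ + 1 by ring,
    show 1 - (2 * μ + 1) = -(2 * μ) by ring, Real.rpow_neg two_pos.le] at h2
  have h3 : 0 < Real.Gamma (2 * μ + 1) := Real.Gamma_pos_of_pos (by linarith)
  have h4 : (0 : ℝ) < 2 ^ (2 * μ) := by positivity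
  rw [h1, ProbabilityTheory.beta, show μ + 1 / 2 + (μ + 1 / 2) = 2 * μ + 1 by ring]
  generalize Real.Gamma (2 * μ + 1) = X at *
  generalize Real.Gamma (μ + 1 / 2) = Y at *
  generalize Real.Gamma (μ + 1) = Z at *
  generalize (2 : ℝ) ^ (2 * μ) = P at *
  field_simp at h2 ⊢
  linear_combination Y * h2

/-! ### The product formula -/

/-- Lagrange's identity for the operator `u'' + (2μ+1)/x u'`. -/
theorem hasDerivAt_wronskian {A : Type*} [NormedField A] [NormedAlgebra ℝ A] (μ : ℝ)
    {u v u' v' : ℝ → A} {a b : A} {x : ℝ} (hx : 0 < x)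
    (hu : HasDerivAt u (u' x) x) (hv : HasDerivAt v (v' x) x)
    (hu' : HasDerivAt u' (a - ((2 * μ + 1) / x) • u' x) x)
    (hv' : HasDerivAt v' (b - ((2 * μ + 1) / x) • v' x) x) :
    HasDerivAt (fun x => x ^ (2 * μ + 1) • (v x * u' x - v' x * u x))
      (x ^ (2 * μ + 1) • (v x * a - b * u x)) x := by
  refine ((Real.hasDerivAt_rpow_const (p := 2 * μ + 1) (Or.inl hx.ne')).fun_smul
    ((hv.fun_mul hu').fun_sub (hv'.fun_mul hu))).congr_deriv ?_
  rw [add_sub_cancel_right, Real.rpow_add hx, Real.rpow_one]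
  simp only [Algebra.smul_def, map_mul, map_div₀]
  have : algebraMap ℝ A x ≠ 0 := by
    rw [Ne, map_eq_zero]
    exact hx.ne'
  field_simp
  ring

/-- The expression is at least `(z - |x|)²`. Nonpositive `x` are admitted so that the translate is
differentiable in a full neighbourhood of `x = 0`, where constants are evaluated. -/
theorem dist_sq_pos {x z v : ℝ} (hx : |x| < z) (hv : v ∈ Icc (-1 : ℝ) 1) :
    0 < x ^ 2 + z ^ 2 - 2 * x * z * v := by
  have h1 : |x * v| ≤ |x| := by
    rw [abs_mul]
    exact mul_le_of_le_one_right (abs_nonneg x) (abs_le.2 hv)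
  have h2 := le_abs_self (x * v)
  have h0 := abs_nonneg x
  have h3 : 0 < (z - |x|) ^ 2 := pow_pos (by linarith) 2
  nlinarith [sq_abs x, mul_le_mul_of_nonneg_left (h2.trans h1) (h0.trans hx.le)]

theorem hasDerivAt_bk_dist_left {l : ℝ} (hl : 0 < l) (ν : ℝ) {x z v : ℝ} (hx : |x| < z)
    (hv : v ∈ Icc (-1 : ℝ) 1) :
    HasDerivAt (fun x => bk l ν √(x ^ 2 + z ^ 2 - 2 * x * z * v))
      (-(x - z * v) * bk l (ν + 1) √(x ^ 2 + z ^ 2 - 2 * x * z * v)) x := by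
  have h0 := dist_sq_pos hx hv
  have h1 : HasDerivAt (fun x : ℝ => x ^ 2 + z ^ 2 - 2 * x * z * v) (2 * x - 2 * z * v) x := by
    have := ((hasDerivAt_pow 2 x).add_const (z ^ 2)).fun_sub
      ((((hasDerivAt_id x).const_mul 2).mul_const z).mul_const v)
    simpa using this
  have hs := Real.sqrt_pos.2 h0
  refine ((hasDerivAt_bk hl ν hs).comp x (h1.sqrt h0.ne')).congr_deriv ?_
  generalize √(x ^ 2 + z ^ 2 - 2 * x * z * v) = ρ at hs ⊢
  field_simp

theorem hasDerivAt_bk_dist_right {l : ℝ} (hl : 0 < l) (ν : ℝ) {x z v : ℝ} (hx : |x| < z)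
    (hv : v ∈ Icc (-1 : ℝ) 1) :
    HasDerivAt (fun v => bk l ν √(x ^ 2 + z ^ 2 - 2 * x * z * v))
      (x * z * bk l (ν + 1) √(x ^ 2 + z ^ 2 - 2 * x * z * v)) v := by
  have h0 := dist_sq_pos hx hv
  have h1 : HasDerivAt (fun v : ℝ => x ^ 2 + z ^ 2 - 2 * x * z * v) (-(2 * x * z)) v := by
    have := ((hasDerivAt_id v).const_mul (2 * x * z)).const_sub (x ^ 2 + z ^ 2)
    simpa using this
  have hs := Real.sqrt_pos.2 h0
  refine ((hasDerivAt_bk hl ν hs).comp v (h1.sqrt h0.ne')).congr_deriv ?_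
  generalize √(x ^ 2 + z ^ 2 - 2 * x * z * v) = ρ at hs ⊢
  field_simp

theorem continuousOn_bk_dist {l : ℝ} (hl : 0 < l) (ν z : ℝ) :
    ContinuousOn (fun q : ℝ × ℝ => bk l ν √(q.1 ^ 2 + z ^ 2 - 2 * q.1 * z * q.2))
      (Ioo (-z) z ×ˢ Icc (-1) 1) :=
  (continuousOn_bk hl ν).comp (Continuous.continuousOn (by fun_prop)) fun _ hq =>
    Real.sqrt_pos.2 (dist_sq_pos (abs_lt.2 hq.1) hq.2)

/-- The translate of `bk l μ`. -/
def bkTranslate (l μ z x : ℝ) : ℝ :=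
  ∫ v in Ioo (-1) 1, (1 - v ^ 2) ^ (μ - 1 / 2) * bk l μ √(x ^ 2 + z ^ 2 - 2 * x * z * v)

/-- The derivative of the translate of `bk l μ`. -/
def bkTranslateDeriv (l μ z x : ℝ) : ℝ :=
  ∫ v in Ioo (-1) 1, (1 - v ^ 2) ^ (μ - 1 / 2) *
    (-(x - z * v) * bk l (μ + 1) √(x ^ 2 + z ^ 2 - 2 * x * z * v))

theorem continuousOn_slice {z x : ℝ} (hx : |x| < z) {g : ℝ → ℝ → ℝ}
    (h : ContinuousOn (fun q : ℝ × ℝ => g q.1 q.2) (Ioo (-z) z ×ˢ Icc (-1) 1)) :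
    ContinuousOn (g x) (Icc (-1) 1) :=
  h.comp (f := fun v : ℝ => (x, v)) (Continuous.continuousOn (by fun_prop))
    fun _ hv => ⟨abs_lt.1 hx, hv⟩

theorem hasDerivAt_bkTranslate {l μ : ℝ} (hμ : -1 / 2 < μ) (hl : 0 < l) {x z : ℝ} (hx : |x| < z) :
    HasDerivAt (bkTranslate l μ z) (bkTranslateDeriv l μ z x) x := by
  refine hasDerivAt_integral_one_sub_sq_rpow_mul (by linarith) (isOpen_Ioo (a := -z) (b := z))
    (g := fun x v => bk l μ √(x ^ 2 + z ^ 2 - 2 * x * z * v))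
    (g' := fun x v => -(x - z * v) * bk l (μ + 1) √(x ^ 2 + z ^ 2 - 2 * x * z * v))
    (fun y hy v hv => hasDerivAt_bk_dist_left hl μ (abs_lt.2 hy) hv)
    (fun y hy => continuousOn_slice (abs_lt.2 hy)
      (g := fun x v => bk l μ √(x ^ 2 + z ^ 2 - 2 * x * z * v)) (continuousOn_bk_dist hl μ z))
      ?_ (abs_lt.1 hx)
  exact ContinuousOn.mul (Continuous.continuousOn (by fun_prop)) (continuousOn_bk_dist hl _ z)

theorem hasDerivAt_bkTranslateDeriv_aux {l μ : ℝ} (hμ : -1 / 2 < μ) (hl : 0 < l) {x z : ℝ}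
    (hx : |x| < z) :
    HasDerivAt (bkTranslateDeriv l μ z)
      (∫ v in Ioo (-1) 1, (1 - v ^ 2) ^ (μ - 1 / 2) *
        (-1 * bk l (μ + 1) √(x ^ 2 + z ^ 2 - 2 * x * z * v) + -(x - z * v) *
          (-(x - z * v) * bk l (μ + 1 + 1) √(x ^ 2 + z ^ 2 - 2 * x * z * v)))) x :=
  hasDerivAt_integral_one_sub_sq_rpow_mul (a := μ - 1 / 2) (by linarith)
    (isOpen_Ioo (a := -z) (b := z))
    (g := fun x v => -(x - z * v) * bk l (μ + 1) √(x ^ 2 + z ^ 2 - 2 * x * z * v))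
    (g' := fun x v => -1 * bk l (μ + 1) √(x ^ 2 + z ^ 2 - 2 * x * z * v) + -(x - z * v) *
      (-(x - z * v) * bk l (μ + 1 + 1) √(x ^ 2 + z ^ 2 - 2 * x * z * v)))
    (fun y hy v hv => by
      have h1 : HasDerivAt (fun y : ℝ => -(y - z * v)) (-1) y := by
        simpa using ((hasDerivAt_id y).sub_const (z * v)).fun_neg
      exact h1.fun_mul (hasDerivAt_bk_dist_left hl (μ + 1) (abs_lt.2 hy) hv))
    (fun y hy => ContinuousOn.mul (Continuous.continuousOn (by fun_prop))
      (continuousOn_slice (abs_lt.2 hy)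
        (g := fun x v => bk l (μ + 1) √(x ^ 2 + z ^ 2 - 2 * x * z * v))
        (continuousOn_bk_dist hl _ z)))
    (((continuousOn_bk_dist hl _ z).const_mul _).add
      (ContinuousOn.mul (Continuous.continuousOn (by fun_prop))
        (ContinuousOn.mul (Continuous.continuousOn (by fun_prop)) (continuousOn_bk_dist hl _ z))))
    (abs_lt.1 hx)

/-- Translation commutes with `L`. Under the integral sign the equation has a defect; by the
recurrence at the distance `ρ`, this defect is `-(z/x)` times the integrand of
`integral_one_sub_sq_rpow_mul_deriv` for `v ↦ bk l (μ+1) ρ`, and so it integrates to zero. -/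
theorem hasDerivAt_bkTranslateDeriv {l μ : ℝ} (hμ : -1 / 2 < μ) (hl : 0 < l) {x z : ℝ}
    (hx0 : 0 < x) (hx : x < z) :
    HasDerivAt (bkTranslateDeriv l μ z)
      (l * bkTranslate l μ z x - ((2 * μ + 1) / x) • bkTranslateDeriv l μ z x) x := by
  have hxa : |x| < z := by rwa [abs_of_pos hx0]
  have hcs : ∀ ν, ContinuousOn (fun v => bk l ν √(x ^ 2 + z ^ 2 - 2 * x * z * v)) (Icc (-1) 1) :=
    fun ν => continuousOn_slice hxa (g := fun x v => bk l ν √(x ^ 2 + z ^ 2 - 2 * x * z * v))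
      (continuousOn_bk_dist hl ν z)
  have h := hasDerivAt_bkTranslateDeriv_aux hμ hl hxa
  refine h.congr_deriv ?_
  have hp := integral_one_sub_sq_rpow_mul_deriv (a := μ - 1 / 2) (by linarith)
    (g := fun v => bk l (μ + 1) √(x ^ 2 + z ^ 2 - 2 * x * z * v))
    (g' := fun v => x * z * bk l (μ + 1 + 1) √(x ^ 2 + z ^ 2 - 2 * x * z * v))
    (fun v hv => hasDerivAt_bk_dist_right hl (μ + 1) hxa hv) ((hcs _).const_mul _)
  have hI : ∀ g : ℝ → ℝ, ContinuousOn g (Icc (-1) 1) → Integrable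
      (fun v : ℝ => (1 - v ^ 2) ^ (μ - 1 / 2) * g v) (volume.restrict (Ioo (-1) 1)) := fun g hg =>
    integrableOn_one_sub_sq_rpow_mul (by linarith) hg
  have hw : ContinuousOn (fun v : ℝ => -(x - z * v)) (Icc (-1) 1) := by fun_prop
  have i0 := (hI _ (hcs μ)).const_mul l
  have i1 := (hI (fun v => -(x - z * v) * bk l (μ + 1) √(x ^ 2 + z ^ 2 - 2 * x * z * v))
    (hw.mul (hcs (μ + 1)))).const_mul ((2 * μ + 1) / x)
  have i2 := hI (fun v => -1 * bk l (μ + 1) √(x ^ 2 + z ^ 2 - 2 * x * z * v) + -(x - z * v) *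
      (-(x - z * v) * bk l (μ + 1 + 1) √(x ^ 2 + z ^ 2 - 2 * x * z * v)))
    (((hcs _).const_mul _).add (hw.mul (hw.mul (hcs _))))
  rw [bkTranslate, bkTranslateDeriv, smul_eq_mul, ← integral_const_mul, ← integral_const_mul,
    ← integral_sub i0 i1, ← sub_eq_zero, ← integral_sub i2 (by exact i0.sub i1),
    ← mul_zero (-(z / x)), ← hp, ← integral_const_mul]
  refine setIntegral_congr_fun measurableSet_Ioo fun v hv => ?_
  have hq := dist_sq_pos hxa (Ioo_subset_Icc_self hv)
  have hr := bk_recurrence hl μ (Real.sqrt_pos.2 hq)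
  rw [Real.sq_sqrt hq.le] at hr
  simp only [show μ + 1 + 1 = μ + 2 by ring]
  generalize bk l (μ + 2) √(x ^ 2 + z ^ 2 - 2 * x * z * v) = k2 at *
  generalize bk l (μ + 1) √(x ^ 2 + z ^ 2 - 2 * x * z * v) = k1 at *
  generalize bk l μ √(x ^ 2 + z ^ 2 - 2 * x * z * v) = k0 at *
  generalize (1 - v ^ 2) ^ (μ - 1 / 2) = w at *
  field_simp
  linear_combination w * x * hr

theorem tendsto_rpow_nhdsGT_zero {a : ℝ} (ha : 0 < a) :
    Tendsto (fun x : ℝ => x ^ a) (𝓝[>] 0) (𝓝 0) := by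
  have h := (Real.continuousAt_rpow_const 0 a (Or.inr ha.le)).tendsto
  rw [Real.zero_rpow ha.ne'] at h
  exact h.mono_left nhdsWithin_le_nhds

/-- The product formula, on one side of the diagonal. -/
theorem bkTranslate_eq {l μ : ℝ} (hμ : -1 / 2 < μ) (hl : 0 < l) {x z : ℝ} (hx0 : 0 < x)
    (hx : x < z) : bkTranslate l μ z x = bi l μ x * bk l μ z := by
  have hz : 0 < z := hx0.trans hx
  have habs : ∀ y ∈ Ioo 0 z, |y| < z := fun y hy => by rw [abs_of_pos hy.1]; exact hy.2
  set V : ℝ → ℝ := bi l μ with hV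
  set V' : ℝ → ℝ := fun x => l / (2 * μ + 1) * (x * bi l (μ + 1) x) with hV'
  set F := bkTranslate l μ z with hF
  set F' := bkTranslateDeriv l μ z with hF'
  have hVd : ∀ y, HasDerivAt V (V' y) y := fun y => hasDerivAt_bi hl hμ y
  have hFd : ∀ y, |y| < z → HasDerivAt F (F' y) y := fun y hy => hasDerivAt_bkTranslate hμ hl hy
  have hVpos : ∀ y, 0 < V y := fun y => bi_pos l hμ y
  have hW : ∀ y ∈ Ioo 0 z, HasDerivAt (fun x => x ^ (2 * μ + 1) • (V x * F' x - V' x * F x))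
      0 y := by
    intro y hy
    refine (hasDerivAt_wronskian μ hy.1 (hFd y (habs y hy)) (hVd y)
      (hasDerivAt_bkTranslateDeriv hμ hl hy.1 hy.2)
      (hasDerivAt_deriv_bi hl hμ hy.1)).congr_deriv ?_
    rw [smul_eq_mul]
    ring
  -- The translate and `bi` solve the same equation, so the weighted Wronskian is constant. It tends
  -- to `0` at the origin, where `x^(2μ+1)` vanishes and the other factor is continuous.
  have hW0 : ∀ y ∈ Ioo 0 z, y ^ (2 * μ + 1) • (V y * F' y - V' y * F y) = 0 := by
    obtain ⟨C, hC⟩ := isOpen_Ioo.exists_is_const_of_deriv_eq_zero isPreconnected_Ioo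
      (fun y hy => (hW y hy).differentiableAt.differentiableWithinAt)
      (fun y hy => (hW y hy).deriv)
    have hlim : Tendsto (fun x => x ^ (2 * μ + 1) • (V x * F' x - V' x * F x)) (𝓝[>] 0)
        (𝓝 0) := by
      have hz0 : |(0 : ℝ)| < z := by simpa using hz
      have hV'c : ContinuousAt V' 0 := (continuous_const.mul (continuous_id.mul
        (contDiff_bi hl (by linarith : -1 / 2 < μ + 1)).continuous)).continuousAt
      have h1 : ContinuousAt (fun x => V x * F' x - V' x * F x) 0 :=
        ((hVd 0).continuousAt.mul
          (hasDerivAt_bkTranslateDeriv_aux hμ hl hz0).continuousAt).sub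
          (hV'c.mul (hFd 0 hz0).continuousAt)
      have h2 := (tendsto_rpow_nhdsGT_zero (a := 2 * μ + 1) (by linarith)).smul
        (h1.tendsto.mono_left (nhdsWithin_le_nhds (s := Ioi 0)))
      rwa [zero_smul] at h2
    have hC0 : C = 0 := by
      refine tendsto_nhds_unique (tendsto_const_nhds.congr' ?_) hlim
      filter_upwards [Ioo_mem_nhdsGT hz] with y hy
      exact (hC y hy).symm
    intro y hy
    rw [hC y hy, hC0]
  -- The numerator of the derivative of the quotient is the Wronskian, so the quotient is constant
  -- and can be evaluated at `0`.
  have hq : ∀ y ∈ Ioo 0 z, HasDerivAt (fun y => F y / V y) 0 y := by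
    intro y hy
    refine ((hFd y (habs y hy)).fun_div (hVd y) (hVpos y).ne').congr_deriv ?_
    have h1 := (smul_eq_zero.1 (hW0 y hy)).resolve_left (Real.rpow_pos_of_pos hy.1 _).ne'
    rw [div_eq_zero_iff]
    left
    linear_combination h1
  obtain ⟨C, hC⟩ := isOpen_Ioo.exists_is_const_of_deriv_eq_zero isPreconnected_Ioo
      (fun y hy => (hq y hy).differentiableAt.differentiableWithinAt)
      (fun y hy => (hq y hy).deriv)
  have hlim : Tendsto (fun y => F y / V y) (𝓝[>] 0) (𝓝 (F 0 / V 0)) := by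
    have h1 := (hFd 0 (by simpa using hz)).continuousAt.tendsto
    have h2 := (hVd 0).continuousAt.tendsto
    exact (h1.div h2 (hVpos 0).ne').mono_left nhdsWithin_le_nhds
  have hC0 : C = F 0 / V 0 := by
    refine tendsto_nhds_unique (tendsto_const_nhds.congr' ?_) hlim
    filter_upwards [Ioo_mem_nhdsGT hz] with y hy
    exact (hC y hy).symm
  -- At `x = 0` every distance equals `z`, so `bk` leaves the integral.
  have h0 : F 0 = V 0 * bk l μ z := by
    simp only [hF, hV, bkTranslate, bi]
    rw [← integral_mul_const]
    simp [Real.sqrt_sq hz.le]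
  have := hC x ⟨hx0, hx⟩
  rw [hC0, h0, mul_div_cancel_left₀ _ (hVpos 0).ne', div_eq_iff (hVpos x).ne'] at this
  rw [this, mul_comm]

/-! ### Green's function and the law of cosines -/

theorem bk_pos {l : ℝ} (hl : 0 < l) (ν : ℝ) {y : ℝ} (hy : 0 < y) : 0 < bk l ν y := by
  refine mul_pos (by positivity) ?_
  rw [setIntegral_pos_iff_support_of_nonneg_ae
    ((ae_restrict_iff' measurableSet_Ioi).2 (ae_of_all _ fun t ht => ?_))
    (integrableOn_bk_integrand hl hy _)]
  · have : Function.support (fun t => Real.exp (-l * t - y ^ 2 / (4 * t)) * t ^ (-ν - 1)) ∩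
        Ioi 0 = Ioi 0 := by
      refine inter_eq_right.2 fun t ht => ?_
      have : (0 : ℝ) < t := ht
      exact (by positivity : (0 : ℝ) < _).ne'
    rw [this]
    simp
  · have : (0 : ℝ) < t := ht
    simp only [Pi.zero_apply]
    positivity

theorem bkTranslate_comm (l μ x z : ℝ) : bkTranslate l μ z x = bkTranslate l μ x z := by
  unfold bkTranslate
  congr 1
  funext v
  congr 3
  ring

/-- Green's function of `l - u'' - (2μ+1)/x u'`, with respect to the measure `s dx`. -/
def green (l μ x z : ℝ) : ℝ := bi l μ (min x z) * bk l μ (max x z) / bi l μ 0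

/-- The translate is symmetric in `x` and `z`, so the product formula for `x < z` covers both sides
of the diagonal. -/
theorem bkTranslate_eq_green {l μ : ℝ} (hμ : -1 / 2 < μ) (hl : 0 < l) {x z : ℝ} (hx : 0 < x)
    (hz : 0 < z) (hxz : x ≠ z) : bkTranslate l μ z x = bi l μ 0 * green l μ x z := by
  have h0 := (bi_pos l hμ 0).ne'
  rw [green, mul_div_cancel₀ _ h0]
  rcases lt_or_gt_of_ne hxz with h | h
  · rw [bkTranslate_eq hμ hl hx h, min_eq_left h.le, max_eq_right h.le]
  · rw [bkTranslate_comm, bkTranslate_eq hμ hl hz h, min_eq_right h.le, max_eq_left h.le]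

theorem triangle_iff {x y z : ℝ} :
    (|x - y| < z ∧ z < x + y) ↔ y ∈ Ioo |x - z| (x + z) := by
  rw [mem_Ioo, abs_lt, abs_lt]
  constructor
  · rintro ⟨⟨h1, h2⟩, h3⟩
    exact ⟨⟨by linarith, by linarith⟩, by linarith⟩
  · rintro ⟨⟨h1, h2⟩, h3⟩
    exact ⟨⟨by linarith, by linarith⟩, by linarith⟩

/-- The quotient is the cosine of the angle between the sides `x` and `z`; it lies strictly between
`-1` and `1` exactly when the triangle is nondegenerate. -/
theorem cosine_mem_iff {x y z : ℝ} (hx : 0 < x) (hz : 0 < z) (hy : 0 < y) :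
    (x ^ 2 + z ^ 2 - y ^ 2) / (2 * x * z) ∈ Ioo (-1 : ℝ) 1 ↔ y ∈ Ioo |x - z| (x + z) := by
  have h : 0 < 2 * x * z := by positivity
  rw [mem_Ioo, mem_Ioo, lt_div_iff₀ h, div_lt_one h, and_comm]
  refine and_congr ?_ ?_
  · rw [← abs_of_pos hy, ← sq_lt_sq, abs_of_pos hy]
    constructor <;> intro h <;> nlinarith
  · rw [← abs_of_pos hy, ← abs_of_pos (add_pos hx hz), ← sq_lt_sq, abs_of_pos hy]
    constructor <;> intro h <;> nlinarith

theorem image_cosine {x z : ℝ} (hx : 0 < x) (hz : 0 < z) :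
    (fun y : ℝ => (x ^ 2 + z ^ 2 - y ^ 2) / (2 * x * z)) '' Ioo |x - z| (x + z) =
      Ioo (-1) 1 := by
  have h : 0 < 2 * x * z := by positivity
  ext v
  constructor
  · rintro ⟨y, hy, rfl⟩
    exact (cosine_mem_iff hx hz ((abs_nonneg _).trans_lt hy.1)).2 hy
  · intro hv
    have hq : 0 < x ^ 2 + z ^ 2 - 2 * x * z * v := by
      nlinarith [sq_nonneg (x - z), mul_pos h (sub_pos.2 hv.2)]
    have e : (x ^ 2 + z ^ 2 - √(x ^ 2 + z ^ 2 - 2 * x * z * v) ^ 2) / (2 * x * z) = v := by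
      rw [Real.sq_sqrt hq.le, div_eq_iff h.ne']
      ring
    refine ⟨√(x ^ 2 + z ^ 2 - 2 * x * z * v), ?_, e⟩
    rw [← cosine_mem_iff hx hz (Real.sqrt_pos.2 hq), e]
    exact hv

/-- With `v` the cosine of the angle between `x` and `z`, the area is `(xz/2) √(1 - v²)`. The powers
of `y` in `D_μ` and `N_l` multiply to `y`, and `y/(xz)` is the Jacobian `|dv/dy|`. The right side is
thus arranged for the substitution by `v`. -/
theorem D_mul_N_eq {μ l x y z : ℝ} (hl : 0 < l) (hx : 0 < x) (hz : 0 < z)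
    (hy : y ∈ Ioo |x - z| (x + z)) :
    D μ x y z * N μ l y = (x * z) ^ (μ + 1 / 2) * (2 ^ (-μ) / (Real.Gamma (μ + 1 / 2) * √Real.pi)) *
      (y / (x * z) * ((1 - ((x ^ 2 + z ^ 2 - y ^ 2) / (2 * x * z)) ^ 2) ^ (μ - 1 / 2) *
        bk l μ √(x ^ 2 + z ^ 2 - 2 * x * z * ((x ^ 2 + z ^ 2 - y ^ 2) / (2 * x * z))))) := by
  have hy0 : 0 < y := (abs_nonneg _).trans_lt hy.1
  have hv := (cosine_mem_iff hx hz hy0).2 hy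
  have h1 := one_sub_sq_pos hv
  have e1 : x ^ 2 + z ^ 2 - 2 * x * z * ((x ^ 2 + z ^ 2 - y ^ 2) / (2 * x * z)) = y ^ 2 := by
    field_simp
    ring
  have e2 : area x y z = x * z / 2 * √(1 - ((x ^ 2 + z ^ 2 - y ^ 2) / (2 * x * z)) ^ 2) := by
    rw [area, show ((x + y) ^ 2 - z ^ 2) * (z ^ 2 - (x - y) ^ 2) = (2 * x * z) ^ 2 *
      (1 - ((x ^ 2 + z ^ 2 - y ^ 2) / (2 * x * z)) ^ 2) by field_simp; ring,
      Real.sqrt_mul (by positivity), Real.sqrt_sq (by positivity)]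
    ring
  have e3 : √(1 - ((x ^ 2 + z ^ 2 - y ^ 2) / (2 * x * z)) ^ 2) ^ (2 * μ - 1) =
      (1 - ((x ^ 2 + z ^ 2 - y ^ 2) / (2 * x * z)) ^ 2) ^ (μ - 1 / 2) := by
    rw [Real.sqrt_eq_rpow, ← Real.rpow_mul h1.le]
    congr 1
    ring
  rw [e1, Real.sqrt_sq hy0.le, D, if_pos (triangle_iff.2 hy), N_eq hl hy0, e2,
    Real.mul_rpow (by positivity) (Real.sqrt_nonneg _), e3]
  generalize (1 - ((x ^ 2 + z ^ 2 - y ^ 2) / (2 * x * z)) ^ 2) ^ (μ - 1 / 2) = w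
  generalize bk l μ y = k
  have hxz : 0 < x * z := by positivity
  have e4 : x * y * z = (x * z) * y := by ring
  rw [e4, Real.mul_rpow hxz.le hy0.le, Real.div_rpow hxz.le two_pos.le]
  have f1 : y ^ (-μ + 1 / 2) * y ^ (μ + 1 / 2) = y := by
    rw [← Real.rpow_add hy0, show -μ + 1 / 2 + (μ + 1 / 2) = 1 by ring, Real.rpow_one]
  have f2 : (x * z) ^ (-μ + 1 / 2) * (x * z) ^ (2 * μ - 1) = (x * z) ^ (μ + 1 / 2) / (x * z) := by
    rw [← Real.rpow_add hxz, ← Real.rpow_sub_one hxz.ne']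
    congr 1
    ring
  have f3 : (2 : ℝ) ^ (μ - 1) / 2 ^ (2 * μ - 1) = 2 ^ (-μ) := by
    rw [← Real.rpow_sub two_pos]
    congr 1
    ring
  rw [← f3]
  calc _ = ((x * z) ^ (-μ + 1 / 2) * (x * z) ^ (2 * μ - 1)) * (y ^ (-μ + 1 / 2) * y ^ (μ + 1 / 2)) *
        (2 ^ (μ - 1) / 2 ^ (2 * μ - 1)) / (Real.Gamma (μ + 1 / 2) * √Real.pi) * w * k := by ring
    _ = _ := by
        rw [f1, f2]
        ring

/-- Substituting the cosine `v` for `y` gives the translate of `bk`, and the product formula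
evaluates it. The constants agree by `bi_zero_eq`. -/
theorem integral_D_mul_N {l μ : ℝ} (hμ : -1 / 2 < μ) (hl : 0 < l) {x z : ℝ} (hx : 0 < x)
    (hz : 0 < z) (hxz : x ≠ z) :
    ∫ y in Ioi 0, D μ x y z * N μ l y = (x * z) ^ (μ + 1 / 2) / c μ * green l μ x z := by
  have hsub : Ioo |x - z| (x + z) ⊆ Ioi 0 := fun y hy => (abs_nonneg _).trans_lt hy.1
  have hpos : 0 < 2 * x * z := by positivity
  rw [setIntegral_eq_of_subset_of_forall_sdiff_eq_zero measurableSet_Ioi hsub,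
    setIntegral_congr_fun measurableSet_Ioo fun y hy => D_mul_N_eq (μ := μ) hl hx hz hy,
    integral_const_mul]
  · have h := integral_image_eq_integral_abs_deriv_smul
      (f := fun y : ℝ => (x ^ 2 + z ^ 2 - y ^ 2) / (2 * x * z)) (f' := fun y => -(y / (x * z)))
      (s := Ioo |x - z| (x + z)) measurableSet_Ioo (fun y hy => ?_) ?_
      (fun v => (1 - v ^ 2) ^ (μ - 1 / 2) * bk l μ √(x ^ 2 + z ^ 2 - 2 * x * z * v))
    · rw [image_cosine hx hz] at h
      have h2 : ∫ y in Ioo |x - z| (x + z), (y / (x * z) *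
          ((1 - ((x ^ 2 + z ^ 2 - y ^ 2) / (2 * x * z)) ^ 2) ^ (μ - 1 / 2) *
          bk l μ √(x ^ 2 + z ^ 2 - 2 * x * z * ((x ^ 2 + z ^ 2 - y ^ 2) / (2 * x * z))))) =
          bkTranslate l μ z x := by
        rw [bkTranslate, h]
        refine setIntegral_congr_fun measurableSet_Ioo fun y hy => ?_
        have hy0 : 0 < y := hsub hy
        rw [abs_neg, abs_of_pos (by positivity), smul_eq_mul]
      rw [h2, bkTranslate_eq_green hμ hl hx hz hxz]
      have h3 := bi_zero_eq l hμ
      have h4 := bi_pos l hμ 0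
      have h5 : 0 < Real.Gamma (μ + 1) := Real.Gamma_pos_of_pos (by linarith)
      have h6 : 0 < Real.Gamma (μ + 1 / 2) := Real.Gamma_pos_of_pos (by linarith)
      have h7 : 0 < √Real.pi := Real.sqrt_pos.2 Real.pi_pos
      have h8 : (0 : ℝ) < 2 ^ μ := by positivity
      rw [c, Real.rpow_neg two_pos.le]
      generalize green l μ x z = g
      generalize (x * z) ^ (μ + 1 / 2) = X
      generalize Real.Gamma (μ + 1) = G at *
      generalize Real.Gamma (μ + 1 / 2) = H at *
      generalize (2 : ℝ) ^ μ = P at *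
      field_simp
      linear_combination X * g * h3
    · refine HasDerivAt.hasDerivWithinAt ?_
      refine (((hasDerivAt_pow 2 y).const_sub (x ^ 2 + z ^ 2)).div_const (2 * x * z)).congr_deriv ?_
      field_simp
      norm_num
    · intro a ha b hb hab
      have ha0 : 0 < a := hsub ha
      have hb0 : 0 < b := hsub hb
      simp only at hab
      rw [div_left_inj' hpos.ne'] at hab
      exact (sq_eq_sq₀ ha0.le hb0.le).1 (by linarith)
  · rintro y ⟨hy, hy'⟩
    rw [D, if_neg (fun h => hy' (triangle_iff.1 h)), zero_mul]

theorem green_pos {l μ : ℝ} (hμ : -1 / 2 < μ) (hl : 0 < l) {x z : ℝ} (hx : 0 < x) :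
    0 < green l μ x z :=
  div_pos (mul_pos (bi_pos l hμ _) (bk_pos hl μ (lt_max_of_lt_left hx))) (bi_pos l hμ 0)

theorem green_comm (l μ x z : ℝ) : green l μ x z = green l μ z x := by
  rw [green, green, min_comm, max_comm]

theorem integrableOn_D_mul_N {l μ : ℝ} (hμ : -1 / 2 < μ) (hl : 0 < l) {x z : ℝ} (hx : 0 < x)
    (hz : 0 < z) (hxz : x ≠ z) : IntegrableOn (fun y => D μ x y z * N μ l y) (Ioi 0) := by
  -- A function that is not integrable has integral `0` by convention, so the positive value just
  -- computed proves integrability.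
  refine Integrable.of_integral_ne_zero ?_
  rw [integral_D_mul_N hμ hl hx hz hxz]
  have h1 := green_pos hμ hl hx (z := z)
  have h2 := c_pos hμ
  positivity

theorem D_mul_N_nonneg {l μ : ℝ} (hμ : -1 / 2 < μ) (hl : 0 < l) {x y z : ℝ} (hx : 0 < x)
    (hz : 0 < z) : 0 ≤ D μ x y z * N μ l y := by
  by_cases hy : y ∈ Ioo |x - z| (x + z)
  · rw [D_mul_N_eq hl hx hz hy]
    have hy0 : 0 < y := (abs_nonneg _).trans_lt hy.1
    have h1 := one_sub_sq_pos ((cosine_mem_iff hx hz hy0).2 hy)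
    have h2 := bk_nonneg l μ
      √(x ^ 2 + z ^ 2 - 2 * x * z * ((x ^ 2 + z ^ 2 - y ^ 2) / (2 * x * z)))
    have h6 : 0 < Real.Gamma (μ + 1 / 2) := Real.Gamma_pos_of_pos (by linarith)
    positivity
  · rw [D, if_neg (fun h => hy (triangle_iff.1 h)), zero_mul]

theorem measurable_D (μ x : ℝ) : Measurable (fun q : ℝ × ℝ => D μ x q.1 q.2) := by
  unfold D area
  refine Measurable.ite ?_ (by fun_prop) measurable_const
  exact (measurableSet_lt (f := fun q : ℝ × ℝ => |x - q.1|) (g := fun q => q.2) (by fun_prop)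
    (by fun_prop)).inter (measurableSet_lt (f := fun q : ℝ × ℝ => q.2) (g := fun q => x + q.1)
    (by fun_prop) (by fun_prop))

theorem measurable_N (μ l : ℝ) : Measurable (N μ l) := by
  have h : Measurable (macdonald μ) := by
    have h1 : Measurable (fun q : ℝ × ℝ =>
      Real.exp (-q.2 - q.1 ^ 2 / (4 * q.2)) / q.2 ^ (μ + 1)) := by fun_prop
    have h2 := (h1.stronglyMeasurable.integral_prod_right'
      (ν := volume.restrict (Ioi (0 : ℝ)))).measurable
    unfold macdonald
    fun_prop
  unfold N
  fun_prop

/-! ### Green's identity -/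

/-- The derivative of `bi l μ`. -/
def biDeriv (l μ x : ℝ) : ℝ := l / (2 * μ + 1) * (x * bi l (μ + 1) x)

/-- The derivative of `bk l μ`. -/
def bkDeriv (l μ x : ℝ) : ℝ := -x * bk l (μ + 1) x

/-- Lagrange's identity makes the left side constant. Its value is the limit at `0`, where only the
product of `bi l μ 0` with the singularity of `bk l (μ+1)` survives. -/
theorem wronskian_bk_bi {l μ : ℝ} (hμ : -1 / 2 < μ) (hl : 0 < l) {x : ℝ} (hx : 0 < x) :
    x ^ (2 * μ + 1) * (bk l μ x * biDeriv l μ x - bkDeriv l μ x * bi l μ x) = bi l μ 0 * c μ := by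
  have hW : ∀ y ∈ Ioi (0 : ℝ), HasDerivAt (fun x => x ^ (2 * μ + 1) •
      (bk l μ x * biDeriv l μ x - bkDeriv l μ x * bi l μ x)) 0 y := by
    intro y hy
    refine (hasDerivAt_wronskian μ (mem_Ioi.1 hy) (hasDerivAt_bi hl hμ y) (hasDerivAt_bk hl μ hy)
      (hasDerivAt_deriv_bi hl hμ hy) (hasDerivAt_deriv_bk hl μ hy)).congr_deriv ?_
    rw [smul_eq_mul]
    ring
  obtain ⟨C, hC⟩ := isOpen_Ioi.exists_is_const_of_deriv_eq_zero isPreconnected_Ioi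
      (fun y hy => (hW y hy).differentiableAt.differentiableWithinAt)
      (fun y hy => (hW y hy).deriv)
  have hlim : Tendsto (fun x => x ^ (2 * μ + 1) •
      (bk l μ x * biDeriv l μ x - bkDeriv l μ x * bi l μ x)) (𝓝[>] 0) (𝓝 (bi l μ 0 * c μ)) := by
    have c1 : Tendsto (bi l (μ + 1)) (𝓝[>] 0) (𝓝 (bi l (μ + 1) 0)) :=
      ((contDiff_bi hl (by linarith : -1 / 2 < μ + 1)).continuous.tendsto 0).mono_left
        nhdsWithin_le_nhds
    have c0 : Tendsto (bi l μ) (𝓝[>] 0) (𝓝 (bi l μ 0)) :=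
      ((contDiff_bi hl hμ).continuous.tendsto 0).mono_left nhdsWithin_le_nhds
    have h := ((tendsto_rpow_mul_bk hμ hl).mul (c1.const_mul (l / (2 * μ + 1)))).add
      (c0.mul (tendsto_rpow_mul_bk_succ hμ hl))
    rw [zero_mul, zero_add] at h
    refine h.congr' ?_
    filter_upwards [self_mem_nhdsWithin] with y hy
    have hy0 : (0 : ℝ) < y := hy
    rw [show 2 * μ + 2 = 2 * μ + 1 + 1 by ring, Real.rpow_add hy0, Real.rpow_one, biDeriv,
      bkDeriv, smul_eq_mul]
    ring
  have hC0 : C = bi l μ 0 * c μ := by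
    refine tendsto_nhds_unique (tendsto_const_nhds.congr' ?_) hlim
    filter_upwards [self_mem_nhdsWithin] with y hy
    exact (hC y hy).symm
  rw [← hC0, ← hC x hx, smul_eq_mul]

/-- `bk` decreases faster than any power: the exponent `b` can be placed below any given `e`. With
`e = 0` this gives limits at infinity, with `e = -1` integrability. -/
theorem exists_rpow_mul_bk_le {l : ℝ} (hl : 0 < l) (ν a e : ℝ) :
    ∃ C, 0 ≤ C ∧ ∃ b < e, ∀ y, 0 < y → y ^ a * bk l ν y ≤ C * y ^ b := by
  obtain ⟨n, hn⟩ := exists_nat_gt (max ν ((a - e) / 2))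
  obtain ⟨C, hC0, hC⟩ := exists_pow_mul_bk_le hl ν n ((le_max_left _ _).trans_lt hn)
  refine ⟨C, hC0, a - 2 * n, ?_, fun y hy => ?_⟩
  · have := (le_max_right ν ((a - e) / 2)).trans_lt hn
    linarith
  · have h := hC y hy
    have h2 : y ^ (a - 2 * n) = y ^ a / y ^ (2 * n) := by
      rw [Real.rpow_sub hy, show (2 * n : ℝ) = ((2 * n : ℕ) : ℝ) by push_cast; ring,
        Real.rpow_natCast]
    have h3 : 0 < y ^ a := Real.rpow_pos_of_pos hy a
    rw [h2, mul_div_assoc', le_div_iff₀ (by positivity)]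
    nlinarith

theorem tendsto_rpow_mul_bk_atTop {l : ℝ} (hl : 0 < l) (ν a : ℝ) :
    Tendsto (fun y => y ^ a * bk l ν y) atTop (𝓝 0) := by
  obtain ⟨C, -, b, hb, hC⟩ := exists_rpow_mul_bk_le hl ν a 0
  have h := (tendsto_rpow_neg_atTop (y := -b) (by linarith)).const_mul C
  rw [neg_neg, mul_zero] at h
  refine squeeze_zero' ?_ ?_ h
  · filter_upwards [eventually_gt_atTop 0] with y hy
    have := bk_nonneg l ν y
    positivity
  · filter_upwards [eventually_gt_atTop 0] with y hy
    exact hC y hy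

theorem integrableOn_rpow_mul_bk {l : ℝ} (hl : 0 < l) (ν a : ℝ) {x : ℝ} (hx : 0 < x) :
    IntegrableOn (fun y => y ^ a * bk l ν y) (Ioi x) := by
  obtain ⟨C, -, b, hb, hC⟩ := exists_rpow_mul_bk_le hl ν a (-1)
  have hsub : Ioi x ⊆ Ioi 0 := Ioi_subset_Ioi hx.le
  refine ((integrableOn_Ioi_rpow_of_lt hb hx).const_mul C).mono'
    ((ContinuousOn.mul (continuousOn_id.rpow_const fun y hy => Or.inl (ne_of_gt (hsub hy)))
      ((continuousOn_bk hl ν).mono hsub)).aestronglyMeasurable measurableSet_Ioi)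
    ((ae_restrict_iff' measurableSet_Ioi).2 (ae_of_all _ fun y hy => ?_))
  have hy0 : 0 < y := hsub hy
  have := bk_nonneg l ν y
  rw [Real.norm_of_nonneg (by positivity)]
  exact hC y hy0

theorem measurable_green (l : ℝ) {μ : ℝ} (hμ : -1 / 2 < μ) (hl : 0 < l) :
    Measurable (fun q : ℝ × ℝ => green l μ q.1 q.2) := by
  have h1 := (contDiff_bi hl hμ).continuous.measurable
  have h2 := measurable_bk l μ
  unfold green
  exact ((h1.comp (measurable_fst.min measurable_snd)).mul
    (h2.comp (measurable_fst.max measurable_snd))).div_const _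

theorem measurable_s (μ : ℝ) : Measurable (s μ) := by
  unfold s
  fun_prop

theorem integrableOn_rpow_mul_bi {l μ : ℝ} (hμ : -1 / 2 < μ) (hl : 0 < l) (x : ℝ) :
    IntegrableOn (fun z => z ^ (2 * μ + 1) * bi l μ z) (Ioc 0 x) := by
  have h : Continuous fun z : ℝ => z ^ (2 * μ + 1) * bi l μ z :=
    (Real.continuous_rpow_const (by linarith)).mul (contDiff_bi hl hμ).continuous
  exact (h.continuousOn.integrableOn_Icc (a := 0) (b := x)).mono_set Ioc_subset_Icc_self

theorem integrableOn_green {l μ : ℝ} (hμ : -1 / 2 < μ) (hl : 0 < l) {x : ℝ} (hx : 0 < x) :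
    IntegrableOn (fun z => green l μ x z * s μ z) (Ioi 0) := by
  rw [← Ioc_union_Ioi_eq_Ioi hx.le]
  refine IntegrableOn.union ?_ ?_
  · refine IntegrableOn.congr_fun (Integrable.const_mul (integrableOn_rpow_mul_bi hμ hl x)
      (bk l μ x / bi l μ 0 / c μ)) (fun z hz => ?_) measurableSet_Ioc
    simp only [green, s, min_eq_right hz.2, max_eq_left hz.2]
    ring
  · refine IntegrableOn.congr_fun (Integrable.const_mul
      (integrableOn_rpow_mul_bk hl μ (2 * μ + 1) hx) (bi l μ x / bi l μ 0 / c μ))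
      (fun z hz => ?_) measurableSet_Ioi
    simp only [green, s, min_eq_left (mem_Ioi.1 hz).le, max_eq_right (mem_Ioi.1 hz).le]
    ring

/-- Green's function inverts `l - u'' - (2μ+1)/x u'`. -/
theorem green_identity {l μ : ℝ} (hμ : -1 / 2 < μ) (hl : 0 < l) {u u' Lu : ℝ → ℂ} {C : ℝ}
    (hu : ∀ x, 0 < x → HasDerivAt u (u' x) x)
    (hu' : ∀ x, 0 < x → HasDerivAt u' (Lu x - ((2 * μ + 1) / x) • u' x) x)
    (hC : ∀ x, 0 < x → ‖u x‖ ≤ C) (hC' : ∀ x, 0 < x → ‖u' x‖ ≤ C * x)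
    (hCL : ∀ x, 0 < x → ‖Lu x‖ ≤ C) (hLc : ContinuousOn Lu (Ioi 0)) {x : ℝ} (hx : 0 < x) :
    ∫ z in Ioi 0, ((green l μ x z * s μ z : ℝ) : ℂ) * (l * u z - Lu z) = u x := by
  have hbi1 : Continuous (bi l (μ + 1)) := (contDiff_bi hl (by linarith)).continuous
  have hbi : Continuous (bi l μ) := (contDiff_bi hl hμ).continuous
  have hC0 : 0 ≤ C := (norm_nonneg _).trans (hC 1 one_pos)
  set h : ℝ → ℂ := fun z => l * u z - Lu z with hh
  have hhc : ContinuousOn h (Ioi 0) := ContinuousOn.sub (ContinuousOn.mul continuousOn_const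
    fun z hz => (hu z hz).continuousAt.continuousWithinAt) hLc
  have hhb : ∀ z, 0 < z → ‖h z‖ ≤ l * C + C := fun z hz => by
    refine (norm_sub_le _ _).trans (add_le_add ?_ (hCL z hz))
    rw [norm_mul, Complex.norm_real, Real.norm_of_nonneg hl.le]
    exact mul_le_mul_of_nonneg_left (hC z hz) hl.le
  -- integrals against a solution of the homogeneous equation
  have hInt : ∀ (g : ℝ → ℝ) (S : Set ℝ), MeasurableSet S → S ⊆ Ioi 0 → IntegrableOn g S →
      IntegrableOn (fun z => (g z : ℂ) * h z) S := by
    intro g S hS hS0 hg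
    exact (Integrable.ofReal hg).mul_bdd (c := l * C + C)
      ((hhc.mono hS0).aestronglyMeasurable hS)
      ((ae_restrict_iff' hS).2 (ae_of_all _ fun z hz => hhb z (hS0 hz)))
  -- The weighted Wronskians of `u` with the two homogeneous solutions; their derivatives are minus
  -- the integrands on the two sides of `x`.
  set w1 : ℝ → ℂ := fun z => z ^ (2 * μ + 1) • ((bi l μ z : ℂ) * u' z - (biDeriv l μ z : ℂ) * u z)
    with hw1
  set w2 : ℝ → ℂ := fun z => z ^ (2 * μ + 1) • ((bk l μ z : ℂ) * u' z - (bkDeriv l μ z : ℂ) * u z)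
    with hw2
  have d1 : ∀ z, 0 < z → HasDerivAt w1 (-(((z ^ (2 * μ + 1) * bi l μ z : ℝ) : ℂ) * h z)) z := by
    intro z hz
    have hv := (hasDerivAt_bi hl hμ z).ofReal_comp
    have hv' := (hasDerivAt_deriv_bi hl hμ hz).ofReal_comp
    refine (hasDerivAt_wronskian μ (v := fun z => (bi l μ z : ℂ))
      (v' := fun z => (biDeriv l μ z : ℂ)) (b := l * bi l μ z) hz (hu z hz) hv (hu' z hz)
      ?_).congr_deriv ?_
    · refine hv'.congr_deriv ?_
      simp only [Complex.real_smul, biDeriv]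
      push_cast
      ring
    · simp only [Complex.real_smul, hh]
      push_cast
      ring
  have d2 : ∀ z, 0 < z → HasDerivAt w2 (-(((z ^ (2 * μ + 1) * bk l μ z : ℝ) : ℂ) * h z)) z := by
    intro z hz
    have hv := (hasDerivAt_bk hl μ hz).ofReal_comp
    have hv' := (hasDerivAt_deriv_bk hl μ hz).ofReal_comp
    refine (hasDerivAt_wronskian μ (v := fun z => (bk l μ z : ℂ))
      (v' := fun z => (bkDeriv l μ z : ℂ)) (b := l * bk l μ z) hz (hu z hz) hv (hu' z hz)
      ?_).congr_deriv ?_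
    · refine hv'.congr_deriv ?_
      simp only [Complex.real_smul, bkDeriv]
      push_cast
      ring
    · simp only [Complex.real_smul, hh]
      push_cast
      ring
  have i1 := hInt _ (Ioc 0 x) measurableSet_Ioc Ioc_subset_Ioi_self
    (integrableOn_rpow_mul_bi hμ hl x)
  have i2 := hInt _ (Ioi x) measurableSet_Ioi (Ioi_subset_Ioi hx.le)
    (integrableOn_rpow_mul_bk hl μ (2 * μ + 1) hx)
  have I1 : ∫ z in Ioc 0 x, ((z ^ (2 * μ + 1) * bi l μ z : ℝ) : ℂ) * h z = -w1 x := by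
    have lim0 : Tendsto w1 (𝓝[>] 0) (𝓝 0) := by
      have e : Tendsto (fun z : ℝ => z ^ (2 * μ + 1) *
          (|bi l μ z| * (C * z) + |biDeriv l μ z| * C)) (𝓝[>] 0) (𝓝 0) := by
        have hc : Continuous fun z => |bi l μ z| * (C * z) + |biDeriv l μ z| * C := by
          unfold biDeriv
          fun_prop
        have := (tendsto_rpow_nhdsGT_zero (a := 2 * μ + 1) (by linarith)).mul
          ((hc.tendsto 0).mono_left (nhdsWithin_le_nhds (s := Ioi 0)))
        rwa [zero_mul] at this
      refine squeeze_zero_norm' ?_ e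
      filter_upwards [self_mem_nhdsWithin] with z hz
      have hz0 : (0 : ℝ) < z := hz
      rw [hw1, norm_smul, Real.norm_of_nonneg (by positivity)]
      refine mul_le_mul_of_nonneg_left ((norm_sub_le _ _).trans ?_) (by positivity)
      rw [norm_mul, norm_mul, Complex.norm_real, Complex.norm_real, Real.norm_eq_abs,
        Real.norm_eq_abs]
      exact add_le_add (mul_le_mul_of_nonneg_left (hC' z hz0) (abs_nonneg _))
        (mul_le_mul_of_nonneg_left (hC z hz0) (abs_nonneg _))
    have := intervalIntegral.integral_eq_sub_of_hasDerivAt_of_tendsto hx (fun z hz => d1 z hz.1)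
      (by
        rw [intervalIntegrable_iff_integrableOn_Ioc_of_le hx.le]
        exact i1.neg) lim0
      ((d1 x hx).continuousAt.tendsto.mono_left nhdsWithin_le_nhds)
    rw [intervalIntegral.integral_of_le hx.le, integral_neg, sub_zero] at this
    rw [← this, neg_neg]
  have I2 : ∫ z in Ioi x, ((z ^ (2 * μ + 1) * bk l μ z : ℝ) : ℂ) * h z = w2 x := by
    have lim0 : Tendsto w2 atTop (𝓝 0) := by
      have e := ((tendsto_rpow_mul_bk_atTop hl μ (2 * μ + 2)).add
        (tendsto_rpow_mul_bk_atTop hl (μ + 1) (2 * μ + 2))).const_mul C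
      rw [add_zero, mul_zero] at e
      refine squeeze_zero_norm' ?_ e
      filter_upwards [eventually_gt_atTop 0] with z hz0
      rw [hw2, norm_smul, Real.norm_of_nonneg (by positivity)]
      have b0 := bk_nonneg l μ z
      have b1 := bk_nonneg l (μ + 1) z
      have : ‖(bk l μ z : ℂ) * u' z - (bkDeriv l μ z : ℂ) * u z‖ ≤
          bk l μ z * (C * z) + z * bk l (μ + 1) z * C := by
        refine (norm_sub_le _ _).trans ?_
        rw [norm_mul, norm_mul, Complex.norm_real, Complex.norm_real, bkDeriv, neg_mul, norm_neg,
          Real.norm_of_nonneg b0, Real.norm_of_nonneg (by positivity)]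
        exact add_le_add (mul_le_mul_of_nonneg_left (hC' z hz0) b0)
          (mul_le_mul_of_nonneg_left (hC z hz0) (by positivity))
      refine (mul_le_mul_of_nonneg_left this (by positivity)).trans (le_of_eq ?_)
      have e3 : z ^ (2 * μ + 2) = z ^ (2 * μ + 1) * z := by
        rw [← Real.rpow_add_one hz0.ne']
        congr 1
        ring
      rw [e3]
      ring
    have := integral_Ioi_of_hasDerivAt_of_tendsto' (a := x)
      (fun z hz => d2 z (hx.trans_le hz)) i2.neg lim0
    rw [integral_neg, zero_sub, neg_inj] at this
    exact this
  have hb0 := (bi_pos l hμ 0).ne'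
  have hc0 := (c_pos hμ).ne'
  have hb0' : (bi l μ 0 : ℂ) ≠ 0 := by exact_mod_cast hb0
  have hc0' : (c μ : ℂ) ≠ 0 := by exact_mod_cast hc0
  have hgi := integrableOn_green hμ hl hx
  have e1 : ∀ z ∈ Ioc 0 x, ((green l μ x z * s μ z : ℝ) : ℂ) * h z =
      ((bk l μ x / (bi l μ 0 * c μ) : ℝ) : ℂ) *
        (((z ^ (2 * μ + 1) * bi l μ z : ℝ) : ℂ) * h z) := by
    intro z hz
    rw [green, s, min_eq_right hz.2, max_eq_left hz.2]
    push_cast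
    field_simp
  have e2 : ∀ z ∈ Ioi x, ((green l μ x z * s μ z : ℝ) : ℂ) * h z =
      ((bi l μ x / (bi l μ 0 * c μ) : ℝ) : ℂ) *
        (((z ^ (2 * μ + 1) * bk l μ z : ℝ) : ℂ) * h z) := by
    intro z hz
    rw [green, s, min_eq_left (mem_Ioi.1 hz).le, max_eq_right (mem_Ioi.1 hz).le]
    push_cast
    field_simp
  rw [← Ioc_union_Ioi_eq_Ioi hx.le, setIntegral_union Ioc_disjoint_Ioi_same measurableSet_Ioi
    (hInt _ _ measurableSet_Ioc Ioc_subset_Ioi_self (hgi.mono_set Ioc_subset_Ioi_self))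
    (hInt _ _ measurableSet_Ioi (Ioi_subset_Ioi hx.le) (hgi.mono_set (Ioi_subset_Ioi hx.le))),
    setIntegral_congr_fun measurableSet_Ioc e1, setIntegral_congr_fun measurableSet_Ioi e2,
    integral_const_mul, integral_const_mul, I1, I2, hw1, hw2]
  -- In `bi x * w2 x - bk x * w1 x` the terms with `u' x` cancel, and the coefficient of `u x` is
  -- the Wronskian of `bi` and `bk`.
  have hwr : ((x ^ (2 * μ + 1) : ℝ) : ℂ) * ((bk l μ x : ℂ) * biDeriv l μ x -
      (bkDeriv l μ x : ℂ) * bi l μ x) = bi l μ 0 * c μ := by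
    exact_mod_cast wronskian_bk_bi hμ hl hx
  simp only [Complex.real_smul]
  generalize ((x ^ (2 * μ + 1) : ℝ) : ℂ) = X at *
  push_cast
  field_simp
  linear_combination u x * hwr

/-- The total mass of Green's function. -/
theorem integral_green {l μ : ℝ} (hμ : -1 / 2 < μ) (hl : 0 < l) {x : ℝ} (hx : 0 < x) :
    ∫ z in Ioi 0, green l μ x z * s μ z = 1 / l := by
  -- For `u = 1` the function `l u - L u` is the constant `l`.
  have h := green_identity hμ hl (u := fun _ => 1) (u' := fun _ => 0) (Lu := fun _ => 0) (C := 1)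
    (fun x _ => hasDerivAt_const x 1)
    (fun x _ => by simpa using hasDerivAt_const x (0 : ℂ)) (by simp)
    (fun x hx => by simpa using hx.le) (by simp) continuousOn_const hx
  simp only [mul_one, sub_zero] at h
  rw [integral_mul_const, integral_complex_ofReal] at h
  have hl' : (l : ℂ) ≠ 0 := by exact_mod_cast hl.ne'
  have h2 : (∫ z in Ioi 0, green l μ x z * s μ z) * l = 1 := by exact_mod_cast h
  field_simp
  linarith

/-! ### The equation `l φ - S_μ φ = ψ` in `H_μ` -/

theorem hasDerivAt_weightedDeriv (μ : ℝ) {φ : ℝ → ℂ} (h : ContDiffOn ℝ ∞ φ (Ioi 0)) (k : ℕ)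
    {x : ℝ} (hx : 0 < x) :
    HasDerivAt (weightedDeriv μ k φ) (x * weightedDeriv μ (k + 1) φ x) x := by
  have hxc : (x : ℂ) ≠ 0 := by exact_mod_cast hx.ne'
  have e : weightedDeriv μ (k + 1) φ = xinvD (weightedDeriv μ k φ) :=
    Function.iterate_succ_apply' _ _ _
  rw [e, xinvD, mul_inv_cancel_left₀ hxc]
  exact (differentiableAt_of (contDiffOn_xinvD_iter (contDiffOn_r_mul μ h) k) hx).hasDerivAt

/-- For `ψ = r φ`, the function `r S_μ φ` is `L ψ`, and `ψ' = x (x⁻¹D) ψ`. The bounds required by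
`green_identity`, including the one linear in `x`, therefore come from `γ_{0,0}`, `γ_{0,1}` and
`γ_{2,2}`. -/
theorem green_identity_test {l μ : ℝ} (hμ : -1 / 2 < μ) (hl : 0 < l) (φ : Hmu μ) {x : ℝ}
    (hx : 0 < x) :
    ∫ z in Ioi 0, ((green l μ x z * s μ z : ℝ) : ℂ) *
      ((r μ z : ℂ) * (l * (φ : ℝ → ℂ) z - besselFun μ φ z)) = (r μ x : ℂ) * (φ : ℝ → ℂ) x := by
  have hφ := φ.2.2.1
  set C : ℝ := gamma μ 0 0 φ + gamma μ 0 1 φ + (gamma μ 2 2 φ + |2 * μ + 2| * gamma μ 0 1 φ)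
    with hC
  have g00 : 0 ≤ gamma μ 0 0 φ := apply_nonneg _ _
  have g01 : 0 ≤ gamma μ 0 1 φ := apply_nonneg _ _
  have g22 : 0 ≤ gamma μ 2 2 φ := apply_nonneg _ _
  have g3 : 0 ≤ |2 * μ + 2| * gamma μ 0 1 φ := by positivity
  have n0 : ∀ x, 0 < x → ‖weightedDeriv μ 0 φ x‖ ≤ gamma μ 0 0 φ := fun x hx => by
    simpa using le_gamma μ 0 0 φ hx
  have n1 : ∀ x, 0 < x → ‖weightedDeriv μ 1 φ x‖ ≤ gamma μ 0 1 φ := fun x hx => by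
    simpa using le_gamma μ 0 1 φ hx
  have n2 : ∀ x : ℝ, 0 < x → ‖(x : ℂ) ^ 2 * weightedDeriv μ 2 φ x‖ ≤ gamma μ 2 2 φ :=
    fun x hx => le_gamma μ 2 2 φ hx
  have hcw : ∀ k, ContinuousOn (weightedDeriv μ k φ) (Ioi 0) := fun k =>
    (contDiffOn_xinvD_iter (contDiffOn_r_mul μ hφ) k).continuousOn
  have h := green_identity hμ hl (C := C) (u := weightedDeriv μ 0 φ)
    (u' := fun x => x * weightedDeriv μ 1 φ x)
    (Lu := fun x => (x : ℂ) ^ 2 * weightedDeriv μ 2 φ x + (2 * μ + 2) * weightedDeriv μ 1 φ x)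
    (fun x hx => hasDerivAt_weightedDeriv μ hφ 0 hx)
    (fun x hx => by
      have h1 : HasDerivAt (fun x : ℝ => (x : ℂ)) 1 x := (hasDerivAt_id x).ofReal_comp
      refine (h1.fun_mul (hasDerivAt_weightedDeriv μ hφ 1 hx)).congr_deriv ?_
      have hxc : (x : ℂ) ≠ 0 := by exact_mod_cast hx.ne'
      simp only [Complex.real_smul]
      push_cast
      field_simp
      ring)
    (fun x hx => (n0 x hx).trans (by linarith))
    (fun x hx => by
      rw [norm_mul, Complex.norm_real, Real.norm_of_nonneg hx.le, mul_comm]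
      exact mul_le_mul_of_nonneg_right ((n1 x hx).trans (by linarith)) hx.le)
    (fun x hx => by
      refine (norm_add_le _ _).trans ((add_le_add (n2 x hx) ?_).trans
        (by linarith : gamma μ 2 2 φ + |2 * μ + 2| * gamma μ 0 1 φ ≤ C))
      rw [norm_mul, show (2 * μ + 2 : ℂ) = ((2 * μ + 2 : ℝ) : ℂ) by push_cast; ring,
        Complex.norm_real, Real.norm_eq_abs]
      exact mul_le_mul_of_nonneg_left (n1 x hx) (abs_nonneg _))
    (((Complex.continuous_ofReal.pow 2).continuousOn.mul (hcw 2)).add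
      (continuousOn_const.mul (hcw 1))) hx
  refine Eq.trans ?_ h
  refine setIntegral_congr_fun measurableSet_Ioi fun z hz => ?_
  have h2 := r_mul_besselFun μ hφ hz
  beta_reduce at h2 ⊢
  rw [← h2, mul_sub, mul_left_comm (r μ z : ℂ)]
  rfl

/-! ### Solving `l φ - S_μ φ = ψ` for `ψ` in `D(0,∞)` -/

theorem xinvD_iter_congr_of_isOpen {f g : ℝ → ℂ} {S : Set ℝ} (hS : IsOpen S) (h : EqOn f g S)
    (k : ℕ) : EqOn (xinvD^[k] f) (xinvD^[k] g) S := by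
  induction k with
  | zero => exact h
  | succ k ih =>
    intro x hx
    have : xinvD^[k] f =ᶠ[nhds x] xinvD^[k] g := ih.eventuallyEq_of_mem (hS.mem_nhds hx)
    simp only [Function.iterate_succ_apply', xinvD, this.deriv_eq]

theorem xinvD_iter_bk {l : ℝ} (hl : 0 < l) (ν : ℝ) (k : ℕ) :
    EqOn (xinvD^[k] fun x => (bk l ν x : ℂ)) (fun x => (-1) ^ k * (bk l (ν + k) x : ℂ))
      (Ioi 0) := by
  induction k with
  | zero => intro x _; simp
  | succ k ih =>
    intro x hx
    have hxc : (x : ℂ) ≠ 0 := by exact_mod_cast (ne_of_gt hx : x ≠ 0)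
    rw [Function.iterate_succ_apply', xinvD_congr ih hx, xinvD,
      ((hasDerivAt_bk hl (ν + k) hx).ofReal_comp.const_mul ((-1 : ℂ) ^ k)).deriv]
    push_cast
    rw [add_assoc, pow_succ]
    field_simp

/-- Each `x⁻¹D` raises the index by one and contributes a constant factor. Only boundedness near `0`
is needed later, so the product of these factors is left unspecified. -/
theorem xinvD_iter_bi {l : ℝ} (hl : 0 < l) {ν : ℝ} (hν : -1 / 2 < ν) (k : ℕ) :
    ∃ C : ℂ, EqOn (xinvD^[k] fun x => (bi l ν x : ℂ)) (fun x => C * (bi l (ν + k) x : ℂ))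
      (Ioi 0) := by
  induction k with
  | zero => exact ⟨1, fun x _ => by simp⟩
  | succ k ih =>
    obtain ⟨C, hC⟩ := ih
    refine ⟨C * ((l / (2 * (ν + k) + 1) : ℝ) : ℂ), fun x hx => ?_⟩
    have hxc : (x : ℂ) ≠ 0 := by exact_mod_cast (ne_of_gt hx : x ≠ 0)
    have hν' : -1 / 2 < ν + k := by
      have : (0 : ℝ) ≤ k := k.cast_nonneg
      linarith
    rw [Function.iterate_succ_apply', xinvD_congr hC hx, xinvD,
      ((hasDerivAt_bi hl hν' x).ofReal_comp.const_mul C).deriv, Complex.ofReal_mul,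
      Complex.ofReal_mul x, Nat.cast_succ, ← add_assoc]
    field_simp

theorem exists_Ioo_of_isCompact {K : Set ℝ} (hK : IsCompact K) (h : K ⊆ Ioi 0) :
    ∃ a b : ℝ, 0 < a ∧ a < b ∧ K ⊆ Ioo a b := by
  rcases K.eq_empty_or_nonempty with rfl | hne
  · exact ⟨1, 2, one_pos, one_lt_two, empty_subset _⟩
  · obtain ⟨p, hp, hpm⟩ := hK.exists_isLeast hne
    obtain ⟨q, hq, hqm⟩ := hK.exists_isGreatest hne
    have hp0 : 0 < p := h hp
    refine ⟨p / 2, q + 1, half_pos hp0, by linarith [hpm hq], fun x hx => ⟨?_, ?_⟩⟩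
    · linarith [hpm hx]
    · linarith [hqm hx]

theorem contDiff_primitive {p : ℝ → ℂ} (hp : ContDiff ℝ ∞ p) :
    ContDiff ℝ ∞ (fun x => ∫ z in (0 : ℝ)..x, p z) := by
  have hd : ∀ x, HasDerivAt (fun x => ∫ z in (0 : ℝ)..x, p z) (p x) x := fun x =>
    intervalIntegral.integral_hasDerivAt_right (hp.continuous.intervalIntegrable _ _)
      (hp.continuous.stronglyMeasurableAtFilter _ _) hp.continuous.continuousAt
  rw [contDiff_infty_iff_deriv]
  refine ⟨fun x => (hd x).differentiableAt, ?_⟩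
  rw [funext fun x => (hd x).deriv]
  exact hp

theorem exists_pow_mul_bk_le_of_le {l : ℝ} (hl : 0 < l) (ν : ℝ) (m : ℕ) {b : ℝ} (hb : 0 < b) :
    ∃ C, ∀ y, b ≤ y → y ^ m * bk l ν y ≤ C := by
  obtain ⟨C, hC0, e, he, hC⟩ := exists_rpow_mul_bk_le hl ν m 0
  refine ⟨C * b ^ e, fun y hy => ?_⟩
  have h := hC y (hb.trans_le hy)
  rw [Real.rpow_natCast] at h
  exact h.trans (mul_le_mul_of_nonneg_left (Real.rpow_le_rpow_of_nonpos hb hy he.le) hC0)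

/-- A function that is a multiple of `bi` near `0` and of `bk` near `∞` gives an element
of `H_μ`. -/
theorem mem_Hmu_of_eq {l μ : ℝ} (hμ : -1 / 2 < μ) (hl : 0 < l) {U : ℝ → ℂ}
    (hU : ContDiffOn ℝ ∞ U (Ioi 0)) {a b : ℝ} (ha : 0 < a) (hab : a < b) {A B : ℂ}
    (h0 : EqOn U (fun x => A * (bi l μ x : ℂ)) (Ioo 0 a))
    (h1 : EqOn U (fun x => B * (bk l μ x : ℂ)) (Ioi b)) :
    (Ioi (0 : ℝ)).indicator (fun x => ((x ^ (μ + 1 / 2) : ℝ) : ℂ) * U x) ∈ Hmu μ := by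
  have hr : EqOn (fun x => (r μ x : ℂ) *
      (Ioi (0 : ℝ)).indicator (fun x => ((x ^ (μ + 1 / 2) : ℝ) : ℂ) * U x) x) U (Ioi 0) := by
    intro x hx
    have hx0 : (0 : ℝ) < x := hx
    beta_reduce
    rw [indicator_of_mem hx, ← mul_assoc, ← Complex.ofReal_mul, r, ← Real.rpow_add hx0,
      show -μ - 1 / 2 + (μ + 1 / 2) = 0 by ring, Real.rpow_zero, Complex.ofReal_one, one_mul]
  refine ⟨fun x hx => indicator_of_notMem (by simpa using hx) _,
    ((contDiffOn_ofReal_rpow _).mul hU).congr fun x hx => indicator_of_mem hx _, fun m k => ?_⟩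
  have hk : ∀ x : ℝ, 0 < x → weightedDeriv μ k
      ((Ioi (0 : ℝ)).indicator (fun x => ((x ^ (μ + 1 / 2) : ℝ) : ℂ) * U x)) x = xinvD^[k] U x :=
    fun x hx => xinvD_iter_congr hr k hx
  obtain ⟨C, hC⟩ := xinvD_iter_bi hl hμ k
  have hμk : -1 / 2 < μ + k := by
    have : (0 : ℝ) ≤ k := k.cast_nonneg
    linarith
  -- The seminorm is bounded on three regions: near `0` by continuity of `bi` up to `0`, on `[a,b]`
  -- by compactness, beyond `b` by the decay of `bk`.
  obtain ⟨M1, hM1⟩ := (isCompact_Icc (a := (0 : ℝ)) (b := a)).exists_bound_of_continuousOn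
    (f := fun x : ℝ => (x : ℂ) ^ m * (A * (C * (bi l (μ + k) x : ℂ))))
    (Continuous.continuousOn ((Complex.continuous_ofReal.pow m).mul (continuous_const.mul
      (continuous_const.mul (Complex.continuous_ofReal.comp (contDiff_bi hl hμk).continuous)))))
  obtain ⟨M2, hM2⟩ := (isCompact_Icc (a := a) (b := b)).exists_bound_of_continuousOn
    (f := fun x : ℝ => (x : ℂ) ^ m * xinvD^[k] U x)
    ((Complex.continuous_ofReal.pow m).continuousOn.mul
      ((contDiffOn_xinvD_iter hU k).continuousOn.mono fun x hx => ha.trans_le hx.1))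
  obtain ⟨M3, hM3⟩ := exists_pow_mul_bk_le_of_le hl (μ + k) m (ha.trans hab)
  refine ⟨max (max M1 M2) (‖B‖ * M3), ?_⟩
  rintro _ ⟨⟨x, hx⟩, rfl⟩
  have hx0 : (0 : ℝ) < x := hx
  change ‖(x : ℂ) ^ m * weightedDeriv μ k _ x‖ ≤ _
  rw [hk x hx0]
  rcases lt_or_ge x a with hxa | hxa
  · refine le_trans ?_ ((le_max_left _ _).trans (le_max_left _ _))
    have e := xinvD_iter_congr_of_isOpen isOpen_Ioo h0 k ⟨hx0, hxa⟩
    rw [e, xinvD_iter_const_mul A (fun x => (bi l μ x : ℂ)) k]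
    beta_reduce
    rw [hC hx]
    exact hM1 x ⟨hx0.le, hxa.le⟩
  · rcases le_or_gt x b with hxb | hxb
    · exact (hM2 x ⟨hxa, hxb⟩).trans ((le_max_right _ _).trans (le_max_left _ _))
    · refine le_trans ?_ (le_max_right _ _)
      have e := xinvD_iter_congr_of_isOpen isOpen_Ioi h1 k hxb
      rw [e, xinvD_iter_const_mul B (fun x => (bk l μ x : ℂ)) k]
      beta_reduce
      rw [xinvD_iter_bk hl μ k hx]
      have h2 := hM3 x hxb.le
      have h3 := bk_nonneg l (μ + k) x
      simp only [norm_mul, norm_pow, norm_neg, norm_one, one_pow, one_mul, Complex.norm_real,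
        Real.norm_of_nonneg hx0.le, Real.norm_of_nonneg h3]
      rw [mul_left_comm]
      exact mul_le_mul_of_nonneg_left h2 (norm_nonneg _)

/-- This reads the conjugation of `S_μ` to `L` in the direction from `U` to `x^{μ+1/2} U`; `LU`
stands for `U'' + (2μ+1)/x U'` at the point `x`. -/
theorem besselFun_eq {μ : ℝ} {U U' : ℝ → ℂ} {LU : ℂ} (hUc : ContDiffOn ℝ ∞ U (Ioi 0))
    (hU : ∀ x, 0 < x → HasDerivAt U (U' x) x) {x : ℝ} (hx : 0 < x)
    (hU' : HasDerivAt U' (LU - ((2 * μ + 1) / x) • U' x) x) :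
    besselFun μ ((Ioi (0 : ℝ)).indicator (fun x => ((x ^ (μ + 1 / 2) : ℝ) : ℂ) * U x)) x =
      ((x ^ (μ + 1 / 2) : ℝ) : ℂ) * LU := by
  set φ := (Ioi (0 : ℝ)).indicator (fun x => ((x ^ (μ + 1 / 2) : ℝ) : ℂ) * U x) with hφ
  have hrr : ∀ y : ℝ, 0 < y → r μ y * y ^ (μ + 1 / 2) = 1 := fun y hy => by
    rw [r, ← Real.rpow_add hy, show -μ - 1 / 2 + (μ + 1 / 2) = 0 by ring, Real.rpow_zero]
  have hr : EqOn (fun x => (r μ x : ℂ) * φ x) U (Ioi 0) := by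
    intro y hy
    beta_reduce
    rw [hφ, indicator_of_mem hy, ← mul_assoc, ← Complex.ofReal_mul, hrr y hy, Complex.ofReal_one,
      one_mul]
  have hc : ContDiffOn ℝ ∞ φ (Ioi 0) :=
    ((contDiffOn_ofReal_rpow _).mul hUc).congr fun x hx => indicator_of_mem hx _
  have hxc : (x : ℂ) ≠ 0 := by exact_mod_cast hx.ne'
  have w1 : EqOn (weightedDeriv μ 1 φ) (fun x => (x : ℂ)⁻¹ * U' x) (Ioi 0) := by
    intro y hy
    have : weightedDeriv μ 1 φ y = xinvD U y := xinvD_congr hr hy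
    rw [this, xinvD, (hU y hy).deriv]
  have w2 : weightedDeriv μ 2 φ x = (x : ℂ)⁻¹ * (-((x : ℂ) ^ 2)⁻¹ * U' x +
      (x : ℂ)⁻¹ * (LU - ((2 * μ + 1) / x) • U' x)) := by
    have e : weightedDeriv μ 2 φ x = xinvD (weightedDeriv μ 1 φ) x := rfl
    rw [e, xinvD_congr w1 hx, xinvD]
    have h1 : HasDerivAt (fun x : ℝ => (x : ℂ)⁻¹) (-((x : ℂ) ^ 2)⁻¹) x := by
      have := (hasDerivAt_inv hx.ne').ofReal_comp
      push_cast at this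
      exact this
    rw [(h1.fun_mul hU').deriv]
  have h := r_mul_besselFun μ hc hx
  beta_reduce at h
  rw [w1 hx, w2] at h
  have h3 : (r μ x : ℂ) * ((x ^ (μ + 1 / 2) : ℝ) : ℂ) = 1 := by exact_mod_cast hrr x hx
  have h4 : (r μ x : ℂ) * besselFun μ φ x = LU := by
    rw [h]
    simp only [Complex.real_smul]
    push_cast
    field_simp
    ring
  rw [← h4, mul_left_comm, ← mul_assoc, h3, one_mul]

/-- `l - S_μ` maps `H_μ` onto a space that contains `D(0,∞)`. -/
theorem exists_test_eq {l μ : ℝ} (hμ : -1 / 2 < μ) (hl : 0 < l) {ψ : ℝ → ℂ} (hψ : IsTestFun ψ) :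
    ∃ φ : Hmu μ, ∀ x, 0 < x → l * (φ : ℝ → ℂ) x - besselFun μ φ x = ψ x := by
  obtain ⟨a, b, ha, hab, hK⟩ := exists_Ioo_of_isCompact hψ.2.1 hψ.2.2
  have hψ0 : ∀ x, x ∉ Ioo a b → ψ x = 0 := fun x hx =>
    image_eq_zero_of_notMem_tsupport fun h => hx (hK h)
  have cbk : ContDiffOn ℝ ∞ (fun x => (bk l μ x : ℂ)) (Ioi 0) :=
    Complex.ofRealCLM.contDiff.comp_contDiffOn (contDiffOn_bk hl μ)
  have cbi : ContDiff ℝ ∞ (fun x => (bi l μ x : ℂ)) :=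
    Complex.ofRealCLM.contDiff.comp (contDiff_bi hl hμ)
  set h : ℝ → ℂ := fun z => ((z ^ (μ + 1 / 2) : ℝ) : ℂ) * ψ z with hh
  have hT : IsTestFun h := IsTestFun.mul (contDiffOn_ofReal_rpow _) hψ
  set p : ℝ → ℂ := fun z => (bi l μ z : ℂ) * h z with hp
  set q : ℝ → ℂ := fun z => (bk l μ z : ℂ) * h z with hq
  have pT : IsTestFun p := IsTestFun.mul cbi.contDiffOn hT
  have qT : IsTestFun q := IsTestFun.mul cbk hT
  have p0 : ∀ x, x ∉ Ioo a b → p x = 0 := fun x hx => by simp only [hp, hh, hψ0 x hx, mul_zero]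
  have q0 : ∀ x, x ∉ Ioo a b → q x = 0 := fun x hx => by simp only [hq, hh, hψ0 x hx, mul_zero]
  -- Variation of parameters: `P` vanishes to the left of the support and `Q` to the right of it, so
  -- the solution is a multiple of `bi` near `0` and of `bk` near infinity.
  set P : ℝ → ℂ := fun x => ∫ z in (0 : ℝ)..x, p z with hP
  set Q : ℝ → ℂ := fun x => (∫ z in (0 : ℝ)..b, q z) - ∫ z in (0 : ℝ)..x, q z with hQ
  have zero_left : ∀ g : ℝ → ℂ, (∀ x, x ∉ Ioo a b → g x = 0) → ∀ x ∈ Ioo 0 a,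
      ∫ z in (0 : ℝ)..x, g z = 0 := by
    intro g hg x hx
    rw [intervalIntegral.integral_congr (g := fun _ => 0), intervalIntegral.integral_zero]
    intro z hz
    rw [uIcc_of_le hx.1.le] at hz
    exact hg z fun h => by linarith [h.1, hz.2, hx.2]
  have const_right : ∀ g : ℝ → ℂ, Continuous g → (∀ x, x ∉ Ioo a b → g x = 0) → ∀ x ∈ Ioi b,
      ∫ z in (0 : ℝ)..x, g z = ∫ z in (0 : ℝ)..b, g z := by
    intro g hgc hg x hx
    rw [← intervalIntegral.integral_add_adjacent_intervals (hgc.intervalIntegrable 0 b)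
      (hgc.intervalIntegrable b x), intervalIntegral.integral_congr (a := b) (g := fun _ => 0),
      intervalIntegral.integral_zero, add_zero]
    intro z hz
    rw [uIcc_of_le (mem_Ioi.1 hx).le] at hz
    exact hg z fun h => by linarith [h.2, hz.1]
  set κ : ℂ := ((bi l μ 0 * c μ : ℝ) : ℂ) with hκ
  have hκ0 : κ ≠ 0 := by
    rw [hκ]
    exact_mod_cast (mul_pos (bi_pos l hμ 0) (c_pos hμ)).ne'
  set U : ℝ → ℂ := fun x => κ⁻¹ * ((bk l μ x : ℂ) * P x + (bi l μ x : ℂ) * Q x) with hU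
  set U' : ℝ → ℂ := fun x => κ⁻¹ * ((bkDeriv l μ x : ℂ) * P x + (biDeriv l μ x : ℂ) * Q x) with hU'
  have hPd : ∀ x, HasDerivAt P (p x) x := fun x =>
    intervalIntegral.integral_hasDerivAt_right (pT.1.continuous.intervalIntegrable _ _)
      (pT.1.continuous.stronglyMeasurableAtFilter _ _) pT.1.continuous.continuousAt
  have hQd : ∀ x, HasDerivAt Q (-q x) x := fun x =>
    (intervalIntegral.integral_hasDerivAt_right (qT.1.continuous.intervalIntegrable _ _)
      (qT.1.continuous.stronglyMeasurableAtFilter _ _) qT.1.continuous.continuousAt).const_sub _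
  have hUc : ContDiffOn ℝ ∞ U (Ioi 0) :=
    contDiffOn_const.mul ((cbk.mul (contDiff_primitive pT.1).contDiffOn).add
      (cbi.contDiffOn.mul (contDiff_const.sub (contDiff_primitive qT.1)).contDiffOn))
  -- The derivatives of `P` and `Q` cancel, since `bk * p = bi * q`.
  have hUd : ∀ x, 0 < x → HasDerivAt U (U' x) x := by
    intro x hx
    refine ((((hasDerivAt_bk hl μ hx).ofReal_comp.fun_mul (hPd x)).fun_add
      ((hasDerivAt_bi hl hμ x).ofReal_comp.fun_mul (hQd x))).const_mul κ⁻¹).congr_deriv ?_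
    simp only [hU', hp, hq, bkDeriv, biDeriv]
    ring
  have hU'd : ∀ x, 0 < x → HasDerivAt U'
      ((l * U x - (r μ x : ℂ) * ψ x) - ((2 * μ + 1) / x) • U' x) x := by
    intro x hx
    refine ((((hasDerivAt_deriv_bk hl μ hx).ofReal_comp.fun_mul (hPd x)).fun_add
      ((hasDerivAt_deriv_bi hl hμ hx).ofReal_comp.fun_mul (hQd x))).const_mul κ⁻¹).congr_deriv ?_
    have hw : ((x ^ (2 * μ + 1) : ℝ) : ℂ) * ((bk l μ x : ℂ) * biDeriv l μ x -
        (bkDeriv l μ x : ℂ) * bi l μ x) = κ := by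
      rw [hκ, ← wronskian_bk_bi hμ hl hx]
      push_cast
      ring
    have hx1 : ((x ^ (μ + 1 / 2) : ℝ) : ℂ) = ((x ^ (2 * μ + 1) : ℝ) : ℂ) * (r μ x : ℂ) := by
      rw [← Complex.ofReal_mul, r, ← Real.rpow_add hx]
      congr 2
      ring
    -- In the second derivative these terms no longer cancel: with `h = x^(2μ+1) r ψ` they form the
    -- Wronskian `κ` and produce the source term `-r ψ`.
    have hk : (bkDeriv l μ x : ℂ) * p x - (biDeriv l μ x : ℂ) * q x = -κ * ((r μ x : ℂ) * ψ x) := by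
      simp only [hp, hq, hh]
      rw [hx1]
      linear_combination -((r μ x : ℂ) * ψ x) * hw
    have e1 : (-x * bk l (μ + 1) x) = bkDeriv l μ x := rfl
    have e2 : l / (2 * μ + 1) * (x * bi l (μ + 1) x) = biDeriv l μ x := rfl
    have hi := mul_inv_cancel₀ hκ0
    rw [e1, e2]
    simp only [Complex.real_smul, hU, hU']
    push_cast
    linear_combination κ⁻¹ * hk - (r μ x : ℂ) * ψ x * hi
  have hmem := mem_Hmu_of_eq hμ hl hUc ha hab
    (A := κ⁻¹ * ∫ z in (0 : ℝ)..b, q z) (B := κ⁻¹ * ∫ z in (0 : ℝ)..b, p z)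
    (fun x hx => by
      simp only [hU, hP, hQ, zero_left p p0 x hx, zero_left q q0 x hx]
      ring)
    (fun x hx => by
      simp only [hU, hP, hQ, const_right p pT.1.continuous p0 x hx,
        const_right q qT.1.continuous q0 x hx]
      ring)
  refine ⟨⟨_, hmem⟩, fun x hx => ?_⟩
  change l * (Ioi (0 : ℝ)).indicator (fun x => ((x ^ (μ + 1 / 2) : ℝ) : ℂ) * U x) x -
    besselFun μ ((Ioi (0 : ℝ)).indicator fun x => ((x ^ (μ + 1 / 2) : ℝ) : ℂ) * U x) x = ψ x
  rw [besselFun_eq hUc hUd hx (hU'd x hx), indicator_of_mem (mem_Ioi.2 hx)]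
  have h3 : ((x ^ (μ + 1 / 2) : ℝ) : ℂ) * (r μ x : ℂ) = 1 := by
    rw [← Complex.ofReal_mul, r, ← Real.rpow_add hx,
      show μ + 1 / 2 + (-μ - 1 / 2) = 0 by ring, Real.rpow_zero, Complex.ofReal_one]
  linear_combination ψ x * h3

/-! ### Schur's test -/

/-- This is Hölder's inequality between the `L¹` and `L^q` norms of `f` for the measure `k ν`, whose
total mass is `∫ k dν`. -/
theorem lintegral_mul_rpow_le {α : Type*} [MeasurableSpace α] {ν : Measure α} {k f : α → ℝ≥0∞}
    (hk : Measurable k) (hf : AEMeasurable f ν) {q : ℝ} (hq : 1 ≤ q) :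
    (∫⁻ z, k z * f z ∂ν) ^ q ≤ (∫⁻ z, k z * f z ^ q ∂ν) * (∫⁻ z, k z ∂ν) ^ (q - 1) := by
  have hq0 : 0 < q := one_pos.trans_le hq
  have hac := withDensity_absolutelyContinuous ν k
  have h := eLpNorm_le_eLpNorm_mul_rpow_measure_univ (μ := ν.withDensity k) (f := f)
    (p := 1) (q := ENNReal.ofReal q) (by simpa using hq)
    (hf.mono_ac hac).aestronglyMeasurable
  rw [eLpNorm_one_eq_lintegral_enorm, eLpNorm_eq_lintegral_rpow_enorm_toReal (by simpa using hq0)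
    ENNReal.ofReal_ne_top, ENNReal.toReal_ofReal hq0.le, withDensity_apply _ MeasurableSet.univ,
    Measure.restrict_univ, ENNReal.toReal_one] at h
  simp only [enorm_eq_self] at h
  rw [lintegral_withDensity_eq_lintegral_mul₀' hk.aemeasurable (hf.mono_ac hac),
    lintegral_withDensity_eq_lintegral_mul₀' hk.aemeasurable ((hf.mono_ac hac).pow_const q)] at h
  simp only [Pi.mul_apply] at h
  refine (ENNReal.rpow_le_rpow h hq0.le).trans (le_of_eq ?_)
  rw [ENNReal.mul_rpow_of_nonneg _ _ hq0.le, ← ENNReal.rpow_mul, ← ENNReal.rpow_mul,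
    one_div_mul_cancel hq0.ne', ENNReal.rpow_one]
  congr 2
  field_simp

/-- For finite exponent, Hölder in each row gives the factor `M^(q-1)`; after Tonelli the column
bound gives one more `M`. For `p = ∞` the row bound alone suffices. -/
theorem eLpNorm_lintegral_kernel_le {α : Type*} [MeasurableSpace α] {ν : Measure α} [SFinite ν]
    {k : α → α → ℝ≥0∞} (hk : Measurable (Function.uncurry k)) {M : ℝ≥0∞}
    (h1 : ∀ᵐ x ∂ν, ∫⁻ z, k x z ∂ν ≤ M) (h2 : ∀ᵐ z ∂ν, ∫⁻ x, k x z ∂ν ≤ M)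
    {f : α → ℝ≥0∞} (hf : AEMeasurable f ν) {p : ℝ≥0∞} (hp : 1 ≤ p) :
    eLpNorm (fun x => ∫⁻ z, k x z * f z ∂ν) p ν ≤ M * eLpNorm f p ν := by
  have hkx : ∀ x, Measurable (k x) := fun x => hk.comp measurable_prodMk_left
  rcases eq_or_ne p ⊤ with rfl | hpt
  · rw [eLpNorm_exponent_top, eLpNorm_exponent_top]
    refine eLpNormEssSup_le_of_ae_enorm_bound ?_
    filter_upwards [h1] with x hx
    rw [enorm_eq_self]
    have hb := ae_le_eLpNormEssSup (f := f) (μ := ν)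
    simp only [enorm_eq_self] at hb
    calc ∫⁻ z, k x z * f z ∂ν ≤ ∫⁻ z, k x z * eLpNormEssSup f ν ∂ν := by
          refine lintegral_mono_ae ?_
          filter_upwards [hb] with z hz
          gcongr
      _ = (∫⁻ z, k x z ∂ν) * eLpNormEssSup f ν := lintegral_mul_const _ (hkx x)
      _ ≤ _ := by gcongr
  · have hp0 : p ≠ 0 := (zero_lt_one.trans_le hp).ne'
    set q := p.toReal with hqdef
    have hq : 1 ≤ q := by
      rw [← ENNReal.toReal_one]
      exact ENNReal.toReal_mono hpt hp
    have hq0 : 0 < q := one_pos.trans_le hq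
    rw [eLpNorm_eq_lintegral_rpow_enorm_toReal hp0 hpt,
      eLpNorm_eq_lintegral_rpow_enorm_toReal hp0 hpt]
    simp only [enorm_eq_self, ← hqdef]
    have hm : AEMeasurable (Function.uncurry fun x z => k x z * f z ^ q) (ν.prod ν) :=
      hk.aemeasurable.mul (hf.pow_const q).comp_snd
    have key : ∫⁻ x, (∫⁻ z, k x z * f z ∂ν) ^ q ∂ν ≤ M ^ q * ∫⁻ z, f z ^ q ∂ν := by
      calc ∫⁻ x, (∫⁻ z, k x z * f z ∂ν) ^ q ∂ν
          ≤ ∫⁻ x, (∫⁻ z, k x z * f z ^ q ∂ν) * M ^ (q - 1) ∂ν := by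
            refine lintegral_mono_ae ?_
            filter_upwards [h1] with x hx
            refine (lintegral_mul_rpow_le (hkx x) hf hq).trans ?_
            gcongr
        _ = (∫⁻ x, ∫⁻ z, k x z * f z ^ q ∂ν ∂ν) * M ^ (q - 1) :=
            lintegral_mul_const'' _ hm.lintegral_prod_right'
        _ = (∫⁻ z, ∫⁻ x, k x z * f z ^ q ∂ν ∂ν) * M ^ (q - 1) := by
            rw [lintegral_lintegral_swap hm]
        _ ≤ (∫⁻ z, M * f z ^ q ∂ν) * M ^ (q - 1) := by
            gcongr 1
            refine lintegral_mono_ae ?_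
            filter_upwards [h2] with z hz
            have : Measurable fun x => k x z := hk.comp measurable_prodMk_right
            rw [lintegral_mul_const _ this]
            gcongr
        _ = M ^ q * ∫⁻ z, f z ^ q ∂ν := by
            rw [lintegral_const_mul'' _ (hf.pow_const q), mul_right_comm]
            congr 1
            nth_rewrite 1 [← ENNReal.rpow_one M]
            rw [← ENNReal.rpow_add_of_nonneg _ _ zero_le_one (by linarith)]
            congr 1
            ring
    refine (ENNReal.rpow_le_rpow key (by positivity)).trans (le_of_eq ?_)
    rw [ENNReal.mul_rpow_of_nonneg _ _ (by positivity), ← ENNReal.rpow_mul,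
      mul_one_div_cancel hq0.ne', ENNReal.rpow_one]

theorem ae_lt_top_of_eLpNorm_lt_top {α : Type*} [MeasurableSpace α] {ν : Measure α}
    {f : α → ℝ≥0∞} (hf : AEMeasurable f ν) {p : ℝ≥0∞} (hp : p ≠ 0)
    (h : eLpNorm f p ν < (⊤ : ℝ≥0∞)) :
    ∀ᵐ x ∂ν, f x < (⊤ : ℝ≥0∞) := by
  rcases eq_or_ne p ⊤ with rfl | hpt
  · filter_upwards [ae_le_eLpNormEssSup (f := f) (μ := ν)] with x hx
    rw [eLpNorm_exponent_top] at h
    exact lt_of_le_of_lt (by simpa using hx) h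
  · have h1 := (eLpNorm_lt_top_iff_lintegral_rpow_enorm_lt_top hp hpt).1 h
    simp only [enorm_eq_self] at h1
    filter_upwards [ae_lt_top' (hf.pow_const _) h1.ne] with x hx
    exact (ENNReal.rpow_lt_top_iff_of_pos (ENNReal.toReal_pos hp hpt)).1 hx

/-! ### The measure `s dx` and the integral operator with Green's kernel -/

/-- The measure `s dx` on `(0,∞)`. -/
def sMeasure (μ : ℝ) : Measure ℝ :=
  (volume.restrict (Ioi 0)).withDensity fun x => ENNReal.ofReal (s μ x)

instance instSFiniteSMeasure (μ : ℝ) : SFinite (sMeasure μ) := by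
  unfold sMeasure
  infer_instance

theorem measurable_ofReal_s (μ : ℝ) : Measurable fun x => ENNReal.ofReal (s μ x) :=
  (measurable_s μ).ennreal_ofReal

theorem sMeasure_ac (μ : ℝ) : sMeasure μ ≪ volume.restrict (Ioi 0) :=
  withDensity_absolutelyContinuous _ _

theorem ac_sMeasure {μ : ℝ} (hμ : -1 / 2 < μ) : volume.restrict (Ioi 0) ≪ sMeasure μ :=
  withDensity_absolutelyContinuous' (measurable_ofReal_s μ).aemeasurable
    ((ae_restrict_iff' measurableSet_Ioi).2 (ae_of_all _ fun x hx => by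
      simpa using s_pos hμ hx))

theorem ae_sMeasure_pos (μ : ℝ) : ∀ᵐ x ∂sMeasure μ, 0 < x :=
  (sMeasure_ac μ).ae_le (ae_restrict_mem measurableSet_Ioi)

theorem integral_sMeasure {μ : ℝ} (hμ : -1 / 2 < μ) (f : ℝ → ℂ) :
    ∫ x, f x ∂sMeasure μ = ∫ x in Ioi 0, (s μ x : ℂ) * f x := by
  rw [sMeasure, integral_withDensity_eq_integral_toReal_smul (measurable_ofReal_s μ)
    (ae_of_all _ fun _ => ENNReal.ofReal_lt_top)]
  refine setIntegral_congr_fun measurableSet_Ioi fun x hx => ?_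
  simp only [ENNReal.toReal_ofReal (s_pos hμ hx).le, Complex.real_smul]

theorem integrable_sMeasure_iff {μ : ℝ} (hμ : -1 / 2 < μ) (f : ℝ → ℂ) :
    Integrable f (sMeasure μ) ↔ IntegrableOn (fun x => (s μ x : ℂ) * f x) (Ioi 0) := by
  rw [sMeasure, integrable_withDensity_iff_integrable_smul' (measurable_ofReal_s μ)
    (ae_of_all _ fun _ => ENNReal.ofReal_lt_top)]
  refine integrable_congr ((ae_restrict_iff' measurableSet_Ioi).2 (ae_of_all _ fun x hx => ?_))
  simp only [ENNReal.toReal_ofReal (s_pos hμ hx).le, Complex.real_smul]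

theorem lintegral_green {l μ : ℝ} (hμ : -1 / 2 < μ) (hl : 0 < l) {x : ℝ} (hx : 0 < x) :
    ∫⁻ z, ENNReal.ofReal (green l μ x z) ∂sMeasure μ = ENNReal.ofReal (1 / l) := by
  rw [sMeasure, lintegral_withDensity_eq_lintegral_mul_non_measurable _ (measurable_ofReal_s μ)
    (ae_of_all _ fun _ => ENNReal.ofReal_lt_top), ← integral_green hμ hl hx,
    ofReal_integral_eq_lintegral_ofReal (integrableOn_green hμ hl hx)
    ((ae_restrict_iff' measurableSet_Ioi).2 (ae_of_all _ fun z hz =>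
      (mul_pos (green_pos hμ hl hx) (s_pos hμ hz)).le))]
  refine setLIntegral_congr_fun measurableSet_Ioi fun z hz => ?_
  simp only [Pi.mul_apply]
  rw [ENNReal.ofReal_mul (green_pos hμ hl hx).le, mul_comm]

/-- The integral operator with Green's kernel, on `(0,∞)` with the measure `s dx`. -/
def greenOp (l μ : ℝ) (h : ℝ → ℂ) (x : ℝ) : ℂ := ∫ z, (green l μ x z : ℂ) * h z ∂sMeasure μ

theorem measurable_ofReal_green {l μ : ℝ} (hμ : -1 / 2 < μ) (hl : 0 < l) :
    Measurable (Function.uncurry fun x z => ENNReal.ofReal (green l μ x z)) :=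
  (measurable_green l hμ hl).ennreal_ofReal

theorem enorm_green_mul {l μ : ℝ} (hμ : -1 / 2 < μ) (hl : 0 < l) {x z : ℝ} (hx : 0 < x) (w : ℂ) :
    ‖(green l μ x z : ℂ) * w‖ₑ = ENNReal.ofReal (green l μ x z) * ‖w‖ₑ := by
  rw [enorm_mul, ← ofReal_norm (green l μ x z : ℂ), Complex.norm_real,
    Real.norm_of_nonneg (green_pos hμ hl hx).le]

theorem aestronglyMeasurable_green_mul {l μ : ℝ} (hμ : -1 / 2 < μ) (hl : 0 < l) {h : ℝ → ℂ}
    (hh : AEStronglyMeasurable h (sMeasure μ)) :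
    AEStronglyMeasurable (fun q : ℝ × ℝ => (green l μ q.1 q.2 : ℂ) * h q.2)
      ((sMeasure μ).prod (sMeasure μ)) :=
  (Complex.measurable_ofReal.comp (measurable_green l hμ hl)).aestronglyMeasurable.mul hh.comp_snd

/-- By symmetry the rows and the columns of Green's kernel have the same mass `1/l`, so Schur's test
gives the same constant for all `p`. The absolute value is kept inside, so that convergence follows
as well. -/
theorem eLpNorm_lintegral_green_le {l μ : ℝ} (hμ : -1 / 2 < μ) (hl : 0 < l) {p : ℝ≥0∞}
    (hp : 1 ≤ p) {h : ℝ → ℂ} (hh : AEStronglyMeasurable h (sMeasure μ)) :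
    eLpNorm (fun x => ∫⁻ z, ENNReal.ofReal (green l μ x z) * ‖h z‖ₑ ∂sMeasure μ) p (sMeasure μ) ≤
      ENNReal.ofReal (1 / l) * eLpNorm h p (sMeasure μ) := by
  rw [← eLpNorm_enorm h]
  refine eLpNorm_lintegral_kernel_le (measurable_ofReal_green hμ hl) ?_ ?_ hh.enorm hp
  · filter_upwards [ae_sMeasure_pos μ] with x hx using (lintegral_green hμ hl hx).le
  · filter_upwards [ae_sMeasure_pos μ] with x hx
    simp only [green_comm l μ _ x]
    exact (lintegral_green hμ hl hx).le

theorem eLpNorm_greenOp_le {l μ : ℝ} (hμ : -1 / 2 < μ) (hl : 0 < l) {p : ℝ≥0∞}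
    (hp : 1 ≤ p) {h : ℝ → ℂ} (hh : AEStronglyMeasurable h (sMeasure μ)) :
    eLpNorm (greenOp l μ h) p (sMeasure μ) ≤
      ENNReal.ofReal (1 / l) * eLpNorm h p (sMeasure μ) := by
  refine (eLpNorm_mono_enorm_ae ?_).trans (eLpNorm_lintegral_green_le hμ hl hp hh)
  filter_upwards [ae_sMeasure_pos μ] with x hx
  rw [enorm_eq_self]
  refine (enorm_integral_le_lintegral_enorm _).trans (le_of_eq ?_)
  simp only [enorm_green_mul hμ hl hx]

theorem memLp_greenOp {l μ : ℝ} (hμ : -1 / 2 < μ) (hl : 0 < l) {p : ℝ≥0∞}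
    (hp : 1 ≤ p) {h : ℝ → ℂ} (hh : MemLp h p (sMeasure μ)) :
    MemLp (greenOp l μ h) p (sMeasure μ) :=
  ⟨(aestronglyMeasurable_green_mul hμ hl hh.1).integral_prod_right',
    (eLpNorm_greenOp_le hμ hl hp hh.1).trans_lt (ENNReal.mul_lt_top ENNReal.ofReal_lt_top hh.2)⟩

theorem integrable_green_mul_of_lt_top {l μ : ℝ} (hμ : -1 / 2 < μ) (hl : 0 < l) {h : ℝ → ℂ}
    (hh : AEStronglyMeasurable h (sMeasure μ)) {x : ℝ} (hx : 0 < x)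
    (hlt : ∫⁻ z, ENNReal.ofReal (green l μ x z) * ‖h z‖ₑ ∂sMeasure μ < (⊤ : ℝ≥0∞)) :
    Integrable (fun z => (green l μ x z : ℂ) * h z) (sMeasure μ) := by
  refine ⟨((Complex.measurable_ofReal.comp ((measurable_green l hμ hl).comp
    measurable_prodMk_left)).aestronglyMeasurable).mul hh, ?_⟩
  rw [HasFiniteIntegral]
  simpa only [enorm_green_mul hμ hl hx] using hlt

theorem ae_integrable_green_mul {l μ : ℝ} (hμ : -1 / 2 < μ) (hl : 0 < l) {p : ℝ≥0∞}
    (hp : 1 ≤ p) {h : ℝ → ℂ} (hh : MemLp h p (sMeasure μ)) :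
    ∀ᵐ x ∂sMeasure μ, Integrable (fun z => (green l μ x z : ℂ) * h z) (sMeasure μ) := by
  have h1 := (eLpNorm_lintegral_green_le hμ hl hp hh.1).trans_lt
    (ENNReal.mul_lt_top ENNReal.ofReal_lt_top hh.2)
  have hm : AEMeasurable (fun x => ∫⁻ z, ENNReal.ofReal (green l μ x z) * ‖h z‖ₑ ∂sMeasure μ)
      (sMeasure μ) :=
    AEMeasurable.lintegral_prod_right' (f := fun q : ℝ × ℝ =>
      ENNReal.ofReal (green l μ q.1 q.2) * ‖h q.2‖ₑ)
      ((measurable_ofReal_green hμ hl).aemeasurable.mul hh.1.enorm.comp_snd)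
  filter_upwards [ae_lt_top_of_eLpNorm_lt_top hm (zero_lt_one.trans_le hp).ne' h1,
    ae_sMeasure_pos μ] with x hx hx0
  exact integrable_green_mul_of_lt_top hμ hl hh.1 hx0 hx

/-- Every row `x > 0` has mass `1/l`, so against a bounded function there is no exceptional set. -/
theorem integrable_green_mul_of_memLp_top {l μ : ℝ} (hμ : -1 / 2 < μ) (hl : 0 < l) {h : ℝ → ℂ}
    (hh : MemLp h ∞ (sMeasure μ)) {x : ℝ} (hx : 0 < x) :
    Integrable (fun z => (green l μ x z : ℂ) * h z) (sMeasure μ) := by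
  refine integrable_green_mul_of_lt_top hμ hl hh.1 hx ?_
  have hb := ae_le_eLpNormEssSup (f := h) (μ := sMeasure μ)
  have hm : Measurable fun z => ENNReal.ofReal (green l μ x z) :=
    (measurable_ofReal_green hμ hl).comp measurable_prodMk_left
  calc ∫⁻ z, ENNReal.ofReal (green l μ x z) * ‖h z‖ₑ ∂sMeasure μ
      ≤ ∫⁻ z, ENNReal.ofReal (green l μ x z) * eLpNormEssSup h (sMeasure μ) ∂sMeasure μ := by
        refine lintegral_mono_ae ?_
        filter_upwards [hb] with z hz
        gcongr
    _ = ENNReal.ofReal (1 / l) * eLpNormEssSup h (sMeasure μ) := by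
        rw [lintegral_mul_const _ hm, lintegral_green hμ hl hx]
    _ < (⊤ : ℝ≥0∞) := ENNReal.mul_lt_top ENNReal.ofReal_lt_top (by
        rw [← eLpNorm_exponent_top]
        exact hh.2)

/-- The functions of `L^p(s dx)` are integrable against functions of rapid decay. -/
theorem integrable_mul_of_decay {μ : ℝ} (hμ : -1 / 2 < μ) {p : ℝ≥0∞} (hp : 1 ≤ p) {g w : ℝ → ℂ}
    (hg : MemLp g p (sMeasure μ)) (hw : AEStronglyMeasurable w (sMeasure μ)) {C : ℝ}
    (hC : ∀ x, 0 < x → ‖w x‖ ≤ C * (1 + x ^ decayExp μ)⁻¹) :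
    Integrable (fun x => g x * w x) (sMeasure μ) := by
  set d : ℝ → ℝ := fun x => (1 + x ^ decayExp μ)⁻¹ with hd
  have hdm : Measurable fun x => ENNReal.ofReal (d x) := by
    simp only [hd]
    fun_prop
  -- The measure `e s dx` is finite, hence its `L^p` lies in its `L¹`, and it is at most `s dx`,
  -- hence `g` belongs to it. Truncation at `1` gives `e ≤ 1` on the whole line and changes nothing
  -- for `x > 0`.
  set e : ℝ → ℝ≥0∞ := fun x => min (ENNReal.ofReal (d x)) 1 with he
  have hem : Measurable e := hdm.min measurable_const
  have hed : ∀ x, 0 < x → (e x).toReal = d x := fun x hx => by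
    have h4 := pow_pos hx (decayExp μ)
    have h1 : d x ≤ 1 := inv_le_one_of_one_le₀ (by linarith)
    have h0 : 0 < d x := by
      simp only [hd]
      positivity
    rw [he]
    simp only
    rw [min_eq_left (by simpa using ENNReal.ofReal_le_ofReal h1), ENNReal.toReal_ofReal h0.le]
  have hlt : ∀ x, e x < (⊤ : ℝ≥0∞) := fun x => (min_le_right _ _).trans_lt ENNReal.one_lt_top
  have hfin : IsFiniteMeasure ((sMeasure μ).withDensity e) := by
    refine isFiniteMeasure_withDensity (ne_of_lt ?_)
    have h1 := (integrableOn_decay_mul_s hμ).lintegral_lt_top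
    rw [sMeasure, lintegral_withDensity_eq_lintegral_mul_non_measurable _ (measurable_ofReal_s μ)
      (ae_of_all _ fun _ => ENNReal.ofReal_lt_top)]
    refine lt_of_le_of_lt ?_ h1
    refine lintegral_mono_ae ((ae_restrict_iff' measurableSet_Ioi).2 (ae_of_all _ fun x hx => ?_))
    simp only [Pi.mul_apply]
    rw [ENNReal.ofReal_mul' (s_pos hμ hx).le, mul_comm]
    gcongr
    exact min_le_left _ _
  have hle : (sMeasure μ).withDensity e ≤ sMeasure μ := by
    conv_rhs => rw [← withDensity_one (μ := sMeasure μ)]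
    exact withDensity_mono (ae_of_all _ fun x => min_le_right _ _)
  have h1 : Integrable g ((sMeasure μ).withDensity e) :=
    (hg.mono_measure hle).integrable hp
  rw [integrable_withDensity_iff_integrable_smul' hem (ae_of_all _ hlt)] at h1
  refine (h1.norm.const_mul C).mono' (hg.1.mul hw) ?_
  filter_upwards [ae_sMeasure_pos μ] with x hx
  rw [norm_mul, norm_smul, hed x hx]
  have h4 := pow_pos hx (decayExp μ)
  have h0 : 0 < d x := by
    simp only [hd]
    positivity
  rw [Real.norm_of_nonneg h0.le]
  calc ‖g x‖ * ‖w x‖ ≤ ‖g x‖ * (C * d x) := mul_le_mul_of_nonneg_left (hC x hx) (norm_nonneg _)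
    _ = _ := by ring

/-- The integral operator with Green's kernel is symmetric. -/
theorem integral_greenOp_mul {l μ : ℝ} (hμ : -1 / 2 < μ) (hl : 0 < l) {p : ℝ≥0∞} (hp : 1 ≤ p)
    {g w : ℝ → ℂ} (hg : MemLp g p (sMeasure μ)) (hw : AEStronglyMeasurable w (sMeasure μ)) {C : ℝ}
    (hC : ∀ x, 0 < x → ‖w x‖ ≤ C * (1 + x ^ decayExp μ)⁻¹) :
    ∫ x, greenOp l μ g x * w x ∂sMeasure μ = ∫ x, g x * greenOp l μ w x ∂sMeasure μ := by
  have hInt : Integrable (Function.uncurry fun x z => (green l μ x z : ℂ) * g z * w x)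
      ((sMeasure μ).prod (sMeasure μ)) := by
    have hm : AEStronglyMeasurable (Function.uncurry fun x z => (green l μ x z : ℂ) * g z * w x)
      ((sMeasure μ).prod (sMeasure μ)) :=
      by
      have h1 := (aestronglyMeasurable_green_mul hμ hl hg.1).mul hw.comp_fst
      exact h1
    rw [integrable_prod_iff hm]
    constructor
    · filter_upwards [ae_integrable_green_mul hμ hl hp hg] with x hx
      simp only [Function.uncurry_apply_pair]
      exact hx.mul_const (w x)
    -- By positivity of the kernel, the inner integral of the norm is `G|g|` times `|w|`. Since
    -- `G|g|` lies in `L^p`, the decay of `w` makes the product integrable.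
    · have hgn : MemLp (fun z => ((‖g z‖ : ℝ) : ℂ)) p (sMeasure μ) :=
        hg.of_le (Complex.continuous_ofReal.comp_aestronglyMeasurable hg.1.norm)
          (ae_of_all _ fun z => by rw [Complex.norm_real, norm_norm])
      have h1 := integrable_mul_of_decay hμ hp
        (memLp_greenOp (h := fun z => ((‖g z‖ : ℝ) : ℂ)) hμ hl hp hgn) hw hC
      refine h1.norm.congr ?_
      filter_upwards [ae_sMeasure_pos μ] with x hx
      rw [norm_mul, greenOp]
      simp only [Function.uncurry, norm_mul, Complex.norm_real,
        Real.norm_of_nonneg (green_pos hμ hl hx).le]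
      rw [integral_mul_const]
      congr 1
      have e : ∀ z, (green l μ x z : ℂ) * ((‖g z‖ : ℝ) : ℂ) = ((green l μ x z * ‖g z‖ : ℝ) : ℂ) :=
        fun z => by push_cast; rfl
      have hn : 0 ≤ ∫ z, green l μ x z * ‖g z‖ ∂sMeasure μ :=
        integral_nonneg fun z => mul_nonneg (green_pos hμ hl hx).le (norm_nonneg _)
      simp only [e]
      rw [integral_complex_ofReal, Complex.norm_real, Real.norm_of_nonneg hn]
  calc ∫ x, greenOp l μ g x * w x ∂sMeasure μ
      = ∫ x, ∫ z, (green l μ x z : ℂ) * g z * w x ∂sMeasure μ ∂sMeasure μ := by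
        simp only [greenOp, integral_mul_const]
    _ = ∫ z, ∫ x, (green l μ x z : ℂ) * g z * w x ∂sMeasure μ ∂sMeasure μ :=
        integral_integral_swap hInt
    _ = _ := by
        refine integral_congr_ae (ae_of_all _ fun z => ?_)
        beta_reduce
        rw [greenOp, ← integral_const_mul]
        refine integral_congr_ae (ae_of_all _ fun x => ?_)
        beta_reduce
        rw [green_comm]
        ring

/-! ### Resolvents of the part of an operator -/

section Part

variable {E V : Type*} [NormedAddCommGroup E] [NormedSpace ℂ E] [AddCommGroup V] [Module ℂ V]
  {A : V →ₗ[ℂ] V} {T : E →ₗ[ℂ] V} {hT : Function.Injective T}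

theorem map_part (f : (part A T hT).domain) : T (part A T hT f) = A (T f) :=
  congrArg Subtype.val ((LinearEquiv.ofInjective T hT).apply_symm_apply ⟨A (T f), f.2⟩)

theorem mem_graph_part_iff (f g : E) : (f, g) ∈ (part A T hT).graph ↔ A (T f) = T g := by
  rw [LinearPMap.mem_graph_iff]
  constructor
  · rintro ⟨y, rfl, rfl⟩
    exact (map_part y).symm
  · intro h
    exact ⟨⟨f, g, h.symm⟩, rfl, hT ((map_part _).trans h)⟩

theorem eq_of_smul_sub_eq {z : ℂ} {R : E →L[ℂ] E}
    (hR : ∀ g, z • T (R g) - A (T (R g)) = T g) (h0 : ∀ f, z • T f - A (T f) = 0 → f = 0)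
    {f g : E} (h : z • T f - A (T f) = T g) : R g = f := by
  refine sub_eq_zero.1 (h0 _ ?_)
  simp only [map_sub, smul_sub]
  rw [sub_sub_sub_comm, hR, h, sub_self]

/-- The graph consists of the pairs `(f, g)` with `R (z f - g) = f`, a closed condition because `R`
is continuous. No topology on `V` is involved. -/
theorem isClosed_part {z : ℂ} {R : E →L[ℂ] E}
    (hR : ∀ g, z • T (R g) - A (T (R g)) = T g) (h0 : ∀ f, z • T f - A (T f) = 0 → f = 0) :
    (part A T hT).IsClosed := by
  have e : ((part A T hT).graph : Set (E × E)) = {q | R (z • q.1 - q.2) = q.1} := by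
    ext ⟨f, g⟩
    rw [SetLike.mem_coe, mem_graph_part_iff, mem_ofPred_eq]
    constructor
    · intro h
      refine eq_of_smul_sub_eq hR h0 ?_
      rw [map_sub, map_smul, h]
    · intro h
      have h1 := hR (z • f - g)
      simp only at h
      rw [h, map_sub, map_smul] at h1
      exact sub_right_injective h1
  rw [LinearPMap.IsClosed, e]
  exact isClosed_eq (by fun_prop) continuous_fst

/-- The equation `hR` makes `R` a right inverse of `z - A`, and injectivity `h0` makes it a left
inverse too. -/
theorem isResolvent_neg_part {z : ℂ} {R : E →L[ℂ] E}
    (hR : ∀ g, z • T (R g) - A (T (R g)) = T g) (h0 : ∀ f, z • T f - A (T f) = 0 → f = 0) :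
    IsResolvent (-part A T hT) z R := by
  constructor
  · intro f
    rw [LinearPMap.neg_apply]
    refine eq_of_smul_sub_eq hR h0 ?_
    rw [map_add, map_smul, map_neg, sub_eq_add_neg]
    exact congrArg (fun v => z • T f + -v) (map_part f).symm
  · intro g
    have hm : R g ∈ (part A T hT).domain := by
      -- The resolvent equation, solved for `A (T (R g))`, exhibits it as an element of the range of
      -- `T`.
      refine ⟨z • R g - g, ?_⟩
      rw [map_sub, map_smul, ← hR g, sub_sub_cancel]
      rfl
    refine ⟨hm, hT ?_⟩
    rw [LinearPMap.neg_apply, map_add, map_smul, map_neg, map_part, ← sub_eq_add_neg]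
    exact hR g

end Part

/-! ### The Hankel convolution with `N_λ` -/

theorem rpow_div_c (μ : ℝ) {x z : ℝ} (hx : 0 < x) (hz : 0 < z) :
    (x * z) ^ (μ + 1 / 2) / c μ = (r μ x)⁻¹ * (s μ z * r μ z) := by
  have h1 : z ^ (2 * μ + 1) * z ^ (-μ - 1 / 2) = z ^ (μ + 1 / 2) := by
    rw [← Real.rpow_add hz]
    congr 1
    ring
  have h2 : (x ^ (-μ - 1 / 2))⁻¹ = x ^ (μ + 1 / 2) := by
    rw [← Real.rpow_neg hx.le]
    congr 1
    ring
  rw [r, r, s, h2, Real.mul_rpow hx.le hz.le, ← h1]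
  ring

theorem ae_pos_and_ne (x : ℝ) : ∀ᵐ z ∂volume.restrict (Ioi (0 : ℝ)), 0 < z ∧ x ≠ z := by
  have h1 : ∀ᵐ z ∂volume.restrict (Ioi (0 : ℝ)), z ≠ x :=
    ae_restrict_of_ae (Measure.ae_ne volume x)
  filter_upwards [ae_restrict_mem measurableSet_Ioi, h1] with z hz h
  exact ⟨hz, h.symm⟩

/-- The inner integral is Green's kernel up to the factor `(xz)^(μ+1/2) / c_μ = r(x)⁻¹ s(z) r(z)`,
except at `z = x`, a null set. The outer integrands agree almost everywhere, so `f` may be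
arbitrary. -/
theorem hankelConv_N {l μ : ℝ} (hμ : -1 / 2 < μ) (hl : 0 < l) (f : ℝ → ℂ) {x : ℝ} (hx : 0 < x) :
    hankelConv μ (fun y => (N μ l y : ℂ)) f x =
      (r μ x : ℂ)⁻¹ * greenOp l μ (fun z => (r μ z : ℂ) * f z) x := by
  rw [hankelConv, greenOp, integral_sMeasure hμ, ← integral_const_mul]
  refine integral_congr_ae ?_
  filter_upwards [ae_pos_and_ne x] with z hz
  rw [integral_mul_const]
  have e : ∀ y, (D μ x y z : ℂ) * (N μ l y : ℂ) = ((D μ x y z * N μ l y : ℝ) : ℂ) :=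
    fun y => (Complex.ofReal_mul _ _).symm
  simp only [e]
  rw [integral_complex_ofReal, integral_D_mul_N hμ hl hx hz.1 hz.2, rpow_div_c μ hx hz.1]
  push_cast
  ring

/-- Since `D_μ N_l ≥ 0`, integrating the absolute value in `y` gives Green's kernel times `|f|`.
Tonelli's theorem then reduces absolute convergence to a single integral. -/
theorem hankelConvExists_N {l μ : ℝ} (hμ : -1 / 2 < μ) (hl : 0 < l) {f : ℝ → ℂ}
    (hf : AEStronglyMeasurable f (volume.restrict (Ioi 0))) {x : ℝ} (hx : 0 < x)
    (h : Integrable (fun z => (green l μ x z : ℂ) * ((r μ z : ℂ) * f z)) (sMeasure μ)) :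
    HankelConvExists μ (fun y => (N μ l y : ℂ)) f x := by
  rw [integrable_sMeasure_iff hμ] at h
  have hm : AEStronglyMeasurable (fun q : ℝ × ℝ => (D μ x q.1 q.2 : ℂ) * (N μ l q.1 : ℂ) * f q.2)
      ((volume.restrict (Ioi (0 : ℝ))).prod (volume.restrict (Ioi (0 : ℝ)))) :=
    ((Complex.measurable_ofReal.comp (measurable_D μ x)).mul (Complex.measurable_ofReal.comp
      ((measurable_N μ l).comp measurable_fst))).aestronglyMeasurable.mul hf.comp_snd
  rw [HankelConvExists, IntegrableOn, Measure.volume_eq_prod, ← Measure.prod_restrict,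
    integrable_prod_iff' hm]
  have e : ∀ y z, (D μ x y z : ℂ) * (N μ l y : ℂ) = ((D μ x y z * N μ l y : ℝ) : ℂ) :=
    fun y z => (Complex.ofReal_mul _ _).symm
  simp only [e]
  constructor
  · filter_upwards [ae_pos_and_ne x] with z hz
    exact (integrableOn_D_mul_N hμ hl hx hz.1 hz.2).ofReal.mul_const (f z)
  · refine (h.norm.const_mul (r μ x)⁻¹).congr ?_
    filter_upwards [ae_pos_and_ne x] with z hz
    have hr := r_pos μ hz.1
    have hs := s_pos hμ hz.1
    have hg := green_pos hμ hl hx (z := z)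
    simp only [norm_mul, Complex.norm_real, Real.norm_of_nonneg (D_mul_N_nonneg hμ hl hx hz.1),
      Real.norm_of_nonneg hr.le, Real.norm_of_nonneg hs.le, Real.norm_of_nonneg hg.le]
    rw [integral_mul_const, integral_D_mul_N hμ hl hx hz.1 hz.2, rpow_div_c μ hx hz.1]
    ring

/-! ### The resolvent equation in the space of distributions -/

/-- The reason is `c_μ s r² = 1` on `(0,∞)`. In this form the symmetry of Green's operator applies.
-/
theorem integral_mul_test_eq {μ : ℝ} (hμ : -1 / 2 < μ) (f φ : ℝ → ℂ) :
    ∫ x in Ioi 0, f x * φ x =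
      c μ * ∫ x, ((r μ x : ℂ) * f x) * ((r μ x : ℂ) * φ x) ∂sMeasure μ := by
  rw [integral_sMeasure hμ, ← integral_const_mul]
  refine setIntegral_congr_fun measurableSet_Ioi fun x hx => ?_
  have hx0 : (0 : ℝ) < x := hx
  have h1 : c μ * (s μ x * (r μ x * r μ x)) = 1 := by
    have hc := (c_pos hμ).ne'
    rw [s, r, ← Real.rpow_add hx0, div_mul_eq_mul_div, ← Real.rpow_add hx0, mul_div_cancel₀ _ hc]
    convert Real.rpow_zero x using 2
    ring
  have h2 : (c μ : ℂ) * ((s μ x : ℂ) * ((r μ x : ℂ) * (r μ x : ℂ))) = 1 := by exact_mod_cast h1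
  linear_combination (-(f x * φ x)) * h2

theorem norm_r_mul_test_le (μ : ℝ) (φ : Hmu μ) {x : ℝ} (hx : 0 < x) :
    ‖(r μ x : ℂ) * (φ : ℝ → ℂ) x‖ ≤
      (gamma μ 0 0 φ + gamma μ (decayExp μ) 0 φ) * (1 + x ^ decayExp μ)⁻¹ := by
  have hr := r_pos μ hx
  rw [norm_mul, Complex.norm_real, Real.norm_of_nonneg hr.le]
  refine (mul_le_mul_of_nonneg_left (norm_test_le μ φ hx) hr.le).trans (le_of_eq ?_)
  have h1 : r μ x * x ^ (μ + 1 / 2) = 1 := by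
    rw [r, ← Real.rpow_add hx]
    convert Real.rpow_zero x using 2
    ring
  rw [testWeight, div_eq_mul_inv]
  linear_combination (gamma μ 0 0 φ + gamma μ (decayExp μ) 0 φ) * (1 + x ^ decayExp μ)⁻¹ * h1

theorem aestronglyMeasurable_r_mul_test (μ : ℝ) (φ : Hmu μ) :
    AEStronglyMeasurable (fun x => (r μ x : ℂ) * (φ : ℝ → ℂ) x) (sMeasure μ) :=
  ((contDiffOn_r_mul μ φ.2.2.1).continuousOn.aestronglyMeasurable measurableSet_Ioi).mono_ac
    (sMeasure_ac μ)

/-- `λ φ - S_μ φ` as an element of `H_μ`. -/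
def shiftedBessel (μ l : ℝ) (φ : Hmu μ) : Hmu μ := (l : ℂ) • φ - besselLin μ φ

theorem shiftedBessel_apply (μ l : ℝ) (φ : Hmu μ) (x : ℝ) :
    (shiftedBessel μ l φ : ℝ → ℂ) x = l * (φ : ℝ → ℂ) x - besselFun μ φ x := rfl

theorem greenOp_shiftedBessel {l μ : ℝ} (hμ : -1 / 2 < μ) (hl : 0 < l) (φ : Hmu μ) {x : ℝ}
    (hx : 0 < x) :
    greenOp l μ (fun z => (r μ z : ℂ) * (shiftedBessel μ l φ : ℝ → ℂ) z) x =
      (r μ x : ℂ) * (φ : ℝ → ℂ) x := by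
  rw [greenOp, integral_sMeasure hμ, ← green_identity_test hμ hl φ hx]
  refine setIntegral_congr_fun measurableSet_Ioi fun z _ => ?_
  simp only [shiftedBessel_apply]
  push_cast
  ring

/-- Symmetry moves `G` from `r f` to `r (l - S_μ) φ`, and Green's identity gives back `r φ`. This is
the resolvent equation tested against `φ`. -/
theorem integral_mul_shiftedBessel {l μ : ℝ} (hμ : -1 / 2 < μ) (hl : 0 < l) {p : ℝ≥0∞}
    (hp : 1 ≤ p) {f u : ℝ → ℂ} (hf : MemLp (fun x => (r μ x : ℂ) * f x) p (sMeasure μ))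
    (hu : ∀ᵐ x ∂volume.restrict (Ioi (0 : ℝ)),
      u x = (r μ x : ℂ)⁻¹ * greenOp l μ (fun z => (r μ z : ℂ) * f z) x) (φ : Hmu μ) :
    ∫ x in Ioi 0, u x * (shiftedBessel μ l φ : ℝ → ℂ) x = ∫ x in Ioi 0, f x * (φ : ℝ → ℂ) x := by
  rw [integral_mul_test_eq hμ, integral_mul_test_eq hμ]
  congr 1
  have h1 := integral_greenOp_mul hμ hl hp hf (aestronglyMeasurable_r_mul_test μ _)
    fun x hx => norm_r_mul_test_le μ (shiftedBessel μ l φ) hx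
  calc _ = ∫ x, greenOp l μ (fun z => (r μ z : ℂ) * f z) x *
        ((r μ x : ℂ) * (shiftedBessel μ l φ : ℝ → ℂ) x) ∂sMeasure μ := by
        refine integral_congr_ae ?_
        filter_upwards [(sMeasure_ac μ).ae_le hu, ae_sMeasure_pos μ] with x hx hx0
        have hr : (r μ x : ℂ) ≠ 0 := Complex.ofReal_ne_zero.2 (r_pos μ hx0).ne'
        rw [hx, mul_inv_cancel_left₀ hr]
    _ = _ := by
        rw [h1]
        refine integral_congr_ae ?_
        filter_upwards [ae_sMeasure_pos μ] with x hx
        rw [greenOp_shiftedBessel hμ hl φ hx]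

/-- Every smooth `ψ` with compact support in `(0,∞)` is `(l - S_μ) φ` for some `φ` in `H_μ`, so `f`
is orthogonal to all of them. A locally integrable function with this property vanishes almost
everywhere. -/
theorem ae_eq_zero_of_integral_mul_shiftedBessel {l μ : ℝ} (hμ : -1 / 2 < μ) (hl : 0 < l)
    {f : ℝ → ℂ} (hf : IntegrableOn (fun x => (testWeight μ x : ℂ) * f x) (Ioi 0))
    (h : ∀ φ : Hmu μ, ∫ x in Ioi 0, f x * (shiftedBessel μ l φ : ℝ → ℂ) x = 0) :
    ∀ᵐ x ∂volume.restrict (Ioi 0), f x = 0 := by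
  rw [ae_restrict_iff' measurableSet_Ioi]
  have hw : ContinuousOn (fun x => (testWeight μ x : ℂ)⁻¹) (Ioi 0) :=
    (Complex.continuous_ofReal.comp_continuousOn (continuousOn_testWeight μ)).inv₀
      fun x hx => Complex.ofReal_ne_zero.2 (testWeight_pos μ hx).ne'
  have h1 := hf.locallyIntegrableOn.continuousOn_mul hw isOpen_Ioi.isLocallyClosed
  have h2 : LocallyIntegrableOn f (Ioi 0) := by
    refine h1.congr ((ae_restrict_iff' measurableSet_Ioi).2 (ae_of_all _ fun x hx => ?_))
    have : (testWeight μ x : ℂ) ≠ 0 := by exact_mod_cast (testWeight_pos μ hx).ne'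
    exact inv_mul_cancel_left₀ this _
  refine isOpen_Ioi.ae_eq_zero_of_integral_contDiff_smul_eq_zero h2 fun g hg hc hs => ?_
  have hsub : tsupport (fun x => (g x : ℂ)) ⊆ tsupport g :=
    closure_mono fun x hx => by simpa using hx
  have hT : IsTestFun (fun x => (g x : ℂ)) :=
    ⟨Complex.ofRealCLM.contDiff.comp hg, hc.comp_left Complex.ofReal_zero, hsub.trans hs⟩
  obtain ⟨φ, hφ⟩ := exists_test_eq hμ hl hT
  rw [← h φ, ← setIntegral_eq_integral_of_forall_compl_eq_zero (s := Ioi 0)]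
  · refine setIntegral_congr_fun measurableSet_Ioi fun x hx => ?_
    simp only [Complex.real_smul, shiftedBessel_apply, hφ x hx]
    ring
  · intro x hx
    have h0 := (hT.mem_Hmu μ).1 x (by simpa using hx)
    simp only at h0
    rw [Complex.real_smul, h0, zero_mul]

theorem smul_regularElement_sub (μ l : ℝ) {f : ℝ → ℂ}
    (hf : IntegrableOn (fun x => (testWeight μ x : ℂ) * f x) (Ioi 0)) (φ : Hmu μ) :
    ((l : ℂ) • regularElement μ f hf - besselDual μ (regularElement μ f hf)) φ =
      ∫ x in Ioi 0, f x * (shiftedBessel μ l φ : ℝ → ℂ) x := by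
  have h : regularElement μ f hf (shiftedBessel μ l φ) =
      (l : ℂ) * regularElement μ f hf φ - regularElement μ f hf (besselLin μ φ) := by
    rw [shiftedBessel, map_sub, map_smul, smul_eq_mul]
  exact h.symm

/-! ### The resolvents -/

/-- The function `(λ - S_μ)⁻¹ f`, given by Green's kernel. -/
def resolventFun (l μ : ℝ) (f : ℝ → ℂ) (x : ℝ) : ℂ :=
  (r μ x : ℂ)⁻¹ * greenOp l μ (fun z => (r μ z : ℂ) * f z) x

theorem resolventFun_congr {l μ : ℝ} {f g : ℝ → ℂ}
    (h : ∀ᵐ x ∂volume.restrict (Ioi (0 : ℝ)), f x = g x) :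
    resolventFun l μ f = resolventFun l μ g := by
  funext x
  rw [resolventFun, resolventFun, greenOp, greenOp]
  congr 1
  refine integral_congr_ae ?_
  filter_upwards [(sMeasure_ac μ).ae_le h] with z hz
  rw [hz]

theorem resolventFun_const_mul (l μ : ℝ) (a : ℂ) (f : ℝ → ℂ) (x : ℝ) :
    resolventFun l μ (fun z => a * f z) x = a * resolventFun l μ f x := by
  rw [resolventFun, resolventFun, greenOp, greenOp, mul_left_comm a]
  congr 1
  rw [← integral_const_mul]
  refine integral_congr_ae (ae_of_all _ fun z => ?_)
  ring

theorem resolventFun_add {l μ : ℝ} (hμ : -1 / 2 < μ) (hl : 0 < l) {p : ℝ≥0∞} (hp : 1 ≤ p)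
    {f g : ℝ → ℂ} (hf : MemLp (fun x => (r μ x : ℂ) * f x) p (sMeasure μ))
    (hg : MemLp (fun x => (r μ x : ℂ) * g x) p (sMeasure μ)) :
    ∀ᵐ x ∂volume.restrict (Ioi (0 : ℝ)),
      resolventFun l μ (fun z => f z + g z) x = resolventFun l μ f x + resolventFun l μ g x := by
  filter_upwards [(ac_sMeasure hμ).ae_le (ae_integrable_green_mul hμ hl hp hf),
    (ac_sMeasure hμ).ae_le (ae_integrable_green_mul hμ hl hp hg)] with x h1 h2
  rw [resolventFun, resolventFun, resolventFun, ← mul_add, greenOp, greenOp, greenOp,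
    ← integral_add h1 h2]
  simp only [mul_add]

theorem r_mul_resolventFun (l μ : ℝ) (f : ℝ → ℂ) :
    (fun x => (r μ x : ℂ) * resolventFun l μ f x) =ᵐ[sMeasure μ]
      greenOp l μ fun z => (r μ z : ℂ) * f z := by
  filter_upwards [ae_sMeasure_pos μ] with x hx
  exact mul_inv_cancel_left₀ (Complex.ofReal_ne_zero.2 (r_pos μ hx).ne') _

theorem memLp_r_mul_resolventFun {l μ : ℝ} (hμ : -1 / 2 < μ) (hl : 0 < l) {p : ℝ≥0∞} (hp : 1 ≤ p)
    {f : ℝ → ℂ} (hf : MemLp (fun x => (r μ x : ℂ) * f x) p (sMeasure μ)) :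
    MemLp (fun x => (r μ x : ℂ) * resolventFun l μ f x) p (sMeasure μ) :=
  (memLp_greenOp hμ hl hp hf).ae_eq (r_mul_resolventFun l μ f).symm

theorem eLpNorm_r_mul_resolventFun_le {l μ : ℝ} (hμ : -1 / 2 < μ) (hl : 0 < l) {p : ℝ≥0∞}
    (hp : 1 ≤ p) {f : ℝ → ℂ} (hf : MemLp (fun x => (r μ x : ℂ) * f x) p (sMeasure μ)) :
    (eLpNorm (fun x => (r μ x : ℂ) * resolventFun l μ f x) p (sMeasure μ)).toReal ≤
      1 / l * (eLpNorm (fun x => (r μ x : ℂ) * f x) p (sMeasure μ)).toReal := by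
  rw [eLpNorm_congr_ae (r_mul_resolventFun l μ f),
    ← ENNReal.toReal_ofReal (one_div_pos.2 hl).le, ← ENNReal.toReal_mul]
  exact ENNReal.toReal_mono (ENNReal.mul_lt_top ENNReal.ofReal_lt_top hf.2).ne
    (eLpNorm_greenOp_le hμ hl hp hf.1)

/-! ### Transfer between `L^p(s r^p)` and `L^p(s dx)` -/

theorem measurable_r (μ : ℝ) : Measurable fun x => (r μ x : ℂ) := by
  unfold r
  fun_prop

theorem aestronglyMeasurable_of_r_mul {μ : ℝ} {F : ℝ → ℂ} {ν : Measure ℝ}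
    (hν : ν ≪ volume.restrict (Ioi 0))
    (h : AEStronglyMeasurable (fun x => (r μ x : ℂ) * F x) ν) : AEStronglyMeasurable F ν := by
  refine ((measurable_r μ).inv.aestronglyMeasurable.mul h).congr ?_
  filter_upwards [hν.ae_le (ae_restrict_mem measurableSet_Ioi)] with x hx
  exact inv_mul_cancel_left₀ (Complex.ofReal_ne_zero.2 (r_pos μ hx).ne') _

/-- The integrands coincide: `|F|^p s r^p = |r F|^p s`. Multiplication by `r` is thus isometric for
each finite `p`. -/
theorem eLpNorm_weightMeasure {μ : ℝ} (hμ : -1 / 2 < μ) {p : ℝ≥0∞} (hp0 : p ≠ 0) (hp : p ≠ ⊤)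
    (F : ℝ → ℂ) :
    eLpNorm F p (weightMeasure μ p) = eLpNorm (fun x => (r μ x : ℂ) * F x) p (sMeasure μ) := by
  rw [eLpNorm_eq_lintegral_rpow_enorm_toReal hp0 hp,
    eLpNorm_eq_lintegral_rpow_enorm_toReal hp0 hp, weightMeasure, sMeasure,
    lintegral_withDensity_eq_lintegral_mul_non_measurable _ (measurable_weight μ p)
      (ae_of_all _ fun _ => ENNReal.ofReal_lt_top),
    lintegral_withDensity_eq_lintegral_mul_non_measurable _ (measurable_ofReal_s μ)
      (ae_of_all _ fun _ => ENNReal.ofReal_lt_top)]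
  congr 1
  refine setLIntegral_congr_fun measurableSet_Ioi fun x hx => ?_
  have hr := r_pos μ hx
  simp only [Pi.mul_apply]
  rw [enorm_mul, ENNReal.mul_rpow_of_nonneg _ _ ENNReal.toReal_nonneg,
    ENNReal.ofReal_mul (s_pos hμ hx).le, mul_assoc, ← ofReal_norm (r μ x : ℂ), Complex.norm_real,
    Real.norm_of_nonneg hr.le, ENNReal.ofReal_rpow_of_pos hr]

theorem memLp_weightMeasure_iff {μ : ℝ} (hμ : -1 / 2 < μ) {p : ℝ≥0∞} (hp0 : p ≠ 0) (hp : p ≠ ⊤)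
    (F : ℝ → ℂ) :
    MemLp F p (weightMeasure μ p) ↔ MemLp (fun x => (r μ x : ℂ) * F x) p (sMeasure μ) := by
  have h1 : weightMeasure μ p ≪ sMeasure μ := (weightMeasure_ac_restrict μ p).trans (ac_sMeasure hμ)
  have h2 : sMeasure μ ≪ weightMeasure μ p := (sMeasure_ac μ).trans (restrict_ac_weightMeasure hμ p)
  rw [MemLp, MemLp, eLpNorm_weightMeasure hμ hp0 hp]
  refine and_congr_left fun _ => ⟨fun h => (measurable_r μ).aestronglyMeasurable.mul (h.mono_ac h2),
    fun h => aestronglyMeasurable_of_r_mul (weightMeasure_ac_restrict μ p) (h.mono_ac h1)⟩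

/-! ### The resolvent on `L^p(s r^p)` -/

theorem memLp_r_mul {μ : ℝ} (hμ : -1 / 2 < μ) {p : ℝ≥0∞} [hp1 : Fact (1 ≤ p)]
    (hp : p ≠ ⊤) (f : LpSR μ p) : MemLp (fun x => (r μ x : ℂ) * f x) p (sMeasure μ) :=
  (memLp_weightMeasure_iff hμ (zero_lt_one.trans_le hp1.out).ne' hp f).1 (Lp.memLp f)

theorem memLp_resolventFun {μ : ℝ} (hμ : -1 / 2 < μ) {p : ℝ≥0∞} [hp1 : Fact (1 ≤ p)]
    (hp : p ≠ ⊤) {l : ℝ} (hl : 0 < l) (f : LpSR μ p) :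
    MemLp (resolventFun l μ f) p (weightMeasure μ p) :=
  (memLp_weightMeasure_iff hμ (zero_lt_one.trans_le hp1.out).ne' hp _).2
    (memLp_r_mul_resolventFun hμ hl hp1.out (memLp_r_mul hμ hp f))

/-- The resolvent of `S_{μ,p}`. -/
def resolventLp {μ : ℝ} (hμ : -1 / 2 < μ) {p : ℝ≥0∞} [hp1 : Fact (1 ≤ p)]
    (hp : p ≠ ⊤) {l : ℝ} (hl : 0 < l) : LpSR μ p →L[ℂ] LpSR μ p :=
  LinearMap.mkContinuous
    { toFun := fun f => (memLp_resolventFun hμ hp hl f).toLp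
      map_add' := fun f g => by
        rw [← MemLp.toLp_add, MemLp.toLp_eq_toLp_iff]
        refine (weightMeasure_ac_restrict μ p).ae_le ?_
        rw [resolventFun_congr ((restrict_ac_weightMeasure hμ p).ae_le (Lp.coeFn_add f g))]
        exact resolventFun_add hμ hl hp1.out (memLp_r_mul hμ hp f) (memLp_r_mul hμ hp g)
      map_smul' := fun a f => by
        rw [RingHom.id_apply, ← MemLp.toLp_const_smul, MemLp.toLp_eq_toLp_iff,
          resolventFun_congr ((restrict_ac_weightMeasure hμ p).ae_le (Lp.coeFn_smul a f))]
        exact ae_of_all _ fun x => resolventFun_const_mul l μ a f x }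
    (1 / l) fun f => by
      have h0 := (zero_lt_one.trans_le hp1.out).ne'
      have h := eLpNorm_r_mul_resolventFun_le hμ hl hp1.out (memLp_r_mul hμ hp f)
      rw [← eLpNorm_weightMeasure hμ h0 hp, ← eLpNorm_weightMeasure hμ h0 hp, ← Lp.norm_def] at h
      refine le_trans (le_of_eq ?_) h
      exact Lp.norm_toLp _ (memLp_resolventFun hμ hp hl f)

theorem norm_resolventLp_le {μ : ℝ} (hμ : -1 / 2 < μ) {p : ℝ≥0∞} [hp1 : Fact (1 ≤ p)]
    (hp : p ≠ ⊤) {l : ℝ} (hl : 0 < l) : ‖resolventLp hμ hp hl‖ ≤ 1 / l :=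
  LinearMap.mkContinuous_norm_le _ (one_div_pos.2 hl).le _

theorem resolventLp_apply {μ : ℝ} (hμ : -1 / 2 < μ) {p : ℝ≥0∞} [hp1 : Fact (1 ≤ p)]
    (hp : p ≠ ⊤) {l : ℝ} (hl : 0 < l) (f : LpSR μ p) :
    ∀ᵐ x ∂volume.restrict (Ioi (0 : ℝ)), resolventLp hμ hp hl f x = resolventFun l μ f x :=
  (restrict_ac_weightMeasure hμ p).ae_le (MemLp.coeFn_toLp (memLp_resolventFun hμ hp hl f))

theorem embedLp_resolventLp {μ : ℝ} (hμ : -1 / 2 < μ) {p : ℝ≥0∞} [hp1 : Fact (1 ≤ p)]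
    (hp : p ≠ ⊤) {l : ℝ} (hl : 0 < l) (g : LpSR μ p) :
    (l : ℂ) • embedLp μ hμ p hp (resolventLp hμ hp hl g) -
      besselDual μ (embedLp μ hμ p hp (resolventLp hμ hp hl g)) = embedLp μ hμ p hp g := by
  refine ContinuousLinearMap.ext fun φ => ?_
  refine (smul_regularElement_sub μ l _ φ).trans ?_
  exact integral_mul_shiftedBessel hμ hl hp1.out (memLp_r_mul hμ hp g)
    (resolventLp_apply hμ hp hl g) φ

theorem eq_zero_of_embedLp {μ : ℝ} (hμ : -1 / 2 < μ) {p : ℝ≥0∞} [hp1 : Fact (1 ≤ p)]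
    (hp : p ≠ ⊤) {l : ℝ} (hl : 0 < l) (f : LpSR μ p)
    (h : (l : ℂ) • embedLp μ hμ p hp f - besselDual μ (embedLp μ hμ p hp f) = 0) : f = 0 := by
  rw [Lp.eq_zero_iff_ae_eq_zero]
  refine (weightMeasure_ac_restrict μ p).ae_le (ae_eq_zero_of_integral_mul_shiftedBessel hμ hl
    (integrableOn_testWeight_Lp hμ hp f) fun φ => ?_)
  rw [← smul_regularElement_sub μ l (integrableOn_testWeight_Lp hμ hp f) φ]
  exact DFunLike.congr_fun h φ

theorem isResolvent_resolventLp {μ : ℝ} (hμ : -1 / 2 < μ) {p : ℝ≥0∞} [hp1 : Fact (1 ≤ p)]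
    (hp : p ≠ ⊤) {l : ℝ} (hl : 0 < l) :
    IsResolvent (-besselLp μ hμ p hp) l (resolventLp hμ hp hl) :=
  isResolvent_neg_part (embedLp_resolventLp hμ hp hl) (eq_zero_of_embedLp hμ hp hl)

theorem isClosed_besselLp {μ : ℝ} (hμ : -1 / 2 < μ) {p : ℝ≥0∞} [Fact (1 ≤ p)]
    (hp : p ≠ ⊤) : (besselLp μ hμ p hp).IsClosed :=
  isClosed_part (embedLp_resolventLp hμ hp one_pos) (eq_zero_of_embedLp hμ hp one_pos)

theorem hankelConv_Lp {μ : ℝ} (hμ : -1 / 2 < μ) {p : ℝ≥0∞} [hp1 : Fact (1 ≤ p)]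
    (hp : p ≠ ⊤) {l : ℝ} (hl : 0 < l) (f : LpSR μ p) :
    ∀ᵐ x ∂volume.restrict (Ioi (0 : ℝ)), HankelConvExists μ (fun y => (N μ l y : ℂ)) f x ∧
      resolventLp hμ hp hl f x = hankelConv μ (fun y => (N μ l y : ℂ)) f x := by
  filter_upwards [resolventLp_apply hμ hp hl f, ae_restrict_mem measurableSet_Ioi,
    (ac_sMeasure hμ).ae_le (ae_integrable_green_mul hμ hl hp1.out (memLp_r_mul hμ hp f))]
    with x h1 hx h2
  refine ⟨hankelConvExists_N hμ hl ?_ hx h2, h1.trans (hankelConv_N hμ hl f hx).symm⟩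
  exact (Lp.aestronglyMeasurable f).mono_ac (restrict_ac_weightMeasure hμ p)


/-! ### The resolvent on `L^∞(r)` -/

/-- Since `s > 0` on `(0,∞)`, the measures `s dx` and `dx` have the same null sets there, and hence
the same essential suprema. -/
theorem eLpNorm_top_sMeasure {μ : ℝ} (hμ : -1 / 2 < μ) (F : ℝ → ℂ) :
    eLpNorm F ⊤ (sMeasure μ) = eLpNorm F ⊤ (volume.restrict (Ioi 0)) := by
  rw [eLpNorm_exponent_top, eLpNorm_exponent_top]
  exact le_antisymm (eLpNormEssSup_mono_measure _ (sMeasure_ac μ))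
    (eLpNormEssSup_mono_measure _ (ac_sMeasure hμ))

theorem memLp_top_sMeasure_iff {μ : ℝ} (hμ : -1 / 2 < μ) (F : ℝ → ℂ) :
    MemLp F ⊤ (sMeasure μ) ↔ MemLp F ⊤ (volume.restrict (Ioi 0)) := by
  rw [MemLp, MemLp, eLpNorm_top_sMeasure hμ]
  exact and_congr_left fun _ => ⟨fun h => h.mono_ac (ac_sMeasure hμ),
    fun h => h.mono_ac (sMeasure_ac μ)⟩

theorem memLp_top_r_mul {μ : ℝ} (hμ : -1 / 2 < μ) (f : LinfR μ) :
    MemLp (fun x => (r μ x : ℂ) * f x) ⊤ (sMeasure μ) :=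
  (memLp_top_sMeasure_iff hμ _).2 f.memLp

theorem memLp_top_resolventFun {μ : ℝ} (hμ : -1 / 2 < μ) {l : ℝ} (hl : 0 < l) (f : LinfR μ) :
    MemLp (fun x => (r μ x : ℂ) * resolventFun l μ f x) ⊤ (volume.restrict (Ioi 0)) :=
  (memLp_top_sMeasure_iff hμ _).1 (memLp_r_mul_resolventFun hμ hl le_top (memLp_top_r_mul hμ f))

theorem LinfR.ext {μ : ℝ} {f g : LinfR μ}
    (h : ∀ᵐ x ∂volume.restrict (Ioi (0 : ℝ)), f x = g x) : f = g :=
  Subtype.ext (AEEqFun.ext h)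

/-- The element of `L^∞(r)` given by a function. -/
def LinfR.mk {μ : ℝ} (F : ℝ → ℂ)
    (hF : MemLp (fun x => (r μ x : ℂ) * F x) ⊤ (volume.restrict (Ioi 0))) : LinfR μ :=
  ⟨AEEqFun.mk F (aestronglyMeasurable_of_r_mul Measure.AbsolutelyContinuous.rfl hF.1), by
    refine hF.ae_eq ?_
    filter_upwards [AEEqFun.coeFn_mk F
      (aestronglyMeasurable_of_r_mul Measure.AbsolutelyContinuous.rfl hF.1)] with x hx
    rw [hx]⟩

theorem LinfR.coe_mk {μ : ℝ} (F : ℝ → ℂ)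
    (hF : MemLp (fun x => (r μ x : ℂ) * F x) ⊤ (volume.restrict (Ioi 0))) :
    ∀ᵐ x ∂volume.restrict (Ioi (0 : ℝ)), LinfR.mk F hF x = F x :=
  AEEqFun.coeFn_mk _ _

/-- The resolvent of `S_{μ,∞}`. -/
def resolventLinf {μ : ℝ} (hμ : -1 / 2 < μ) {l : ℝ} (hl : 0 < l) : LinfR μ →L[ℂ] LinfR μ :=
  LinearMap.mkContinuous
    { toFun := fun f => LinfR.mk (resolventFun l μ f) (memLp_top_resolventFun hμ hl f)
      map_add' := fun f g => by
        refine LinfR.ext ?_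
        filter_upwards [LinfR.coe_mk _ (memLp_top_resolventFun hμ hl (f + g)),
          LinfR.coe_mk _ (memLp_top_resolventFun hμ hl f),
          LinfR.coe_mk _ (memLp_top_resolventFun hμ hl g), LinfR.coe_add
          (LinfR.mk _ (memLp_top_resolventFun hμ hl f))
          (LinfR.mk _ (memLp_top_resolventFun hμ hl g)),
          resolventFun_add hμ hl le_top (memLp_top_r_mul hμ f) (memLp_top_r_mul hμ g)]
          with x h1 h2 h3 h4 h5
        rw [h1, h4, h2, h3, resolventFun_congr (LinfR.coe_add f g), h5]
      map_smul' := fun a f => by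
        refine LinfR.ext ?_
        filter_upwards [LinfR.coe_mk _ (memLp_top_resolventFun hμ hl (a • f)),
          LinfR.coe_mk _ (memLp_top_resolventFun hμ hl f), LinfR.coe_smul a
          (LinfR.mk _ (memLp_top_resolventFun hμ hl f))] with x h1 h2 h3
        rw [h1, RingHom.id_apply, h3, h2, resolventFun_congr (LinfR.coe_smul a f),
          resolventFun_const_mul] }
    (1 / l) fun f => by
      have h := eLpNorm_r_mul_resolventFun_le hμ hl le_top (memLp_top_r_mul hμ f)
      rw [eLpNorm_top_sMeasure hμ, eLpNorm_top_sMeasure hμ, ← norm_LinfR] at h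
      refine le_trans (le_of_eq ?_) h
      refine (norm_LinfR μ _).trans (congrArg ENNReal.toReal (eLpNorm_congr_ae ?_))
      filter_upwards [LinfR.coe_mk _ (memLp_top_resolventFun hμ hl f)] with x hx
      exact congrArg _ hx

theorem norm_resolventLinf_le {μ : ℝ} (hμ : -1 / 2 < μ) {l : ℝ} (hl : 0 < l) :
    ‖resolventLinf hμ hl‖ ≤ 1 / l :=
  LinearMap.mkContinuous_norm_le _ (one_div_pos.2 hl).le _

theorem resolventLinf_apply {μ : ℝ} (hμ : -1 / 2 < μ) {l : ℝ} (hl : 0 < l) (f : LinfR μ) :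
    ∀ᵐ x ∂volume.restrict (Ioi (0 : ℝ)), resolventLinf hμ hl f x = resolventFun l μ f x :=
  LinfR.coe_mk _ (memLp_top_resolventFun hμ hl f)

theorem embedLinf_resolventLinf {μ : ℝ} (hμ : -1 / 2 < μ) {l : ℝ} (hl : 0 < l) (g : LinfR μ) :
    (l : ℂ) • embedLinf μ hμ (resolventLinf hμ hl g) -
      besselDual μ (embedLinf μ hμ (resolventLinf hμ hl g)) = embedLinf μ hμ g := by
  refine ContinuousLinearMap.ext fun φ => ?_
  refine (smul_regularElement_sub μ l _ φ).trans ?_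
  exact integral_mul_shiftedBessel hμ hl le_top (memLp_top_r_mul hμ g)
    (resolventLinf_apply hμ hl g) φ

theorem eq_zero_of_embedLinf {μ : ℝ} (hμ : -1 / 2 < μ) {l : ℝ} (hl : 0 < l) (f : LinfR μ)
    (h : (l : ℂ) • embedLinf μ hμ f - besselDual μ (embedLinf μ hμ f) = 0) : f = 0 := by
  refine f.eq_zero (ae_eq_zero_of_integral_mul_shiftedBessel hμ hl
    (integrableOn_testWeight_Linf hμ f) fun φ => ?_)
  rw [← smul_regularElement_sub μ l (integrableOn_testWeight_Linf hμ f) φ]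
  exact DFunLike.congr_fun h φ

theorem isResolvent_resolventLinf {μ : ℝ} (hμ : -1 / 2 < μ) {l : ℝ} (hl : 0 < l) :
    IsResolvent (-besselLinf μ hμ) l (resolventLinf hμ hl) :=
  isResolvent_neg_part (embedLinf_resolventLinf hμ hl) (eq_zero_of_embedLinf hμ hl)

theorem isClosed_besselLinf {μ : ℝ} (hμ : -1 / 2 < μ) : (besselLinf μ hμ).IsClosed :=
  isClosed_part (embedLinf_resolventLinf hμ one_pos) (eq_zero_of_embedLinf hμ one_pos)

theorem hankelConvExists_Linf {μ : ℝ} (hμ : -1 / 2 < μ) {l : ℝ} (hl : 0 < l) (f : LinfR μ)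
    {x : ℝ} (hx : 0 < x) :
    HankelConvExists μ (fun y => (N μ l y : ℂ)) f x :=
  hankelConvExists_N hμ hl (AEEqFun.aestronglyMeasurable _) hx
    (integrable_green_mul_of_memLp_top hμ hl (memLp_top_r_mul hμ f) hx)

theorem hankelConv_Linf {μ : ℝ} (hμ : -1 / 2 < μ) {l : ℝ} (hl : 0 < l) (f : LinfR μ) :
    ∀ᵐ x ∂volume.restrict (Ioi (0 : ℝ)),
      resolventLinf hμ hl f x = hankelConv μ (fun y => (N μ l y : ℂ)) f x := by
  filter_upwards [resolventLinf_apply hμ hl f, ae_restrict_mem measurableSet_Ioi] with x h1 hx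
  exact h1.trans (hankelConv_N hμ hl f hx).symm


theorem isNonnegative_of_resolvent {E : Type*} [NormedAddCommGroup E] [NormedSpace ℂ E]
    {A : E →ₗ.[ℂ] E} (h : ∀ l : ℝ, 0 < l → ∃ R : E →L[ℂ] E, IsResolvent A l R ∧ ‖R‖ ≤ 1 / l) :
    IsNonnegative A := by
  refine ⟨1, fun l hl => ?_⟩
  obtain ⟨R, h1, h2⟩ := h l hl
  refine ⟨R, h1, ?_⟩
  rw [norm_smul, Complex.norm_real, Real.norm_of_nonneg hl.le]
  exact (mul_le_mul_of_nonneg_left h2 hl.le).trans (mul_one_div_cancel hl.ne').le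

end Bessel

end

theorem mainTheorem1 (μ : ℝ) (hμ : -1 / 2 < μ) :
    (∀ (p : ENNReal) [Fact (1 ≤ p)] (hp : p ≠ ⊤),
      (Bessel.besselLp μ hμ p hp).IsClosed ∧
      Bessel.IsNonnegative (-Bessel.besselLp μ hμ p hp) ∧
      ∀ l : ℝ, 0 < l → ∃ R : Bessel.LpSR μ p →L[ℂ] Bessel.LpSR μ p,
        Bessel.IsResolvent (-Bessel.besselLp μ hμ p hp) l R ∧ ‖R‖ ≤ 1 / l ∧
        ∀ f : Bessel.LpSR μ p, ∀ᵐ x ∂MeasureTheory.volume.restrict (Set.Ioi (0 : ℝ)),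
          Bessel.HankelConvExists μ (fun y => (Bessel.N μ l y : ℂ)) f x ∧
          R f x = Bessel.hankelConv μ (fun y => (Bessel.N μ l y : ℂ)) f x) ∧
    (Bessel.besselLinf μ hμ).IsClosed ∧
    Bessel.IsNonnegative (-Bessel.besselLinf μ hμ) ∧
    ∀ l : ℝ, 0 < l → ∃ R : Bessel.LinfR μ →L[ℂ] Bessel.LinfR μ,
      Bessel.IsResolvent (-Bessel.besselLinf μ hμ) l R ∧ ‖R‖ ≤ 1 / l ∧
      ∀ f : Bessel.LinfR μ,
        (∀ x : ℝ, 0 < x → Bessel.HankelConvExists μ (fun y => (Bessel.N μ l y : ℂ)) f x) ∧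
        ∀ᵐ x ∂MeasureTheory.volume.restrict (Set.Ioi (0 : ℝ)),
          R f x = Bessel.hankelConv μ (fun y => (Bessel.N μ l y : ℂ)) f x := by
  refine ⟨fun p _ hp => ⟨Bessel.isClosed_besselLp hμ hp,
    Bessel.isNonnegative_of_resolvent fun l hl => ⟨Bessel.resolventLp hμ hp hl,
      Bessel.isResolvent_resolventLp hμ hp hl, Bessel.norm_resolventLp_le hμ hp hl⟩,
    fun l hl => ⟨Bessel.resolventLp hμ hp hl, Bessel.isResolvent_resolventLp hμ hp hl,
      Bessel.norm_resolventLp_le hμ hp hl, Bessel.hankelConv_Lp hμ hp hl⟩⟩,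
    Bessel.isClosed_besselLinf hμ,
    Bessel.isNonnegative_of_resolvent fun l hl => ⟨Bessel.resolventLinf hμ hl,
      Bessel.isResolvent_resolventLinf hμ hl, Bessel.norm_resolventLinf_le hμ hl⟩,
    fun l hl => ⟨Bessel.resolventLinf hμ hl, Bessel.isResolvent_resolventLinf hμ hl,
      Bessel.norm_resolventLinf_le hμ hl, fun f =>
      ⟨fun x hx => Bessel.hankelConvExists_Linf hμ hl f hx, Bessel.hankelConv_Linf hμ hl f⟩⟩⟩
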